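/- **Proposition 3.** Let $(M,g)$ be a compact, orientable, smooth Riemannian 2-manifold without boundary, with Riemannian measure $dv_g$ and area $|M|$. Let $$E=\Big\{u\in H^1(M):\int_M u\,dv_g=0\Big\},\qquad \|u\|^2=\int_M|\nabla_g u|^2\,dv_g,\qquad \mu_1(M)=\inf_{u\in E\setminus\{0\}}\frac{\int_M|\nabla_g u|^2\,dv_g}{\int_M u^2\,dv_g},$$ and assume that $8\pi<\mu_1(M)|M|<16\pi$. For $\lambda_1,\lambda_2\ge 0$ and $u\in E$ put $$I_{\lambda_1,\lambda_2}(u)=\frac12\int_M|\nabla_g u|^2\,dv_g-\lambda_1\ln\Big(\frac1{|M|}\int_M e^{u}\,dv_g\Big)-\lambda_2\ln\Big(\frac1{|M|}\int_M e^{-u}\,dv_g\Big),$$ and let $$\Lambda=\{(\lambda_1,\lambda_2)\in[0,\infty)^2:\ \lambda_1+\lambda_2<\mu_1(M)|M|,\ \max\{\lambda_1,\lambda_2\}>8\pi\}.$$ Then for almost every $(\lambda_1,\lambda_2)\in\Lambda$ (with respect to Lebesgue measure) the following holds. There exists $\bar u\in E$ with $\|\bar u\|\ge 1$ and $I_{\lambda_1,\lambda_2}(\bar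 u)<0$; and for every such $\bar u$ the mountain pass level $$c=\inf_{\gamma\in\Gamma}\max_{t\in[0,1]}I_{\lambda_1,\lambda_2}(\gamma(t)),\qquad \Gamma=\{\gamma\in C([0,1],E):\gamma(0)=0,\ \gamma(1)=\bar u\},$$ is positive, and there exists a nonzero critical point $u\in E$ of $I_{\lambda_1,\lambda_2}$ (that is, $I_{\lambda_1,\lambda_2}$ is Fréchet differentiable at $u$ with $I_{\lambda_1,\lambda_2}'(u)=0$) with $I_{\lambda_1,\lambda_2}(u)=c$. -/

import Mathlib

open MeasureTheory Set Bundle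
open scoped Manifold ContDiff ENNReal

set_option linter.unusedSectionVars false

noncomputable section

namespace MeanField

/-- The Euclidean plane, the model space of surfaces. -/
abbrev Plane : Type := EuclideanSpace ℝ (Fin 2)

/-- The `i`-th vector of the standard basis of the plane. -/
abbrev stdVec (i : Fin 2) : Plane := EuclideanSpace.single i (1 : ℝ)

section Surface

variable {M : Type*} [TopologicalSpace M] [ChartedSpace Plane M]

/-- Smooth Riemannian metrics on the surface `M`. -/
abbrev Metric (M : Type*) [TopologicalSpace M] [ChartedSpace Plane M] [IsManifold (𝓡 2) ∞ M] :
    Type _ :=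
  ContMDiffRiemannianMetric (𝓡 2) ∞ Plane (fun p : M ↦ TangentSpace (𝓡 2) p)

/-- Orientability: some family of smooth charts covers `M` and has coordinate changes
with positive Jacobian determinant. -/
def IsOrientable (M : Type*) [TopologicalSpace M] [ChartedSpace Plane M] : Prop :=
  ∃ A : Set (OpenPartialHomeomorph M Plane),
    A ⊆ IsManifold.maximalAtlas (𝓡 2) ∞ M ∧
    (∀ p : M, ∃ e ∈ A, p ∈ e.source) ∧
    ∀ e ∈ A, ∀ e' ∈ A, ∀ y ∈ (e.symm.trans e').source,
      0 < (fderiv ℝ (e.symm.trans e') y).det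

/-- The derivative of the inverse of the preferred chart at `x`, at the point with
coordinates `y`. -/
def chartDeriv (x : M) (y : Plane) :
    Plane →L[ℝ] TangentSpace (𝓡 2) ((chartAt Plane x).symm y) :=
  mfderiv (𝓡 2) (𝓡 2) (chartAt Plane x).symm y

/-- The coordinate vector field `∂ᵢ` of the preferred chart at `x`, at the point with
coordinates `y`. -/
def coordVec (x : M) (y : Plane) (i : Fin 2) : TangentSpace (𝓡 2) ((chartAt Plane x).symm y) :=
  chartDeriv x y (stdVec i)

variable [IsManifold (𝓡 2) ∞ M]

/-- The matrix `(gᵢⱼ)` of the metric in the preferred chart at `x`, at the point with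
coordinates `y`. -/
def gram (g : Metric M) (x : M) (y : Plane) : Matrix (Fin 2) (Fin 2) ℝ :=
  Matrix.of fun i j ↦ g.inner _ (coordVec x y i) (coordVec x y j)

/-- The measure `√(det gᵢⱼ) dy` of the preferred chart at `x`, carried over to `M`
(it vanishes outside the domain of the chart). -/
def chartVolume [MeasurableSpace M] (g : Metric M) (x : M) : Measure M :=
  ((volume.restrict (chartAt Plane x).target).withDensity
    (fun y ↦ ENNReal.ofReal (Real.sqrt (gram g x y).det))).map (chartAt Plane x).symm

/-- The Riemannian volume measure `dv_g`: the measure that agrees with `√(det gᵢⱼ) dy` in every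
chart. As the chart measures agree on overlaps of charts, it is their supremum. -/
def riemannianVolume [MeasurableSpace M] (g : Metric M) : Measure M :=
  ⨆ x : M, chartVolume g x

end Surface

/-- `w` is the weak `i`-th partial derivative of `f` on the open set `Ω` of the plane. -/
structure HasWeakPartialDeriv (Ω : Set Plane) (i : Fin 2) (f w : Plane → ℝ) : Prop where
  locInt : LocallyIntegrableOn f Ω
  locInt_deriv : LocallyIntegrableOn w Ω
  parts : ∀ ψ : Plane → ℝ, ContDiff ℝ ∞ ψ → HasCompactSupport ψ → tsupport ψ ⊆ Ω →
    ∫ y in Ω, f y * fderiv ℝ ψ y (stdVec i) = - ∫ y in Ω, w y * ψ y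

section Sobolev

variable {M : Type*} [TopologicalSpace M] [ChartedSpace Plane M] [IsManifold (𝓡 2) ∞ M]

/-- The `i`-th covariant component `g(X, ∂ᵢ)` of a vector field in the preferred chart at `x`. -/
def component (g : Metric M) (X : ∀ p : M, TangentSpace (𝓡 2) p) (x : M) (i : Fin 2)
    (y : Plane) : ℝ :=
  g.inner _ (X ((chartAt Plane x).symm y)) (coordVec x y i)

/-- `X` is a square integrable weak gradient of `u`: it is a Borel vector field whose components
`g(X, ∂ᵢ)` are the weak partial derivatives of `u` in the charts, and `∫ |X|² dv_g < ∞`. -/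
structure IsWeakGradient [MeasurableSpace M] (g : Metric M) (u : M → ℝ)
    (X : ∀ p : M, TangentSpace (𝓡 2) p) : Prop where
  measurable : ∀ x i,
    Measurable fun y : (chartAt Plane x).target ↦ component g X x i (y : Plane)
  weak : ∀ x i, HasWeakPartialDeriv (chartAt Plane x).target i
    (fun y ↦ u ((chartAt Plane x).symm y)) (component g X x i)
  sq_integrable : Integrable (fun p ↦ g.inner p (X p) (X p)) (riemannianVolume g)

/-! ### The facts that make the Sobolev space a vector space with an inner product -/

lemma coordVec_span (x : M) {y : Plane} (hy : y ∈ (chartAt Plane x).target)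
    (v : TangentSpace (𝓡 2) ((chartAt Plane x).symm y)) :
    ∃ a : Fin 2 → ℝ, v = a 0 • coordVec x y 0 + a 1 • coordVec x y 1 := by
  have hd := (mdifferentiable_chart (I := 𝓡 2) x).symm
  have hsurj : Function.Surjective (chartDeriv x y) := hd.mfderiv_surjective (x := y) hy
  obtain ⟨w, rfl⟩ := hsurj v
  refine ⟨fun i ↦ w i, ?_⟩
  have hw : w = w 0 • stdVec 0 + w 1 • stdVec 1 := by
    ext i; fin_cases i <;> simp
  unfold coordVec
  rw [← map_smul, ← map_smul, ← map_add]
  exact congrArg _ hw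

lemma coordVec_indep (x : M) {y : Plane} (hy : y ∈ (chartAt Plane x).target)
    (a b : ℝ) (h : a • coordVec x y 0 + b • coordVec x y 1 = 0) : a = 0 ∧ b = 0 := by
  have hd := (mdifferentiable_chart (I := 𝓡 2) x).symm
  have hinj : Function.Injective (chartDeriv x y) := hd.mfderiv_injective (x := y) hy
  unfold coordVec at h
  rw [← map_smul, ← map_smul, ← map_add] at h
  have h0 : (a • stdVec 0 + b • stdVec 1 : Plane) = 0 := hinj (h.trans (map_zero _).symm)
  have h1 := congrArg (fun v : Plane ↦ v 0) h0
  have h2 := congrArg (fun v : Plane ↦ v 1) h0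
  simp at h1 h2
  exact ⟨h1, h2⟩

lemma metric_nonneg (g : Metric M) (p : M) (v : TangentSpace (𝓡 2) p) : 0 ≤ g.inner p v v := by
  by_cases hv : v = 0
  · simp [hv]
  · exact (g.pos p v hv).le

lemma gram_det (g : Metric M) (x : M) (y : Plane) :
    (gram g x y).det = g.inner _ (coordVec x y 0) (coordVec x y 0) *
      g.inner _ (coordVec x y 1) (coordVec x y 1) -
      g.inner _ (coordVec x y 0) (coordVec x y 1) ^ 2 := by
  rw [Matrix.det_fin_two]
  simp only [gram, Matrix.of_apply]
  rw [g.symm _ (coordVec x y 1) (coordVec x y 0)]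
  ring

lemma gram_det_pos (g : Metric M) (x : M) {y : Plane} (hy : y ∈ (chartAt Plane x).target) :
    0 < (gram g x y).det := by
  rw [gram_det]
  set A := g.inner _ (coordVec x y 0) (coordVec x y 0) with hA
  set B := g.inner _ (coordVec x y 0) (coordVec x y 1) with hB
  set C := g.inner _ (coordVec x y 1) (coordVec x y 1) with hC
  have hBs : g.inner _ (coordVec x y 1) (coordVec x y 0) = B := g.symm _ _ _
  have hApos : 0 < A := by
    refine g.pos _ _ fun h ↦ ?_
    have := coordVec_indep x hy 1 0 (by simp [h])
    simp at this
  have hne : (-B) • coordVec x y 0 + A • coordVec x y 1 ≠ 0 := fun h ↦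
    hApos.ne' (coordVec_indep x hy _ _ h).2
  have h := g.pos _ _ hne
  simp only [map_add, map_smul, add_apply, smul_apply,
    smul_eq_mul, ← hA, ← hB, ← hC, hBs] at h
  have h' : 0 < A * (A * C - B ^ 2) := by nlinarith
  exact (mul_pos_iff_of_pos_left hApos).1 h'

lemma coordVec_contMDiffOn (x : M) (i : Fin 2) :
    ContMDiffOn (𝓡 2) (𝓡 2).tangent 0
      (fun y ↦ (⟨(chartAt Plane x).symm y, coordVec x y i⟩ : TangentBundle (𝓡 2) M))
      (chartAt Plane x).target := by
  have h1 : ContMDiffOn (𝓡 2) (𝓡 2) ∞ (chartAt Plane x).symm (chartAt Plane x).target :=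
    contMDiffOn_chart_symm
  have hopen := (chartAt Plane x).open_target
  have h2 := h1.contMDiffOn_tangentMapWithin (m := 0) (by simp) hopen.uniqueMDiffOn
  have h3 : ContMDiff (𝓡 2) (𝓡 2).tangent 0
      (fun y : Plane ↦ (⟨y, stdVec i⟩ : TangentBundle (𝓡 2) Plane)) :=
    contMDiff_vectorSpace_iff_contDiff.2 contDiff_const
  refine (h2.comp h3.contMDiffOn (s := (chartAt Plane x).target) (fun y hy ↦ hy)).congr ?_
  intro y hy
  simp only [Function.comp, tangentMapWithin, mfderivWithin_of_isOpen hopen hy]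
  rfl

lemma gram_continuousOn (g : Metric M) (x : M) (i j : Fin 2) :
    ContinuousOn (fun y ↦ g.inner _ (coordVec x y i) (coordVec x y j))
      (chartAt Plane x).target := by
  let _ : RiemannianBundle (fun p : M ↦ TangentSpace (𝓡 2) p) := ⟨g.toRiemannianMetric⟩
  have _ : IsContMDiffRiemannianBundle (𝓡 2) 0 Plane (fun p : M ↦ TangentSpace (𝓡 2) p) :=
    IsContMDiffRiemannianBundle.of_le (n := ∞) (by simp)
  exact (ContMDiffOn.inner_bundle (coordVec_contMDiffOn x i)
    (coordVec_contMDiffOn x j)).continuousOn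

/-- The inverse matrix formula `g(X, Y) = ∑ gⁱʲ Xᵢ Yⱼ`. -/
lemma inner_eq_components (g : Metric M) (X Y : ∀ p : M, TangentSpace (𝓡 2) p) (x : M)
    {y : Plane} (hy : y ∈ (chartAt Plane x).target) :
    g.inner ((chartAt Plane x).symm y) (X _) (Y _) = ((gram g x y).det)⁻¹ *
      (g.inner _ (coordVec x y 1) (coordVec x y 1) * component g X x 0 y * component g Y x 0 y
      - g.inner _ (coordVec x y 0) (coordVec x y 1) *
        (component g X x 0 y * component g Y x 1 y + component g X x 1 y * component g Y x 0 y)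
      + g.inner _ (coordVec x y 0) (coordVec x y 0) *
        component g X x 1 y * component g Y x 1 y) := by
  rw [eq_inv_mul_iff_mul_eq₀ (gram_det_pos g x hy).ne', gram_det]
  obtain ⟨a, ha⟩ := coordVec_span x hy (X _)
  obtain ⟨b, hb⟩ := coordVec_span x hy (Y _)
  simp only [component, ha, hb, map_add, map_smul, add_apply,
    smul_apply, smul_eq_mul, g.symm _ (coordVec x y 1) (coordVec x y 0)]
  ring

lemma measurable_inner [CompactSpace M] [MeasurableSpace M] [BorelSpace M] (g : Metric M)
    {X Y : ∀ p : M, TangentSpace (𝓡 2) p}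
    (hX : ∀ x i, Measurable fun y : (chartAt Plane x).target ↦ component g X x i (y : Plane))
    (hY : ∀ x i, Measurable fun y : (chartAt Plane x).target ↦ component g Y x i (y : Plane)) :
    Measurable fun p ↦ g.inner p (X p) (Y p) := by
  have hloc : ∀ x : M, Measurable fun p : (chartAt Plane x).source ↦ g.inner p (X p) (Y p) := by
    intro x
    have hG (i j : Fin 2) : Measurable fun y : (chartAt Plane x).target ↦
        g.inner _ (coordVec x (y : Plane) i) (coordVec x (y : Plane) j) :=
      (continuousOn_iff_continuous_domRestrict.1 (gram_continuousOn g x i j)).measurable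
    have hF : Measurable fun y : (chartAt Plane x).target ↦
        g.inner ((chartAt Plane x).symm (y : Plane)) (X _) (Y _) := by
      have h := ((((hG 0 0).mul (hG 1 1)).sub ((hG 0 1).pow_const 2)).inv.mul
        (((((hG 1 1).mul (hX x 0)).mul (hY x 0)).sub ((hG 0 1).mul
          (((hX x 0).mul (hY x 1)).add ((hX x 1).mul (hY x 0))))).add
          (((hG 0 0).mul (hX x 1)).mul (hY x 1))))
      convert h using 1
      ext y
      rw [inner_eq_components g X Y x y.2, gram_det]
      rfl
    have hφ : Measurable fun p : (chartAt Plane x).source ↦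
        (⟨chartAt Plane x p, (chartAt Plane x).map_source p.2⟩ : (chartAt Plane x).target) :=
      Measurable.subtype_mk
        (continuousOn_iff_continuous_domRestrict.1 (chartAt Plane x).continuousOn).measurable
    convert hF.comp hφ using 2 with p
    simp only [Function.comp]
    rw [(chartAt Plane x).left_inv p.2]
  obtain ⟨t, -, ht⟩ := isCompact_univ.elim_nhds_subcover
    (fun x : M ↦ (chartAt Plane x).source) (fun x _ ↦ chart_source_mem_nhds Plane x)
  intro s hs
  have : (fun p ↦ g.inner p (X p) (Y p)) ⁻¹' s = ⋃ x ∈ t, Subtype.val ''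
      ((fun p : (chartAt Plane x).source ↦ g.inner (p : M) (X p) (Y p)) ⁻¹' s) := by
    ext p
    simp only [mem_preimage, mem_iUnion, mem_image, Subtype.exists, exists_and_right,
      exists_eq_right]
    constructor
    · intro hp
      obtain ⟨x, hx, hpx⟩ := mem_iUnion₂.1 (ht (mem_univ p))
      exact ⟨x, hx, hpx, hp⟩
    · rintro ⟨x, hx, hpx, hp⟩
      exact hp
  rw [this]
  exact t.measurableSet_biUnion fun x _ ↦
    (chartAt Plane x).open_source.measurableSet.subtype_image (hloc x hs)

section Volume

variable [MeasurableSpace M] [BorelSpace M]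

lemma chart_symm_aemeasurable (x : M) : AEMeasurable (chartAt Plane x).symm
    (volume.restrict (chartAt Plane x).target) :=
  (chartAt Plane x).continuousOn_symm.aemeasurable (chartAt Plane x).open_target.measurableSet

lemma density_aemeasurable (g : Metric M) (x : M) :
    AEMeasurable (fun y ↦ ENNReal.ofReal (Real.sqrt (gram g x y).det))
      (volume.restrict (chartAt Plane x).target) := by
  have hm := (chartAt Plane x).open_target.measurableSet
  have hG (i j : Fin 2) := (gram_continuousOn g x i j).aemeasurable (μ := volume) hm
  simp only [gram_det]
  exact ((((hG 0 0).mul (hG 1 1)).sub ((hG 0 1).pow_const 2)).sqrt).ennreal_ofReal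

lemma chartVolume_le (g : Metric M) (x : M) : chartVolume g x ≤ riemannianVolume g :=
  le_iSup (chartVolume g) x

/-- A property that holds almost everywhere for `dv_g` holds almost everywhere in charts. -/
lemma ae_chart (g : Metric M) {P : M → Prop} (h : ∀ᵐ p ∂(riemannianVolume g), P p) (x : M) :
    ∀ᵐ y ∂(volume.restrict (chartAt Plane x).target), P ((chartAt Plane x).symm y) := by
  have h1 : ∀ᵐ p ∂(chartVolume g x), P p := ae_mono (chartVolume_le g x) h
  have h2 := ae_of_ae_map
    ((chart_symm_aemeasurable x).mono_ac (withDensity_absolutelyContinuous _ _)) h1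
  rw [ae_withDensity_iff' (density_aemeasurable g x)] at h2
  filter_upwards [h2, ae_restrict_mem (chartAt Plane x).open_target.measurableSet] with y hy hyt
  refine hy ?_
  simpa using gram_det_pos g x hyt

/-- A Borel property that holds almost everywhere in charts holds almost everywhere for `dv_g`. -/
lemma ae_of_ae_chart (g : Metric M) {P : M → Prop} (hP : MeasurableSet {p | P p})
    (h : ∀ x : M, ∀ᵐ y ∂(volume.restrict (chartAt Plane x).target),
      P ((chartAt Plane x).symm y)) : ∀ᵐ p ∂(riemannianVolume g), P p := by
  have h1 (x : M) : ∀ᵐ p ∂(chartVolume g x), P p := by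
    refine (ae_map_iff ((chart_symm_aemeasurable x).mono_ac
      (withDensity_absolutelyContinuous _ _)) hP).2 ?_
    exact (withDensity_absolutelyContinuous _ _).ae_le (h x)
  have h2 : riemannianVolume g ≤ (riemannianVolume g).restrict {p | P p} := by
    refine iSup_le fun x ↦ ?_
    rw [← Measure.restrict_eq_self_of_ae_mem (h1 x)]
    exact Measure.restrict_mono le_rfl (chartVolume_le g x)
  exact ae_mono h2 (ae_restrict_mem hP)

end Volume

lemma HasWeakPartialDeriv.congr {Ω : Set Plane} {i : Fin 2} {f f' w : Plane → ℝ}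
    (h : HasWeakPartialDeriv Ω i f w) (hf : f =ᵐ[volume.restrict Ω] f') :
    HasWeakPartialDeriv Ω i f' w where
  locInt x hx := by
    obtain ⟨s, hs, hint⟩ := h.locInt x hx
    refine ⟨s ∩ Ω, Filter.inter_mem hs self_mem_nhdsWithin, ?_⟩
    exact (hint.mono_set inter_subset_left).congr
      (ae_mono (Measure.restrict_mono inter_subset_right le_rfl) hf)
  locInt_deriv := h.locInt_deriv
  parts ψ h1 h2 h3 := by
    rw [← h.parts ψ h1 h2 h3]
    refine integral_congr_ae ?_
    filter_upwards [hf] with y hy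
    rw [hy]

lemma integrable_mul_test {Ω : Set Plane} {f ψ : Plane → ℝ} (hf : LocallyIntegrableOn f Ω)
    (hψ : Continuous ψ) (hc : HasCompactSupport ψ) (hs : tsupport ψ ⊆ Ω) :
    Integrable (fun y ↦ f y * ψ y) (volume.restrict Ω) := by
  have h1 : IntegrableOn f (tsupport ψ) := hf.integrableOn_compact_subset hs hc
  have h2 : IntegrableOn (fun y ↦ f y * ψ y) (tsupport ψ) :=
    h1.mul_continuousOn hψ.continuousOn hc
  refine Integrable.integrableOn ?_
  refine (integrableOn_iff_integrable_of_support_subset ?_).1 h2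
  exact (Function.support_mul_subset_right _ _).trans (subset_tsupport ψ)

lemma HasWeakPartialDeriv.add {Ω : Set Plane} {i : Fin 2} {f f' w w' : Plane → ℝ}
    (h : HasWeakPartialDeriv Ω i f w) (h' : HasWeakPartialDeriv Ω i f' w') :
    HasWeakPartialDeriv Ω i (fun y ↦ f y + f' y) (fun y ↦ w y + w' y) where
  locInt := h.locInt.add h'.locInt
  locInt_deriv := h.locInt_deriv.add h'.locInt_deriv
  parts ψ h1 h2 h3 := by
    have hc : Continuous fun y ↦ fderiv ℝ ψ y (stdVec i) :=
      (h1.continuous_fderiv (by simp)).clm_apply continuous_const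
    have hcs : HasCompactSupport fun y ↦ fderiv ℝ ψ y (stdVec i) := h2.fderiv_apply ℝ _
    have hss : tsupport (fun y ↦ fderiv ℝ ψ y (stdVec i)) ⊆ Ω :=
      (tsupport_fderiv_apply_subset ℝ _).trans h3
    simp only [add_mul]
    rw [integral_add (integrable_mul_test h.locInt hc hcs hss)
      (integrable_mul_test h'.locInt hc hcs hss),
      integral_add (integrable_mul_test h.locInt_deriv h1.continuous h2 h3)
      (integrable_mul_test h'.locInt_deriv h1.continuous h2 h3),
      h.parts ψ h1 h2 h3, h'.parts ψ h1 h2 h3]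
    ring

lemma HasWeakPartialDeriv.smul {Ω : Set Plane} {i : Fin 2} {f w : Plane → ℝ}
    (h : HasWeakPartialDeriv Ω i f w) (c : ℝ) :
    HasWeakPartialDeriv Ω i (fun y ↦ c * f y) (fun y ↦ c * w y) where
  locInt := h.locInt.smul c
  locInt_deriv := h.locInt_deriv.smul c
  parts ψ h1 h2 h3 := by
    simp only [mul_assoc, integral_const_mul]
    rw [h.parts ψ h1 h2 h3]
    ring

lemma HasWeakPartialDeriv.unique {Ω : Set Plane} {i : Fin 2} {f w w' : Plane → ℝ}
    (hΩ : IsOpen Ω) (h : HasWeakPartialDeriv Ω i f w) (h' : HasWeakPartialDeriv Ω i f w') :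
    w =ᵐ[volume.restrict Ω] w' := by
  have key := hΩ.ae_eq_zero_of_integral_contDiff_smul_eq_zero
    (h.locInt_deriv.sub h'.locInt_deriv) (μ := volume) ?_
  · rw [Filter.EventuallyEq, ae_restrict_iff' hΩ.measurableSet]
    filter_upwards [key] with y hy hyΩ
    exact sub_eq_zero.1 (hy hyΩ)
  · intro ψ h1 h2 h3
    have e : ∫ y in Ω, w y * ψ y = ∫ y in Ω, w' y * ψ y := by
      have := h.parts ψ h1 h2 h3
      have := h'.parts ψ h1 h2 h3
      linarith
    have hsupp : Function.support (fun y ↦ ψ y • (w - w') y) ⊆ Ω :=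
      (Function.support_smul_subset_left _ _).trans ((subset_tsupport ψ).trans h3)
    rw [← setIntegral_eq_integral_of_forall_compl_eq_zero
      (s := Ω) (fun y hy ↦ Function.notMem_support.1 fun hh ↦ hy (hsupp hh))]
    have e2 : (fun y ↦ ψ y • (w - w') y) = fun y ↦ w y * ψ y - w' y * ψ y := by
      ext y; simp; ring
    rw [e2, integral_sub (integrable_mul_test h.locInt_deriv h1.continuous h2 h3)
      (integrable_mul_test h'.locInt_deriv h1.continuous h2 h3), e, sub_self]

lemma component_add (g : Metric M) (X Y : ∀ p : M, TangentSpace (𝓡 2) p) (x : M) (i : Fin 2) :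
    component g (fun p ↦ X p + Y p) x i = fun y ↦ component g X x i y + component g Y x i y := by
  ext y; simp [component]

lemma component_sub (g : Metric M) (X Y : ∀ p : M, TangentSpace (𝓡 2) p) (x : M) (i : Fin 2) :
    component g (fun p ↦ X p - Y p) x i = fun y ↦ component g X x i y - component g Y x i y := by
  ext y; simp [component]

lemma component_smul (g : Metric M) (c : ℝ) (X : ∀ p : M, TangentSpace (𝓡 2) p) (x : M)
    (i : Fin 2) : component g (fun p ↦ c • X p) x i = fun y ↦ c * component g X x i y := by
  ext y; simp [component]

lemma component_zero (g : Metric M) (x : M) (i : Fin 2) :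
    component g (fun _ ↦ 0) x i = fun _ ↦ 0 := by
  ext y; simp [component]

section Gradient

variable [CompactSpace M] [MeasurableSpace M] [BorelSpace M] {g : Metric M} {u v : M → ℝ}
  {X Y : ∀ p : M, TangentSpace (𝓡 2) p}

lemma IsWeakGradient.congr (h : IsWeakGradient g u X) (huv : u =ᵐ[riemannianVolume g] v) :
    IsWeakGradient g v X where
  measurable := h.measurable
  weak x i := (h.weak x i).congr (ae_chart g huv x)
  sq_integrable := h.sq_integrable

lemma IsWeakGradient.smul (h : IsWeakGradient g u X) (c : ℝ) :
    IsWeakGradient g (fun p ↦ c * u p) (fun p ↦ c • X p) where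
  measurable x i := by
    rw [component_smul]; exact (h.measurable x i).const_mul c
  weak x i := by
    rw [component_smul]; exact (h.weak x i).smul c
  sq_integrable := by
    simpa using (h.sq_integrable.const_mul c).const_mul c

lemma IsWeakGradient.inner_integrable (h : IsWeakGradient g u X) (h' : IsWeakGradient g v Y) :
    Integrable (fun p ↦ g.inner p (X p) (Y p)) (riemannianVolume g) := by
  refine (h.sq_integrable.add h'.sq_integrable).mono'
    (measurable_inner g h.measurable h'.measurable).aestronglyMeasurable
    (Filter.Eventually.of_forall fun p ↦ ?_)
  have h1 := metric_nonneg g p (X p + Y p)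
  have h2 := metric_nonneg g p (X p - Y p)
  have h3 := metric_nonneg g p (X p)
  have h4 := metric_nonneg g p (Y p)
  simp only [map_add, map_sub, add_apply, sub_apply, g.symm p (Y p) (X p)] at h1 h2
  simp only [Pi.add_apply, Real.norm_eq_abs]
  exact abs_le.2 ⟨by linarith, by linarith⟩

lemma IsWeakGradient.add (h : IsWeakGradient g u X) (h' : IsWeakGradient g v Y) :
    IsWeakGradient g (fun p ↦ u p + v p) (fun p ↦ X p + Y p) where
  measurable x i := by
    rw [component_add]; exact (h.measurable x i).add (h'.measurable x i)
  weak x i := by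
    rw [component_add]; exact (h.weak x i).add (h'.weak x i)
  sq_integrable := by
    have := (h.sq_integrable.add (h.inner_integrable h')).add
      ((h'.inner_integrable h).add h'.sq_integrable)
    refine this.congr (Filter.Eventually.of_forall fun p ↦ ?_)
    simp only [Pi.add_apply, map_add, add_apply]
    ring

lemma isWeakGradient_zero (g : Metric M) : IsWeakGradient g (fun _ ↦ 0) (fun _ ↦ 0) where
  measurable x i := by rw [component_zero]; exact measurable_const
  weak x i := by
    rw [component_zero]
    exact ⟨locallyIntegrableOn_const 0, locallyIntegrableOn_const 0, by simp⟩
  sq_integrable := by simp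

lemma IsWeakGradient.unique (h : IsWeakGradient g u X) (h' : IsWeakGradient g u Y) :
    ∀ᵐ p ∂(riemannianVolume g), X p = Y p := by
  have hm : ∀ x i, Measurable fun y : (chartAt Plane x).target ↦
      component g (fun p ↦ X p - Y p) x i (y : Plane) := fun x i ↦ by
    rw [component_sub]; exact (h.measurable x i).sub (h'.measurable x i)
  have key : ∀ᵐ p ∂(riemannianVolume g), g.inner p (X p - Y p) (X p - Y p) = 0 := by
    refine ae_of_ae_chart g (measurable_inner g hm hm (measurableSet_singleton 0)) fun x ↦ ?_
    have hopen := (chartAt Plane x).open_target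
    filter_upwards [(h.weak x 0).unique hopen (h'.weak x 0),
      (h.weak x 1).unique hopen (h'.weak x 1), ae_restrict_mem hopen.measurableSet] with y h0 h1 hy
    have e0 : component g (fun p ↦ X p - Y p) x 0 y = 0 := by
      simpa [component, sub_eq_zero] using h0
    have e1 : component g (fun p ↦ X p - Y p) x 1 y = 0 := by
      simpa [component, sub_eq_zero] using h1
    rw [inner_eq_components g (fun p ↦ X p - Y p) (fun p ↦ X p - Y p) x hy, e0, e1]
    simp
  filter_upwards [key] with p hp
  by_contra hne
  exact (g.pos p _ (sub_ne_zero.2 hne)).ne' hp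

end Gradient

section Space

variable [CompactSpace M] [MeasurableSpace M] [BorelSpace M]

/-- The Sobolev space `H¹(M)`: the classes in `L²(M)` that have a square integrable weak
gradient. -/
def sobolevH1 (g : Metric M) : Submodule ℝ (Lp ℝ 2 (riemannianVolume g)) where
  carrier := {u | ∃ X, IsWeakGradient g u X}
  add_mem' := by
    rintro u v ⟨X, hX⟩ ⟨Y, hY⟩
    exact ⟨_, (hX.add hY).congr (Lp.coeFn_add u v).symm⟩
  zero_mem' := ⟨_, (isWeakGradient_zero g).congr (Lp.coeFn_zero ℝ 2 _).symm⟩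
  smul_mem' := by
    rintro c u ⟨X, hX⟩
    exact ⟨_, (hX.smul c).congr (Lp.coeFn_smul c u).symm⟩

/-- The space `{u ∈ H¹(M) : ∫ u dv_g = 0}` as a subspace of `L²(M)`. (The integrability of `u`
is automatic, since the volume of `M` is finite.) -/
def meanZeroSubmodule (g : Metric M) : Submodule ℝ (Lp ℝ 2 (riemannianVolume g)) where
  carrier := {u | u ∈ sobolevH1 g ∧ Integrable u (riemannianVolume g) ∧
    ∫ p, u p ∂(riemannianVolume g) = 0}
  add_mem' := by
    rintro u v ⟨hu, hui, hu0⟩ ⟨hv, hvi, hv0⟩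
    refine ⟨add_mem hu hv, (hui.add hvi).congr (Lp.coeFn_add u v).symm, ?_⟩
    rw [integral_congr_ae (Lp.coeFn_add u v)]
    simp only [Pi.add_apply]
    rw [integral_add hui hvi, hu0, hv0, add_zero]
  zero_mem' := by
    refine ⟨zero_mem _, (integrable_zero _ _ _).congr (Lp.coeFn_zero ℝ 2 _).symm, ?_⟩
    rw [integral_congr_ae (Lp.coeFn_zero ℝ 2 _)]
    simp
  smul_mem' := by
    rintro c u ⟨hu, hui, hu0⟩
    refine ⟨Submodule.smul_mem _ c hu, (hui.smul c).congr (Lp.coeFn_smul c u).symm, ?_⟩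
    rw [integral_congr_ae (Lp.coeFn_smul c u)]
    simp only [Pi.smul_apply]
    rw [integral_smul, hu0, smul_zero]

/-- The space `E = {u ∈ H¹(M) : ∫ u dv_g = 0}`, to be equipped with the Dirichlet norm
(not with the norm of `L²`). -/
def E (g : Metric M) : Type _ := meanZeroSubmodule g

instance (g : Metric M) : AddCommGroup (E g) := inferInstanceAs (AddCommGroup (meanZeroSubmodule g))

instance (g : Metric M) : Module ℝ (E g) := inferInstanceAs (Module ℝ (meanZeroSubmodule g))

variable {g : Metric M}

/-- The class in `L²(M)` of an element of `E`. -/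
def E.toLp (u : E g) : Lp ℝ 2 (riemannianVolume g) := (show meanZeroSubmodule g from u).1

/-- An element of `E` as a function on `M`, defined up to sets of measure zero. -/
def E.fn (u : E g) : M → ℝ := u.toLp

/-- The weak gradient `∇_g u`, unique up to sets of measure zero. -/
def E.grad (u : E g) : ∀ p : M, TangentSpace (𝓡 2) p :=
  Classical.choose (show meanZeroSubmodule g from u).2.1

lemma E.isWeakGradient (u : E g) : IsWeakGradient g u.fn u.grad :=
  Classical.choose_spec (show meanZeroSubmodule g from u).2.1

lemma E.grad_add (u v : E g) :
    ∀ᵐ p ∂(riemannianVolume g), (u + v).grad p = u.grad p + v.grad p :=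
  (u + v).isWeakGradient.unique
    ((u.isWeakGradient.add v.isWeakGradient).congr (Lp.coeFn_add u.toLp v.toLp).symm)

lemma E.grad_smul (c : ℝ) (u : E g) :
    ∀ᵐ p ∂(riemannianVolume g), (c • u).grad p = c • u.grad p :=
  (c • u).isWeakGradient.unique
    ((u.isWeakGradient.smul c).congr (Lp.coeFn_smul c u.toLp).symm)

/-- The Dirichlet form `∫ g(∇u, ∇v) dv_g` as a positive semidefinite inner product on `E`. -/
@[reducible] def dirichletCore (g : Metric M) : PreInnerProductSpace.Core ℝ (E g) where
  inner u v := ∫ p, g.inner p (u.grad p) (v.grad p) ∂(riemannianVolume g)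
  conj_inner_symm u v := by
    simp only [conj_trivial]
    exact integral_congr_ae (Filter.Eventually.of_forall fun p ↦ g.symm p _ _)
  re_inner_nonneg u := integral_nonneg fun p ↦ metric_nonneg g p _
  add_left u v w := by
    rw [← integral_add (u.isWeakGradient.inner_integrable w.isWeakGradient)
      (v.isWeakGradient.inner_integrable w.isWeakGradient)]
    refine integral_congr_ae ?_
    filter_upwards [E.grad_add u v] with p hp
    simp [hp]
  smul_left u v c := by
    simp only [conj_trivial]
    rw [← integral_const_mul]
    refine integral_congr_ae ?_
    filter_upwards [E.grad_smul c u] with p hp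
    simp [hp]

/-- The norm `‖u‖² = ∫ |∇_g u|² dv_g` of `E`. (On a disconnected surface it is only a
seminorm; it is a norm as soon as the first eigenvalue defined below is positive.) -/
instance (g : Metric M) : SeminormedAddCommGroup (E g) :=
  @InnerProductSpace.Core.toSeminormedAddCommGroup ℝ (E g) _ _ _ (dirichletCore g)

instance (g : Metric M) : InnerProductSpace ℝ (E g) :=
  InnerProductSpace.ofCore (dirichletCore g)

lemma E.norm_sq (u : E g) :
    ‖u‖ ^ 2 = ∫ p, g.inner p (u.grad p) (u.grad p) ∂(riemannianVolume g) :=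
  (real_inner_self_eq_norm_sq u).symm

/-- The area `|M|`. -/
def area (g : Metric M) : ℝ := (riemannianVolume g).real univ

/-- The first eigenvalue `μ₁(M) = inf { ∫ |∇u|² / ∫ u² : u ∈ E, u ≠ 0 }`. -/
def firstEigenvalue (g : Metric M) : ℝ :=
  ⨅ u : {u : E g // u ≠ 0},
    (∫ p, g.inner p (u.1.grad p) (u.1.grad p) ∂(riemannianVolume g)) /
      ∫ p, u.1.fn p ^ 2 ∂(riemannianVolume g)

/-- The functional `I_{λ₁,λ₂}` on `E`, with `l = (λ₁, λ₂)`. -/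
def functional (g : Metric M) (l : ℝ × ℝ) (u : E g) : ℝ :=
  1 / 2 * ∫ p, g.inner p (u.grad p) (u.grad p) ∂(riemannianVolume g)
    - l.1 * Real.log (1 / area g * ∫ p, Real.exp (u.fn p) ∂(riemannianVolume g))
    - l.2 * Real.log (1 / area g * ∫ p, Real.exp (-u.fn p) ∂(riemannianVolume g))

/-- The parameter set `Λ`. -/
def paramSet (g : Metric M) : Set (ℝ × ℝ) :=
  {l | 0 ≤ l.1 ∧ 0 ≤ l.2 ∧ l.1 + l.2 < firstEigenvalue g * area g ∧
    8 * Real.pi < max l.1 l.2}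

/-- The mountain pass level `c = inf_γ max_t I_{λ₁,λ₂}(γ(t))` over the continuous paths `γ` in
`E` from `0` to `ubar`. -/
def mountainPassLevel (g : Metric M) (l : ℝ × ℝ) (ubar : E g) : ℝ :=
  ⨅ γ : Path (0 : E g) ubar, ⨆ t : unitInterval, functional g l (γ t)

end Space

end Sobolev

end MeanField

end

/-! Write P(u) = log(|M|⁻¹ ∫ e^u) and Q(u) = P(-u), so that I = ½‖u‖² - λ₁P - λ₂Q. On mean-zero
functions P is nonnegative and convex. At the origin P is at most ∫u²/(2|M|) up to a cubic error, so
the Poincaré inequality and λ₁ + λ₂ < μ₁|M| make 0 a strict local minimum (`E.exists_local_min`).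
Since some λᵢ exceeds 8π, logarithmic bubbles concentrating at a point drive I to -∞
(`exists_energy_lt`, `exists_functional_neg`). This is a mountain pass geometry.

The obstacle is that Palais–Smale sequences need not be bounded once a parameter exceeds 8π.
Struwe's monotonicity trick avoids this at almost every parameter. When both parameters increase
together I decreases, so the level is monotone along every diagonal and differentiable almost
everywhere on it. By Fubini, almost every (λ₁, λ₂) has bounded backward difference quotients of the
level. At such a point take a path that is nearly optimal for slightly smaller parameters. Comparing
the two energies near its top bounds P + Q there, hence also ‖u‖. If no bounded almost critical
points existed, one gradient step along the path would push its maximum below the level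
(`exists_bounded_almost_critical`). Convexity of P and Q makes this step decrease the energy without
any Lipschitz bound on the gradient (`energy_descent`).

Bounded almost critical sequences converge because the gradients of P and Q are compact: they are
the Gibbs densities e^u/∫e^u, pulled back by the adjoint of the inclusion of E in L²
(`E.exists_isCompactPotential`). Compactness rests on the Rellich theorem (`E.rellich`) and on
integrability of e^{p|u|} for every p, uniformly on bounded sets (`E.exists_exp_bound`). No sharp
Moser–Trudinger constant is needed. Both are proved in the plane and transported by charts and
cutoffs.

The exceptional null set must not depend on the endpoint of the paths. Endpoints from a countable
dense set suffice, since nearby endpoints joined by a segment of nonpositive energy have the same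
level (`ae_mountainPass`). -/

noncomputable section

namespace MeanField

open Filter Topology
open scoped RealInnerProductSpace

/-! ### Abstract mountain pass theorem with Struwe's monotonicity trick -/

section MountainPass

variable {H : Type*} [NormedAddCommGroup H] [InnerProductSpace ℝ H]

/-- `P` is a nonnegative convex function vanishing at the origin, whose gradient `p` is continuous
and maps bounded sequences to sequences with convergent subsequences. -/
structure IsCompactPotential (P : H → ℝ) (p : H → H) : Prop where
  nonneg : ∀ u, 0 ≤ P u
  zero : P 0 = 0
  cont : Continuous p
  tangent : ∀ u w, P u + ⟪p u, w - u⟫ ≤ P w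
  compact : ∀ (u : ℕ → H) (R : ℝ), (∀ n, ‖u n‖ ≤ R) →
    ∃ φ : ℕ → ℕ, StrictMono φ ∧ ∃ z, Tendsto (fun n ↦ p (u (φ n))) atTop (𝓝 z)

/-- The tangent inequalities at `u` and at `w` trap the first-order remainder between 0 and `⟪p w -
p u, w - u⟫`, which is o(‖w - u‖) because `p` is continuous. Thus no differentiation under an
integral sign is ever needed. -/
lemma IsCompactPotential.hasFDerivAt {P : H → ℝ} {p : H → H} (h : IsCompactPotential P p)
    (u : H) : HasFDerivAt P (innerSL ℝ (p u)) u := by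
  rw [hasFDerivAt_iff_isLittleO, Asymptotics.isLittleO_iff]
  intro c hc
  have h1 : ∀ᶠ w in 𝓝 u, ‖p w - p u‖ < c := by
    have := (h.cont.tendsto u).sub_const (p u) |>.norm
    simp only [sub_self, norm_zero] at this
    exact this.eventually_lt_const hc
  filter_upwards [h1] with w hw
  have h2 := h.tangent u w
  have h3 := h.tangent w u
  have h4 : ⟪p w - p u, w - u⟫ ≤ c * ‖w - u‖ :=
    (real_inner_le_norm _ _).trans (mul_le_mul_of_nonneg_right hw.le (norm_nonneg _))
  rw [inner_sub_left] at h4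
  have h5 : ⟪p w, u - w⟫ = -⟪p w, w - u⟫ := by rw [← neg_sub, inner_neg_right]
  rw [Real.norm_eq_abs, innerSL_apply_apply, abs_le]
  constructor
  · have := mul_nonneg hc.le (norm_nonneg (w - u)); linarith
  · linarith

lemma IsCompactPotential.continuous {P : H → ℝ} {p : H → H} (h : IsCompactPotential P p) :
    Continuous P :=
  continuous_iff_continuousAt.2 fun u ↦ (h.hasFDerivAt u).continuousAt

/-- The functional `½‖u‖² - l₁ P(u) - l₂ Q(u)`. -/
def energy (P Q : H → ℝ) (l : ℝ × ℝ) (u : H) : ℝ := 1 / 2 * ‖u‖ ^ 2 - l.1 * P u - l.2 * Q u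

/-- The gradient of `energy`. -/
def energyGrad (p q : H → H) (l : ℝ × ℝ) (u : H) : H := u - l.1 • p u - l.2 • q u

/-- The mountain pass level of `energy`. -/
def energyLevel (P Q : H → ℝ) (l : ℝ × ℝ) (b : H) : ℝ :=
  ⨅ γ : Path (0 : H) b, ⨆ t : unitInterval, energy P Q l (γ t)

variable {P Q : H → ℝ} {p q : H → H} {l : ℝ × ℝ}

lemma energy_hasFDerivAt (hP : IsCompactPotential P p) (hQ : IsCompactPotential Q q)
    (l : ℝ × ℝ) (u : H) : HasFDerivAt (energy P Q l) (innerSL ℝ (energyGrad p q l u)) u := by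
  have h1 : HasFDerivAt (fun u : H ↦ 1 / 2 * ‖u‖ ^ 2) (innerSL ℝ u) u := by
    have := ((hasStrictFDerivAt_norm_sq (F := H) u).hasFDerivAt).const_mul (1 / 2 : ℝ)
    refine this.congr_fderiv ?_
    ext v; simp
  have := (h1.sub ((hP.hasFDerivAt u).const_mul l.1)).sub ((hQ.hasFDerivAt u).const_mul l.2)
  refine this.congr_fderiv ?_
  ext v
  simp [energyGrad]

lemma energy_continuous (hP : IsCompactPotential P p) (hQ : IsCompactPotential Q q)
    (l : ℝ × ℝ) : Continuous (energy P Q l) :=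
  continuous_iff_continuousAt.2 fun u ↦ (energy_hasFDerivAt hP hQ l u).continuousAt

lemma energyGrad_continuous (hP : IsCompactPotential P p) (hQ : IsCompactPotential Q q)
    (l : ℝ × ℝ) : Continuous (energyGrad p q l) :=
  (continuous_id.sub (hP.cont.const_smul _)).sub (hQ.cont.const_smul _)

lemma energy_zero (hP : IsCompactPotential P p) (hQ : IsCompactPotential Q q) (l : ℝ × ℝ) :
    energy P Q l 0 = 0 := by simp [energy, hP.zero, hQ.zero]

/-- The potentials lie above their tangents and enter with a minus sign, so the energy lies below
its tangent paraboloid of curvature 1. Hence gradient steps of length up to 1 decrease it, with no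
regularity of the gradient, and a single step can replace a deformation flow. -/
lemma energy_descent (hP : IsCompactPotential P p) (hQ : IsCompactPotential Q q)
    (h1 : 0 ≤ l.1) (h2 : 0 ≤ l.2) (u : H) {s : ℝ} (hs0 : 0 ≤ s) (hs1 : s ≤ 1) :
    energy P Q l (u - s • energyGrad p q l u) ≤
      energy P Q l u - s / 2 * ‖energyGrad p q l u‖ ^ 2 := by
  set G := energyGrad p q l u with hG
  have t1 := mul_le_mul_of_nonneg_left (hP.tangent u (u - s • G)) h1
  have t2 := mul_le_mul_of_nonneg_left (hQ.tangent u (u - s • G)) h2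
  have e : u - s • G - u = -(s • G) := by abel
  rw [e, inner_neg_right, inner_smul_right] at t1 t2
  have n1 : ‖u - s • G‖ ^ 2 = ‖u‖ ^ 2 - 2 * (s * ⟪u, G⟫) + s ^ 2 * ‖G‖ ^ 2 := by
    rw [norm_sub_sq_real, inner_smul_right, norm_smul, mul_pow, Real.norm_eq_abs, sq_abs]
  have n2 : ‖G‖ ^ 2 = ⟪u, G⟫ - l.1 * ⟪p u, G⟫ - l.2 * ⟪q u, G⟫ := by
    rw [← real_inner_self_eq_norm_sq]
    nth_rewrite 1 [hG]
    rw [energyGrad, inner_sub_left, inner_sub_left, real_inner_smul_left, real_inner_smul_left]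
  unfold energy
  rw [n1]
  have n3 : s ^ 2 * ‖G‖ ^ 2 ≤ s * ‖G‖ ^ 2 :=
    mul_le_mul_of_nonneg_right (by nlinarith) (sq_nonneg _)
  have n4 : s * ‖G‖ ^ 2 = s * (⟪u, G⟫ - l.1 * ⟪p u, G⟫ - l.2 * ⟪q u, G⟫) := by rw [← n2]
  nlinarith

/-- Compactness of the interval makes the real supremum over a path genuine, rather than the default
value of an unbounded supremum. -/
lemma energy_bddAbove_path (hP : IsCompactPotential P p) (hQ : IsCompactPotential Q q)
    (l : ℝ × ℝ) {a b : H} (γ : Path a b) :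
    BddAbove (range fun t : unitInterval ↦ energy P Q l (γ t)) :=
  (isCompact_range ((energy_continuous hP hQ l).comp γ.continuous)).bddAbove

lemma energy_le_sup (hP : IsCompactPotential P p) (hQ : IsCompactPotential Q q)
    (l : ℝ × ℝ) {a b : H} (γ : Path a b) (t : unitInterval) :
    energy P Q l (γ t) ≤ ⨆ t : unitInterval, energy P Q l (γ t) :=
  le_ciSup (energy_bddAbove_path hP hQ l γ) t

/-- Every path starts at the origin, where the energy is 0. This bounds the infimum over paths from
below. -/
lemma sup_energy_nonneg (hP : IsCompactPotential P p) (hQ : IsCompactPotential Q q)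
    (l : ℝ × ℝ) {b : H} (γ : Path 0 b) : 0 ≤ ⨆ t : unitInterval, energy P Q l (γ t) := by
  have := energy_le_sup hP hQ l γ 0
  rwa [γ.source, energy_zero hP hQ] at this

lemma energyLevel_bddBelow (hP : IsCompactPotential P p) (hQ : IsCompactPotential Q q)
    (l : ℝ × ℝ) (b : H) :
    BddBelow (range fun γ : Path (0 : H) b ↦ ⨆ t : unitInterval, energy P Q l (γ t)) :=
  ⟨0, by rintro _ ⟨γ, rfl⟩; exact sup_energy_nonneg hP hQ l γ⟩

lemma energyLevel_le (hP : IsCompactPotential P p) (hQ : IsCompactPotential Q q)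
    (l : ℝ × ℝ) {b : H} (γ : Path 0 b) :
    energyLevel P Q l b ≤ ⨆ t : unitInterval, energy P Q l (γ t) :=
  ciInf_le (energyLevel_bddBelow hP hQ l b) γ

instance pathNonempty (a b : H) : Nonempty (Path a b) := PathConnectedSpace.joined a b

/-- Both potentials are nonnegative, so raising both parameters by the same amount lowers the energy
along every path. Fixing the difference `y` reduces the two parameters to a single monotone
variable. -/
lemma energyLevel_antitone (hP : IsCompactPotential P p) (hQ : IsCompactPotential Q q)
    (b : H) (y : ℝ) : Antitone fun x : ℝ ↦ energyLevel P Q (x, x + y) b := by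
  intro x x' hx
  refine ciInf_mono (energyLevel_bddBelow hP hQ _ b) fun γ ↦ ?_
  refine ciSup_mono (energy_bddAbove_path hP hQ _ γ) fun t ↦ ?_
  have h1 := mul_nonneg (sub_nonneg.2 hx) (hP.nonneg (γ t))
  have h2 := mul_nonneg (sub_nonneg.2 hx) (hQ.nonneg (γ t))
  simp only [energy]
  nlinarith

lemma sup_energy_continuous (hP : IsCompactPotential P p) (hQ : IsCompactPotential Q q)
    {b : H} (γ : Path 0 b) :
    Continuous fun l : ℝ × ℝ ↦ ⨆ t : unitInterval, energy P Q l (γ t) := by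
  have hP' := hP.continuous
  have hQ' := hQ.continuous
  have h : Continuous (Function.uncurry fun (l : ℝ × ℝ) (t : unitInterval) ↦
      energy P Q l (γ t)) := by
    simp only [energy, Function.uncurry_def]
    fun_prop
  have := (isCompact_univ (X := unitInterval)).continuous_sSup
    (f := fun (l : ℝ × ℝ) (t : unitInterval) ↦ energy P Q l (γ t)) h
  simpa only [image_univ, sSup_range] using this

/-- An infimum of continuous functions, even over uncountably many paths, is upper semicontinuous:
its strict sublevel sets are unions of open sets. Fubini's theorem needs this measurability. -/
lemma energyLevel_measurable (hP : IsCompactPotential P p) (hQ : IsCompactPotential Q q)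
    (b : H) : Measurable fun l : ℝ × ℝ ↦ energyLevel P Q l b := by
  refine measurable_of_Iio fun a ↦ ?_
  have : (fun l : ℝ × ℝ ↦ energyLevel P Q l b) ⁻¹' Iio a =
      ⋃ γ : Path (0 : H) b, {l | ⨆ t : unitInterval, energy P Q l (γ t) < a} := by
    ext l
    simp only [mem_preimage, mem_Iio, mem_iUnion, mem_ofPred_eq]
    constructor
    · intro h
      exact exists_lt_of_ciInf_lt h
    · rintro ⟨γ, hγ⟩
      exact (energyLevel_le hP hQ l γ).trans_lt hγ
  rw [this]
  exact (isOpen_iUnion fun γ ↦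
    isOpen_lt (sup_energy_continuous hP hQ γ) continuous_const).measurableSet

/-- A function of two variables that is antitone along diagonals has, at almost every point,
finite lower difference quotients along the diagonal. -/
lemma ae_diagonal_quotient_bound {f : ℝ × ℝ → ℝ} (hf : Measurable f)
    (hanti : ∀ y, Antitone fun x ↦ f (x, x + y)) :
    ∀ᵐ l : ℝ × ℝ, ∃ C : ℕ, ∀ᶠ n : ℕ in atTop,
      f (l.1 - 1 / (n + 1), l.2 - 1 / (n + 1)) ≤ f l + C * (1 / (n + 1)) := by
  set S : Set (ℝ × ℝ) := {l | ∃ C : ℕ, ∀ᶠ n : ℕ in atTop,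
      f (l.1 - 1 / (n + 1), l.2 - 1 / (n + 1)) ≤ f l + C * (1 / (n + 1))} with hS
  have hSm : MeasurableSet S := by
    -- Natural constants `C` make the set of good parameters a countable union, hence measurable.
    have : S = ⋃ C : ℕ, {l | ∀ᶠ n : ℕ in atTop,
      f (l.1 - 1 / (n + 1), l.2 - 1 / (n + 1)) ≤ f l + C * (1 / (n + 1))} := by
      ext; simp [hS]
    rw [this]
    refine MeasurableSet.iUnion fun C ↦ ?_
    simp only [eventually_atTop, ofPred_exists, ofPred_forall]
    refine MeasurableSet.iUnion fun N ↦ MeasurableSet.iInter fun n ↦ MeasurableSet.iInter fun _ ↦ ?_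
    refine measurableSet_le (hf.comp ?_) (by fun_prop)
    fun_prop
  -- The shear preserves Lebesgue measure and turns diagonals into horizontal lines, so Fubini
  -- reduces the claim to one monotone function on each line.
  have hmp : MeasurePreserving (fun z : ℝ × ℝ ↦ (z.1, z.1 + z.2)) volume volume :=
    measurePreserving_prod_add (volume : Measure ℝ) (volume : Measure ℝ)
  change ∀ᵐ l, l ∈ S
  rw [← hmp.map_eq]
  refine (ae_map_iff (p := fun l ↦ l ∈ S) hmp.measurable.aemeasurable hSm).2 ?_
  have hSm' : MeasurableSet {z : ℝ × ℝ | (z.1, z.1 + z.2) ∈ S} := hmp.measurable hSm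
  rw [Measure.volume_eq_prod,
    ← (Measure.prod_swap (μ := (volume : Measure ℝ)) (ν := (volume : Measure ℝ)))]
  refine (ae_map_iff (p := fun z ↦ z ∈ {z : ℝ × ℝ | (z.1, z.1 + z.2) ∈ S})
    measurable_swap.aemeasurable hSm').2 ?_
  refine (Measure.ae_prod_iff_ae_ae (hSm'.preimage measurable_swap)).2 (Eventually.of_forall
    fun y ↦ ?_)
  have hmono : Monotone fun x ↦ -f (x, x + y) := fun a b hab ↦ neg_le_neg (hanti y hab)
  filter_upwards [hmono.ae_differentiableAt] with x hx
  simp only [mem_ofPred_eq, Prod.fst_swap, Prod.snd_swap, hS]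
  have hd := hx.hasDerivAt
  set d := deriv (fun x ↦ -f (x, x + y)) x
  have hlim := hd.tendsto_slope
  have hseq : Tendsto (fun n : ℕ ↦ x - 1 / ((n : ℝ) + 1)) atTop (𝓝[≠] x) := by
    refine tendsto_nhdsWithin_iff.2 ⟨?_, Eventually.of_forall fun n ↦ ?_⟩
    · simpa using tendsto_const_nhds.sub (tendsto_one_div_add_atTop_nhds_zero_nat (𝕜 := ℝ))
    · have : (0 : ℝ) < 1 / ((n : ℝ) + 1) := by positivity
      simp only [mem_compl_iff, mem_singleton_iff]
      intro h; linarith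
  have h3 := hlim.comp hseq
  -- The slopes from the left converge to the derivative `d` of `-f` along the diagonal, so any
  -- integer above `d` eventually bounds them.
  obtain ⟨C, hC⟩ := exists_nat_gt d
  refine ⟨C, ?_⟩
  filter_upwards [h3.eventually_lt_const hC] with n hn
  have hpos : (0 : ℝ) < 1 / ((n : ℝ) + 1) := by positivity
  simp only [Function.comp, slope_def_field] at hn
  have e : x - 1 / ((n : ℝ) + 1) - x = -(1 / ((n : ℝ) + 1)) := by ring
  rw [e, div_neg, neg_lt, lt_div_iff₀ hpos] at hn
  have e2 : x + y - 1 / ((n : ℝ) + 1) = x - 1 / ((n : ℝ) + 1) + y := by ring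
  rw [e2]
  linarith

/-- If the energy is nonpositive on a segment, then its endpoints have the same level. -/
lemma energyLevel_le_of_segment (hP : IsCompactPotential P p) (hQ : IsCompactPotential Q q)
    {a b : H} (h : ∀ z ∈ segment ℝ a b, energy P Q l z ≤ 0) :
    energyLevel P Q l b ≤ energyLevel P Q l a := by
  refine le_ciInf fun γ ↦ ?_
  let σ : Path a b :=
    { toFun := fun t ↦ AffineMap.lineMap a b (t : ℝ)
      continuous_toFun := AffineMap.lineMap_continuous.comp continuous_subtype_val
      source' := by simp
      target' := by simp }
  refine (energyLevel_le hP hQ l (γ.trans σ)).trans (ciSup_le fun t ↦ ?_)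
  -- The concatenated path adds only points of nonpositive energy, which cannot exceed the supremum
  -- over `γ`, itself nonnegative.
  have ht : (γ.trans σ) t ∈ range γ ∪ range σ := by
    rw [← Path.trans_range]; exact mem_range_self t
  rcases ht with ⟨s, hs⟩ | ⟨s, hs⟩
  · rw [← hs]; exact energy_le_sup hP hQ l γ s
  · rw [← hs]
    refine (h _ ?_).trans (sup_energy_nonneg hP hQ l γ)
    rw [segment_eq_image_lineMap]
    exact ⟨s, s.2, rfl⟩

/-- Struwe's monotonicity trick: bounded Palais–Smale sequences. -/
lemma exists_bounded_almost_critical (hP : IsCompactPotential P p) (hQ : IsCompactPotential Q q)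
    (h1 : 0 ≤ l.1) (h2 : 0 ≤ l.2) {b : H} (hb : energy P Q l b ≤ 0)
    (hc : 0 < energyLevel P Q l b) {C : ℕ}
    (hC : ∀ᶠ n : ℕ in atTop, energyLevel P Q (l.1 - 1 / (n + 1), l.2 - 1 / (n + 1)) b ≤
      energyLevel P Q l b + C * (1 / (n + 1))) :
    ∃ R : ℝ, ∀ η > 0, ∃ u : H, ‖u‖ ≤ R ∧ |energy P Q l u - energyLevel P Q l b| ≤ η ∧
      ‖energyGrad p q l u‖ ≤ η := by
  set c := energyLevel P Q l b with hcdef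
  -- The radius comes from ½‖u‖² = energy + l₁P + l₂Q, with energy at most c + C + 1 and P, Q at
  -- most C + 2.
  refine ⟨√(2 * (c + C + 1 + (l.1 + l.2) * (C + 2))), fun η hη ↦ ?_⟩
  by_contra! hcon
  have hsmall : ∀ κ > 0, ∀ᶠ n : ℕ in atTop, 1 / ((n : ℝ) + 1) < κ := fun κ hκ ↦
    (tendsto_one_div_add_atTop_nhds_zero_nat (𝕜 := ℝ)).eventually_lt_const hκ
  have hC2 : (0 : ℝ) < C + 2 := by positivity
  -- Three smallness conditions on ε: (C+2)ε < η places the top of the path in the energy window, ε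
  -- < c keeps both endpoints below c - ε, and (C+2)ε < η²/2 makes the gain of one gradient step
  -- exceed the excess height of the path.
  obtain ⟨n, hn, hn1, hn2, hn3⟩ := (hC.and ((hsmall (η / (C + 2)) (by positivity)).and
    ((hsmall c hc).and (hsmall (η ^ 2 / 2 / (C + 2)) (by positivity))))).exists
  have hε1 : 1 / ((n : ℝ) + 1) ≤ 1 := by
    rw [div_le_one (by positivity)]; linarith [(Nat.cast_nonneg n : (0 : ℝ) ≤ n)]
  have hε0 : (0 : ℝ) < 1 / ((n : ℝ) + 1) := by positivity
  set ε : ℝ := 1 / ((n : ℝ) + 1) with hε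
  rw [lt_div_iff₀ hC2] at hn1 hn3
  -- The path is nearly optimal for the decreased parameters; the quotient bound `hn` keeps its
  -- maximum for those parameters below c + (C+1)ε.
  obtain ⟨γ, hγ⟩ := exists_lt_of_ciInf_lt (lt_add_of_pos_right
    (energyLevel P Q (l.1 - ε, l.2 - ε) b) hε0)
  have hle (t : unitInterval) : energy P Q (l.1 - ε, l.2 - ε) (γ t) < c + (C + 1) * ε := by
    have := energy_le_sup hP hQ (l.1 - ε, l.2 - ε) γ t
    linarith
  have hdiff (u : H) : energy P Q (l.1 - ε, l.2 - ε) u = energy P Q l u + ε * (P u + Q u) := by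
    simp only [energy]; ring
  have hle' (t : unitInterval) : energy P Q l (γ t) < c + (C + 1) * ε := by
    have h3 := hle t
    rw [hdiff] at h3
    have := mul_nonneg hε0.le (add_nonneg (hP.nonneg (γ t)) (hQ.nonneg (γ t)))
    linarith
  -- The heart of the trick: at a point of `l`-energy at least c - ε, the two energies differ by ε(P
  -- + Q) and by less than (C+2)ε. This bounds P + Q, hence the norm, and the contradiction
  -- hypothesis then forces a large gradient.
  have hbound (t : unitInterval) (ht : c - ε ≤ energy P Q l (γ t)) :
      η < ‖energyGrad p q l (γ t)‖ := by
    have h3 := hle t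
    rw [hdiff] at h3
    have hPQ : P (γ t) + Q (γ t) ≤ C + 2 := by
      by_contra! h4
      have := mul_lt_mul_of_pos_left h4 hε0
      linarith
    refine hcon _ ?_ ?_
    · refine Real.le_sqrt_of_sq_le ?_
      have e : 1 / 2 * ‖γ t‖ ^ 2 = energy P Q l (γ t) + l.1 * P (γ t) + l.2 * Q (γ t) := by
        simp only [energy]; ring
      have i1 : l.1 * P (γ t) ≤ l.1 * (C + 2) :=
        mul_le_mul_of_nonneg_left (by linarith [hQ.nonneg (γ t)]) h1
      have i2 : l.2 * Q (γ t) ≤ l.2 * (C + 2) :=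
        mul_le_mul_of_nonneg_left (by linarith [hP.nonneg (γ t)]) h2
      have i3 := hle' t
      have i4 : (C + 1 : ℝ) * ε ≤ C + 1 :=
        mul_le_of_le_one_right (by positivity) hε1
      linarith
    · rw [abs_le]
      have i3 := hle' t
      have i5 : (C : ℝ) * ε ≥ 0 := by positivity
      constructor <;> linarith
  -- the deformed path
  let χ : ℝ → ℝ := fun r ↦ max 0 (min 1 ((r - (c - ε)) / (ε / 2)))
  have hχc : Continuous χ := by fun_prop
  have hχ0 (r : ℝ) : 0 ≤ χ r := le_max_left _ _
  have hχ1 (r : ℝ) : χ r ≤ 1 := max_le zero_le_one (min_le_left _ _)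
  have hχz {r : ℝ} (hr : r ≤ c - ε) : χ r = 0 :=
    max_eq_left ((min_le_right _ _).trans
      (div_nonpos_of_nonpos_of_nonneg (by linarith) (by positivity)))
  have hχo {r : ℝ} (hr : c - ε / 2 ≤ r) : χ r = 1 := by
    have : 1 ≤ (r - (c - ε)) / (ε / 2) := by rw [le_div_iff₀ (by positivity)]; linarith
    simp only [χ, min_eq_left this]; norm_num
  have hFc := energy_continuous hP hQ l
  have hGc := energyGrad_continuous hP hQ l
  let γ' : Path (0 : H) b :=
    { toFun := fun t ↦ γ t - χ (energy P Q l (γ t)) • energyGrad p q l (γ t)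
      continuous_toFun := γ.continuous.sub
        ((hχc.comp (hFc.comp γ.continuous)).smul (hGc.comp γ.continuous))
      -- The endpoints have energy at most 0 < c - ε, where the cutoff χ vanishes, so the
      -- deformation leaves them fixed.
      source' := by
        rw [γ.source, energy_zero hP hQ, hχz (by linarith)]; simp
      target' := by
        rw [γ.target, hχz (by linarith)]; simp }
  have hfin : ⨆ t : unitInterval, energy P Q l (γ' t) ≤ c - ε / 2 := by
    refine ciSup_le fun t ↦ ?_
    have hd := energy_descent hP hQ h1 h2 (γ t) (hχ0 (energy P Q l (γ t)))
      (hχ1 (energy P Q l (γ t)))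
    change energy P Q l (γ t - χ (energy P Q l (γ t)) • energyGrad p q l (γ t)) ≤ _
    -- Above c - ε/2 the full step loses more than η²/2 > (C+2)ε, from a height below c + (C+1)ε.
    -- Below c - ε/2 a partial step does not increase the energy.
    rcases le_or_gt (c - ε / 2) (energy P Q l (γ t)) with h3 | h3
    · have h4 := hbound t (by linarith)
      have h5 : η ^ 2 < ‖energyGrad p q l (γ t)‖ ^ 2 := pow_lt_pow_left₀ h4 hη.le (by norm_num)
      rw [hχo h3] at hd ⊢
      have := hle' t
      linarith
    · have := mul_nonneg (div_nonneg (hχ0 (energy P Q l (γ t))) zero_le_two)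
        (sq_nonneg ‖energyGrad p q l (γ t)‖)
      linarith
  have := energyLevel_le hP hQ l γ'
  linarith

/-- Since u = energyGrad + l₁ p(u) + l₂ q(u), with the gradient tending to 0 and p, q compact on
bounded sequences, a subsequence of the almost critical points converges in norm. Continuity of the
energy and its gradient does the rest. -/
lemma exists_critical_of_bounded_almost_critical [CompleteSpace H] (hP : IsCompactPotential P p)
    (hQ : IsCompactPotential Q q) {c R : ℝ}
    (h : ∀ η > 0, ∃ u : H, ‖u‖ ≤ R ∧ |energy P Q l u - c| ≤ η ∧ ‖energyGrad p q l u‖ ≤ η) :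
    ∃ u : H, HasFDerivAt (energy P Q l) (0 : H →L[ℝ] ℝ) u ∧ energy P Q l u = c := by
  choose! u hu1 hu2 hu3 using h
  let v : ℕ → H := fun n ↦ u (1 / ((n : ℝ) + 1))
  have hpos (n : ℕ) : (0 : ℝ) < 1 / ((n : ℝ) + 1) := by positivity
  obtain ⟨φ, hφ, z, hz⟩ := hP.compact v R fun n ↦ hu1 _ (hpos n)
  obtain ⟨ψ, hψ, z', hz'⟩ := hQ.compact (v ∘ φ) R fun n ↦ hu1 _ (hpos _)
  have hφψ : Tendsto (fun n ↦ φ (ψ n)) atTop atTop := hφ.tendsto_atTop.comp hψ.tendsto_atTop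
  have h0 := tendsto_one_div_add_atTop_nhds_zero_nat (𝕜 := ℝ)
  have hG : Tendsto (fun n ↦ energyGrad p q l (v (φ (ψ n)))) atTop (𝓝 0) :=
    (squeeze_zero_norm (fun n ↦ hu3 _ (hpos n)) h0).comp hφψ
  have hE : Tendsto (fun n ↦ energy P Q l (v (φ (ψ n)))) atTop (𝓝 c) := by
    have : Tendsto (fun n ↦ energy P Q l (v n) - c) atTop (𝓝 0) :=
      squeeze_zero_norm (fun n ↦ hu2 _ (hpos n)) h0
    simpa using (this.comp hφψ).add_const c
  have hv : Tendsto (fun n ↦ v (φ (ψ n))) atTop (𝓝 (0 + l.1 • z + l.2 • z')) := by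
    refine ((hG.add ((hz.comp hψ.tendsto_atTop).const_smul l.1)).add
      (hz'.const_smul l.2)).congr fun n ↦ ?_
    simp only [energyGrad, Function.comp]
    abel
  refine ⟨_, ?_, tendsto_nhds_unique (((energy_continuous hP hQ l).tendsto _).comp hv) hE⟩
  have hg0 := tendsto_nhds_unique (((energyGrad_continuous hP hQ l).tendsto _).comp hv) hG
  have := energy_hasFDerivAt hP hQ l (0 + l.1 • z + l.2 • z')
  rwa [hg0, map_zero] at this

/-- The endpoint has negative energy, so it lies outside the ball of radius `ρ`. Every path
therefore meets the sphere, where the energy is at least δρ². -/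
lemma energyLevel_pos (hP : IsCompactPotential P p) (hQ : IsCompactPotential Q q)
    {ρ δ : ℝ} (hρ : 0 < ρ) (hδ : 0 < δ)
    (hloc : ∀ u, ‖u‖ ≤ ρ → δ * ‖u‖ ^ 2 ≤ energy P Q l u) {b : H} (hb : energy P Q l b < 0) :
    0 < energyLevel P Q l b := by
  have hbρ : ρ < ‖b‖ := by
    by_contra! h
    have := hloc b h
    have : 0 ≤ δ * ‖b‖ ^ 2 := by positivity
    linarith
  have : δ * ρ ^ 2 ≤ energyLevel P Q l b := by
    refine le_ciInf fun γ ↦ ?_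
    have hcont : Continuous fun t : unitInterval ↦ ‖γ t‖ := γ.continuous.norm
    have hmem : ρ ∈ Icc (‖γ 0‖) (‖γ 1‖) := by
      rw [γ.source, γ.target, norm_zero]; exact ⟨hρ.le, hbρ.le⟩
    obtain ⟨t, ht⟩ := mem_range_of_exists_le_of_exists_ge hcont ⟨0, hmem.1⟩ ⟨1, hmem.2⟩
    replace ht : ‖γ t‖ = ρ := ht
    have h1 := hloc (γ t) ht.le
    rw [ht] at h1
    exact h1.trans (energy_le_sup hP hQ l γ t)
  exact lt_of_lt_of_le (by positivity) this

/-- Mountain pass theorem for almost every parameter. -/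
theorem ae_mountainPass [CompleteSpace H] [TopologicalSpace.SeparableSpace H]
    (hP : IsCompactPotential P p) (hQ : IsCompactPotential Q q) :
    ∀ᵐ l : ℝ × ℝ, 0 ≤ l.1 → 0 ≤ l.2 →
      (∃ ρ > 0, ∃ δ > 0, ∀ u, ‖u‖ ≤ ρ → δ * ‖u‖ ^ 2 ≤ energy P Q l u) →
      ∀ b : H, energy P Q l b < 0 → 0 < energyLevel P Q l b ∧
        ∃ u : H, u ≠ 0 ∧ HasFDerivAt (energy P Q l) (0 : H →L[ℝ] ℝ) u ∧
          energy P Q l u = energyLevel P Q l b := by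
  -- The null set of bad parameters depends on the endpoint, so only countably many endpoints can be
  -- treated at once.
  have hae := (ae_all_iff (μ := (volume : Measure (ℝ × ℝ)))).2 fun n : ℕ ↦
    ae_diagonal_quotient_bound (energyLevel_measurable hP hQ (TopologicalSpace.denseSeq H n))
      (energyLevel_antitone hP hQ (TopologicalSpace.denseSeq H n))
  filter_upwards [hae] with l hl h1 h2 ⟨ρ, hρ, δ, hδ, hloc⟩ b hb
  have hcpos := energyLevel_pos hP hQ hρ hδ hloc hb
  refine ⟨hcpos, ?_⟩
  -- The energy is negative on a ball around `b`. A point of the dense sequence in this ball is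
  -- joined to `b` inside it and so has the same level.
  obtain ⟨r, hr, hball⟩ := Metric.eventually_nhds_iff_ball.1
    ((energy_continuous hP hQ l).continuousAt.eventually_lt_const hb)
  obtain ⟨n, hn⟩ : ∃ n, TopologicalSpace.denseSeq H n ∈ Metric.ball b r :=
    (TopologicalSpace.denseRange_denseSeq H).exists_mem_open Metric.isOpen_ball
      ⟨b, Metric.mem_ball_self hr⟩
  set d := TopologicalSpace.denseSeq H n
  have hseg : ∀ z ∈ segment ℝ b d, energy P Q l z ≤ 0 := fun z hz ↦
    (hball z ((convex_ball b r).segment_subset (Metric.mem_ball_self hr) hn hz)).le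
  have heq : energyLevel P Q l d = energyLevel P Q l b := by
    refine le_antisymm (energyLevel_le_of_segment hP hQ hseg)
      (energyLevel_le_of_segment hP hQ ?_)
    rwa [segment_symm]
  obtain ⟨C, hC⟩ := hl n
  rw [← heq] at hcpos ⊢
  obtain ⟨R, hR⟩ := exists_bounded_almost_critical hP hQ h1 h2
    (hseg d (right_mem_segment ℝ b d)) hcpos hC
  obtain ⟨u, hu1, hu2⟩ := exists_critical_of_bounded_almost_critical hP hQ hR
  refine ⟨u, ?_, hu1, hu2⟩
  -- The origin has energy 0, whereas the level is positive.
  rintro rfl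
  rw [energy_zero hP hQ] at hu2
  exact hcpos.ne hu2

end MountainPass

/-! ### Translation estimate and exponential integrability for smooth functions on the plane -/

section PlaneAnalysis

/-- The Cauchy–Schwarz inequality against the constant function. -/
lemma sq_lintegral_le {α : Type*} [MeasurableSpace α] (μ : Measure α) {F : α → ℝ≥0∞}
    (hF : AEMeasurable F μ) : (∫⁻ a, F a ∂μ) ^ 2 ≤ μ univ * ∫⁻ a, F a ^ 2 ∂μ := by
  have h := ENNReal.lintegral_mul_le_Lp_mul_Lq μ (Real.HolderConjugate.two_two) hF
    (aemeasurable_const (b := (1 : ℝ≥0∞)))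
  simp only [Pi.mul_apply, mul_one, ENNReal.one_rpow, lintegral_const, one_mul] at h
  calc (∫⁻ a, F a ∂μ) ^ 2 ≤ ((∫⁻ a, F a ^ (2 : ℝ) ∂μ) ^ (1 / 2 : ℝ) *
        (μ univ) ^ (1 / 2 : ℝ)) ^ 2 := by gcongr
    _ = μ univ * ∫⁻ a, F a ^ 2 ∂μ := by
      rw [mul_pow, ← ENNReal.rpow_natCast, ← ENNReal.rpow_natCast, ← ENNReal.rpow_mul,
        ← ENNReal.rpow_mul]
      norm_num
      rw [mul_comm]

lemma norm_fderiv_sq_le (f : Plane → ℝ) (x : Plane) :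
    ‖fderiv ℝ f x‖ₑ ^ 2 ≤
      ‖fderiv ℝ f x (stdVec 0)‖ₑ ^ 2 + ‖fderiv ℝ f x (stdVec 1)‖ₑ ^ 2 := by
  set L := fderiv ℝ f x
  have h1 : ‖L‖ ≤ √(L (stdVec 0) ^ 2 + L (stdVec 1) ^ 2) := by
    refine L.opNorm_le_bound (Real.sqrt_nonneg _) fun z ↦ ?_
    have hz : z = z 0 • stdVec 0 + z 1 • stdVec 1 := by
      ext i; fin_cases i <;> simp
    have h2 : L z = z 0 * L (stdVec 0) + z 1 * L (stdVec 1) := by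
      conv_lhs => rw [hz]
      simp
    rw [EuclideanSpace.norm_eq, ← Real.sqrt_mul (by positivity), Real.norm_eq_abs, h2]
    refine Real.abs_le_sqrt ?_
    simp only [Fin.sum_univ_two, Real.norm_eq_abs, sq_abs]
    nlinarith [sq_nonneg (z 0 * L (stdVec 1) - z 1 * L (stdVec 0))]
  have h2 : ‖L‖ ^ 2 ≤ L (stdVec 0) ^ 2 + L (stdVec 1) ^ 2 := by
    rw [← Real.sq_sqrt (show 0 ≤ L (stdVec 0) ^ 2 + L (stdVec 1) ^ 2 by positivity)]
    exact pow_le_pow_left₀ (norm_nonneg _) h1 2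
  have h3 (a : ℝ) : ‖a‖ₑ ^ 2 = ENNReal.ofReal (a ^ 2) := by
    rw [← ofReal_norm, ← ENNReal.ofReal_pow (norm_nonneg _), Real.norm_eq_abs, sq_abs]
  rw [h3, h3, ← ENNReal.ofReal_add (by positivity) (by positivity), ← ofReal_norm,
    ← ENNReal.ofReal_pow (norm_nonneg _)]
  exact ENNReal.ofReal_le_ofReal h2

/-- The translation estimate for smooth functions. -/
lemma lintegral_translate_sub_sq_le {f : Plane → ℝ} (hf : ContDiff ℝ 1 f) (z : Plane) :
    ∫⁻ x, ‖f (x + z) - f x‖ₑ ^ 2 ≤ ‖z‖ₑ ^ 2 * ∫⁻ x, ‖fderiv ℝ f x‖ₑ ^ 2 := by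
  have hc : Continuous (fderiv ℝ f) := hf.continuous_fderiv one_ne_zero
  -- The increment is the integral of the derivative along the segment from x to x + z;
  -- Cauchy–Schwarz in the segment parameter gives the square. Integration in x then uses Fubini and
  -- translation invariance.
  have hpt (x : Plane) : ‖f (x + z) - f x‖ₑ ^ 2 ≤
      ‖z‖ₑ ^ 2 * ∫⁻ t in Ioc (0 : ℝ) 1, ‖fderiv ℝ f (x + t • z)‖ₑ ^ 2 := by
    have hct : Continuous fun t : ℝ ↦ fderiv ℝ f (x + t • z) := by fun_prop
    have hder (t : ℝ) : HasDerivAt (fun t : ℝ ↦ f (x + t • z)) (fderiv ℝ f (x + t • z) z) t := by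
      have h1 : HasDerivAt (fun t : ℝ ↦ x + t • z) z t := by
        simpa using ((hasDerivAt_id t).smul_const z).const_add x
      exact ((hf.differentiable one_ne_zero _).hasFDerivAt).comp_hasDerivAt t h1
    have hint := intervalIntegral.integral_eq_sub_of_hasDerivAt (a := 0) (b := 1)
      (fun t _ ↦ hder t) ((hct.clm_apply continuous_const).intervalIntegrable 0 1)
    simp only [one_smul, zero_smul, add_zero] at hint
    rw [← hint, intervalIntegral.integral_of_le zero_le_one]
    calc ‖∫ t in Ioc (0 : ℝ) 1, fderiv ℝ f (x + t • z) z‖ₑ ^ 2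
        ≤ (∫⁻ t in Ioc (0 : ℝ) 1, ‖fderiv ℝ f (x + t • z)‖ₑ * ‖z‖ₑ) ^ 2 := by
          gcongr
          refine (enorm_integral_le_lintegral_enorm _).trans (lintegral_mono fun t ↦ ?_)
          exact ContinuousLinearMap.le_opENorm _ _
      _ = (∫⁻ t in Ioc (0 : ℝ) 1, ‖fderiv ℝ f (x + t • z)‖ₑ) ^ 2 * ‖z‖ₑ ^ 2 := by
          rw [lintegral_mul_const _ (by fun_prop), mul_pow]
      _ ≤ (1 * ∫⁻ t in Ioc (0 : ℝ) 1, ‖fderiv ℝ f (x + t • z)‖ₑ ^ 2) * ‖z‖ₑ ^ 2 := by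
          gcongr
          have := sq_lintegral_le (volume.restrict (Ioc (0 : ℝ) 1))
            (F := fun t ↦ ‖fderiv ℝ f (x + t • z)‖ₑ) (by fun_prop)
          simpa using this
      _ = _ := by rw [one_mul, mul_comm]
  calc ∫⁻ x, ‖f (x + z) - f x‖ₑ ^ 2
      ≤ ∫⁻ x, ‖z‖ₑ ^ 2 * ∫⁻ t in Ioc (0 : ℝ) 1, ‖fderiv ℝ f (x + t • z)‖ₑ ^ 2 :=
        lintegral_mono hpt
    _ = ‖z‖ₑ ^ 2 * ∫⁻ x, ∫⁻ t in Ioc (0 : ℝ) 1, ‖fderiv ℝ f (x + t • z)‖ₑ ^ 2 :=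
        lintegral_const_mul' _ _ (by simp)
    _ = ‖z‖ₑ ^ 2 * ∫⁻ t in Ioc (0 : ℝ) 1, ∫⁻ x, ‖fderiv ℝ f (x + t • z)‖ₑ ^ 2 := by
        rw [lintegral_lintegral_swap]
        have : Continuous fun a : Plane × ℝ ↦ fderiv ℝ f (a.1 + a.2 • z) := by fun_prop
        exact (this.enorm.measurable.pow_const 2).aemeasurable
    _ = ‖z‖ₑ ^ 2 * ∫⁻ x, ‖fderiv ℝ f x‖ₑ ^ 2 := by
        congr 1
        have (t : ℝ) : ∫⁻ x, ‖fderiv ℝ f (x + t • z)‖ₑ ^ 2 = ∫⁻ x, ‖fderiv ℝ f x‖ₑ ^ 2 :=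
          lintegral_add_right_eq_self (fun x ↦ ‖fderiv ℝ f x‖ₑ ^ 2) (t • z)
        simp [this]

/-- Outside the open unit interval every point is a global minimum or maximum of the transition
function, so the derivative vanishes there. This confines the gradient of a truncation to one level
band. -/
lemma exists_deriv_smoothTransition_bound :
    ∃ K : ℝ, 0 ≤ K ∧ ∀ x, |deriv Real.smoothTransition x| ≤ K ∧
      (x ∉ Ioo (0 : ℝ) 1 → deriv Real.smoothTransition x = 0) := by
  have h0 (x : ℝ) (hx : x ∉ Ioo (0 : ℝ) 1) : deriv Real.smoothTransition x = 0 := by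
    rw [mem_Ioo, not_and_or, not_lt, not_lt] at hx
    rcases hx with hx | hx
    · refine IsLocalMin.deriv_eq_zero (Eventually.of_forall fun y ↦ ?_)
      rw [Real.smoothTransition.zero_of_nonpos hx]
      exact Real.smoothTransition.nonneg y
    · refine IsLocalMax.deriv_eq_zero (Eventually.of_forall fun y ↦ ?_)
      rw [Real.smoothTransition.one_of_one_le hx]
      exact Real.smoothTransition.le_one y
  have hc : Continuous (deriv Real.smoothTransition) :=
    (Real.smoothTransition.contDiff (n := 1)).continuous_deriv le_rfl
  obtain ⟨K, hK⟩ := isCompact_Icc.exists_bound_of_continuousOn (s := Icc (0 : ℝ) 1) hc.continuousOn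
  refine ⟨K, (norm_nonneg _).trans (hK 0 (by simp)), fun x ↦ ⟨?_, h0 x⟩⟩
  by_cases hx : x ∈ Icc (0 : ℝ) 1
  · exact hK x hx
  · rw [h0 x fun h ↦ hx (Ioo_subset_Icc_self h), abs_zero]
    exact (norm_nonneg _).trans (hK 0 (by simp))

lemma finrank_plane : Module.finrank ℝ Plane = 2 := by simp

/-- One step of the level set iteration. -/
lemma exists_levelSet_step :
    ∃ c : ℝ, 0 ≤ c ∧ ∀ v : Plane → ℝ, ContDiff ℝ 1 v → HasCompactSupport v → ∀ j : ℕ,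
      volume {x | ((j + 1 : ℕ) : ℝ) < v x} ≤ ENNReal.ofReal c * volume {x | (j : ℝ) < v x} *
        ∫⁻ x in {x | (j : ℝ) < v x ∧ v x < (j + 1 : ℕ)}, ‖fderiv ℝ v x‖ₑ ^ 2 := by
  obtain ⟨K, hK0, hK⟩ := exists_deriv_smoothTransition_bound
  set C := lintegralPowLePowLIntegralFDerivConst (volume : Measure Plane) 2 with hC
  refine ⟨C * K ^ 2, by positivity, fun v hv hvc j ↦ ?_⟩
  set G := Real.smoothTransition
  have hvcont := hv.continuous
  have hGd : Differentiable ℝ G :=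
    (Real.smoothTransition.contDiff (n := 1)).differentiable one_ne_zero
  -- A smooth truncation of `v`: it is 0 where v ≤ j and 1 where v ≥ j + 1.
  let w : Plane → ℝ := fun x ↦ G (v x - j)
  have hw : ContDiff ℝ 1 w := Real.smoothTransition.contDiff.comp (hv.sub contDiff_const)
  have hwc : HasCompactSupport w := by
    refine hvc.mono fun x hx ↦ ?_
    rw [Function.mem_support] at hx ⊢
    intro h
    refine hx (Real.smoothTransition.zero_of_nonpos ?_)
    rw [h]
    simp
  have hp : Real.HolderConjugate (Module.finrank ℝ Plane) 2 := by
    rw [finrank_plane]; exact Real.HolderConjugate.two_two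
  -- Gagliardo–Nirenberg–Sobolev in dimension two: the L² norm is controlled by the L¹ norm of the
  -- gradient.
  have hgns := lintegral_pow_le_pow_lintegral_fderiv (volume : Measure Plane) hw hwc hp
  rw [← hC] at hgns
  set S : Set Plane := {x | (j : ℝ) < v x ∧ v x < (j + 1 : ℕ)} with hS
  have hSm : MeasurableSet S :=
    ((isOpen_lt continuous_const hvcont).inter (isOpen_lt hvcont continuous_const)).measurableSet
  have hfd (x : Plane) : ‖fderiv ℝ w x‖ₑ ≤
      S.indicator (fun x ↦ ENNReal.ofReal K * ‖fderiv ℝ v x‖ₑ) x := by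
    have h0 : HasFDerivAt (fun x ↦ v x - j) (fderiv ℝ v x) x :=
      (hv.differentiable one_ne_zero x).hasFDerivAt.sub_const (j : ℝ)
    have h1 : HasFDerivAt w (deriv G (v x - j) • fderiv ℝ v x) x :=
      HasDerivAt.comp_hasFDerivAt (h₂ := G) x (hGd (v x - j)).hasDerivAt h0
    rw [h1.fderiv]
    by_cases hx : x ∈ S
    · rw [indicator_of_mem hx, enorm_smul]
      gcongr
      rw [← ofReal_norm]
      exact ENNReal.ofReal_le_ofReal (hK _).1
    · have : deriv G (v x - j) = 0 := by
        refine (hK _).2 fun h ↦ hx ?_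
        simp only [hS, mem_ofPred_eq, Nat.cast_add, Nat.cast_one]
        exact ⟨by linarith [h.1], by linarith [h.2]⟩
      rw [this, zero_smul]
      exact (enorm_zero (E := Plane →L[ℝ] ℝ)).le.trans bot_le
  -- Cauchy–Schwarz on the band, whose measure is at most that of {v > j}. This is what yields a
  -- recursion between consecutive superlevel sets.
  have hfd2 : (∫⁻ x, ‖fderiv ℝ w x‖ₑ) ^ 2 ≤ ENNReal.ofReal (K ^ 2) *
      (volume {x | (j : ℝ) < v x} * ∫⁻ x in S, ‖fderiv ℝ v x‖ₑ ^ 2) := by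
    have hmeas : Continuous fun x ↦ ‖fderiv ℝ v x‖ₑ := (hv.continuous_fderiv one_ne_zero).enorm
    calc (∫⁻ x, ‖fderiv ℝ w x‖ₑ) ^ 2
        ≤ (∫⁻ x, S.indicator (fun x ↦ ENNReal.ofReal K * ‖fderiv ℝ v x‖ₑ) x) ^ 2 := by
          gcongr; exact hfd _
      _ = (ENNReal.ofReal K * ∫⁻ x in S, ‖fderiv ℝ v x‖ₑ) ^ 2 := by
          rw [lintegral_indicator hSm, lintegral_const_mul _ hmeas.measurable]
      _ = ENNReal.ofReal (K ^ 2) * (∫⁻ x in S, ‖fderiv ℝ v x‖ₑ) ^ 2 := by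
          rw [mul_pow, ENNReal.ofReal_pow hK0]
      _ ≤ ENNReal.ofReal (K ^ 2) * (volume S * ∫⁻ x in S, ‖fderiv ℝ v x‖ₑ ^ 2) := by
          gcongr
          simpa using sq_lintegral_le (volume.restrict S) hmeas.aemeasurable
      _ ≤ _ := by
          gcongr
          exact fun x hx ↦ hx.1
  calc volume {x | ((j + 1 : ℕ) : ℝ) < v x} ≤ ∫⁻ x, ‖w x‖ₑ ^ (2 : ℝ) := by
        rw [← lintegral_indicator_one (isOpen_lt continuous_const hvcont).measurableSet]
        refine lintegral_mono fun x ↦ ?_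
        refine indicator_le (f := 1) (g := fun x ↦ ‖w x‖ₑ ^ (2 : ℝ)) (fun x hx ↦ ?_) x
        have : w x = 1 := Real.smoothTransition.one_of_one_le (by
          simp only [mem_ofPred_eq, Nat.cast_add, Nat.cast_one] at hx; linarith)
        simp [this]
    _ ≤ C * (∫⁻ x, ‖fderiv ℝ w x‖ₑ) ^ (2 : ℝ) := hgns
    _ ≤ C * (ENNReal.ofReal (K ^ 2) *
      (volume {x | (j : ℝ) < v x} * ∫⁻ x in S, ‖fderiv ℝ v x‖ₑ ^ 2)) := by
        rw [ENNReal.rpow_two]; gcongr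
    _ = _ := by
        rw [ENNReal.ofReal_mul (by positivity), ENNReal.ofReal_coe_nnreal]; ring

/-- Superexponential decay of the measure of the superlevel sets. -/
lemma exists_levelSet_decay :
    ∃ c : ℝ, 0 ≤ c ∧ ∀ v : Plane → ℝ, ContDiff ℝ 1 v → HasCompactSupport v → ∀ D : ℝ, 0 ≤ D →
      ∫⁻ x, ‖fderiv ℝ v x‖ₑ ^ 2 ≤ ENNReal.ofReal D → ∀ B : Set Plane, (∀ x ∉ B, v x = 0) →
      ∀ (q : ℝ) (n : ℕ), volume {x | (n : ℝ) < v x} ≤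
        volume B * ENNReal.ofReal (Real.exp (-q * n) * Real.exp (Real.exp q * c * D)) := by
  obtain ⟨c, hc, hstep⟩ := exists_levelSet_step
  refine ⟨c, hc, fun v hv hvc D hD0 hD B hB q n ↦ ?_⟩
  have hvcont := hv.continuous
  set S : ℕ → Set Plane := fun j ↦ {x | (j : ℝ) < v x ∧ v x < (j + 1 : ℕ)} with hS
  have hSm (j : ℕ) : MeasurableSet (S j) :=
    ((isOpen_lt continuous_const hvcont).inter (isOpen_lt hvcont continuous_const)).measurableSet
  have hSd : Pairwise (Function.onFun Disjoint S) := by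
    intro i j hij
    refine Set.disjoint_left.2 fun x hi hj ↦ hij ?_
    have h1 : (i : ℝ) < (j + 1 : ℕ) := hi.1.trans hj.2
    have h2 : (j : ℝ) < (i + 1 : ℕ) := hj.1.trans hi.2
    have h1' : i < j + 1 := by exact_mod_cast h1
    have h2' : j < i + 1 := by exact_mod_cast h2
    omega
  set d : ℕ → ℝ≥0∞ := fun j ↦ ∫⁻ x in S j, ‖fderiv ℝ v x‖ₑ ^ 2 with hd
  -- The bands are disjoint, so the energies `d j` share the total budget `D`.
  have hdsum (n : ℕ) : ∑ j ∈ Finset.range n, d j ≤ ENNReal.ofReal D := by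
    refine le_trans ?_ hD
    rw [hd, ← lintegral_biUnion_finset (fun i _ j _ hij ↦ hSd hij) (fun j _ ↦ hSm j)]
    exact setLIntegral_le_lintegral _ _
  have hdfin (j : ℕ) : d j ≠ ⊤ := by
    refine ne_top_of_le_ne_top ENNReal.ofReal_ne_top ((le_trans ?_ (hdsum (j + 1))))
    exact Finset.single_le_sum (f := d) (fun _ _ ↦ bot_le) (Finset.self_mem_range_succ j)
  have hind (n : ℕ) : volume {x | (n : ℝ) < v x} ≤ volume B * ENNReal.ofReal
      (Real.exp (-q * n) * Real.exp (Real.exp q * c * ∑ j ∈ Finset.range n, (d j).toReal)) := by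
    induction n with
    | zero =>
      simp only [CharP.cast_eq_zero, mul_zero, Real.exp_zero, Finset.range_zero, Finset.sum_empty,
        ENNReal.ofReal_one, mul_one]
      refine measure_mono fun x hx ↦ ?_
      by_contra h
      simp [hB x h] at hx
    | succ n ih =>
      refine (hstep v hv hvc n).trans ?_
      have e1 : (∫⁻ x in {x | (n : ℝ) < v x ∧ v x < (n + 1 : ℕ)}, ‖fderiv ℝ v x‖ₑ ^ 2) =
          ENNReal.ofReal (d n).toReal := (ENNReal.ofReal_toReal (hdfin n)).symm
      rw [e1]
      calc ENNReal.ofReal c * volume {x | (n : ℝ) < v x} * ENNReal.ofReal (d n).toReal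
          ≤ ENNReal.ofReal c * (volume B * ENNReal.ofReal (Real.exp (-q * n) * Real.exp
            (Real.exp q * c * ∑ j ∈ Finset.range n, (d j).toReal))) *
              ENNReal.ofReal (d n).toReal := by gcongr
        _ = volume B * ENNReal.ofReal ((Real.exp (-q * n) * Real.exp
            (Real.exp q * c * ∑ j ∈ Finset.range n, (d j).toReal)) * (c * (d n).toReal)) := by
            rw [ENNReal.ofReal_mul (by positivity) (q := c * _), ENNReal.ofReal_mul hc]; ring
        _ ≤ _ := by
            refine mul_le_mul_right (ENNReal.ofReal_le_ofReal ?_) _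
            -- The inequality x ≤ e^{-q} exp(e^q x) trades each recursion factor for a decay e^{-q}.
            -- The exponentials multiply to at most exp(e^q c D), whatever the number of steps.
            have h1 : c * (d n).toReal ≤
                Real.exp (-q) * Real.exp (Real.exp q * c * (d n).toReal) := by
              have := (Real.add_one_le_exp (Real.exp q * c * (d n).toReal))
              have h2 := mul_le_mul_of_nonneg_left this (Real.exp_pos (-q)).le
              refine le_trans ?_ h2
              have h3 : Real.exp (-q) * Real.exp q = 1 := by rw [← Real.exp_add]; simp
              have h4 : Real.exp (-q) * (Real.exp q * c * (d n).toReal + 1) =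
                (Real.exp (-q) * Real.exp q) * (c * (d n).toReal) + Real.exp (-q) := by ring
              rw [h4, h3]
              linarith [Real.exp_pos (-q)]
            calc _ ≤ (Real.exp (-q * n) * Real.exp
                  (Real.exp q * c * ∑ j ∈ Finset.range n, (d j).toReal)) *
                  (Real.exp (-q) * Real.exp (Real.exp q * c * (d n).toReal)) :=
                  mul_le_mul_of_nonneg_left h1 (by positivity)
              _ = _ := by
                rw [← Real.exp_add, ← Real.exp_add, ← Real.exp_add, ← Real.exp_add,
                  Finset.sum_range_succ]
                congr 1
                push_cast
                ring
  refine (hind n).trans ?_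
  gcongr
  rw [← ENNReal.toReal_sum (fun j _ ↦ hdfin j)]
  exact ENNReal.toReal_le_of_le_ofReal hD0 (hdsum n)

/-- The constant in the exponential integrability estimate. -/
lemma exists_exp_bound_of_smooth (p : ℝ) (hp : 0 ≤ p) (D : ℝ) (hD0 : 0 ≤ D) {B : Set Plane}
    (hBfin : volume B ≠ ⊤) :
    ∃ C : ℝ, 0 ≤ C ∧ ∀ v : Plane → ℝ, ContDiff ℝ 1 v → HasCompactSupport v →
      ∫⁻ x, ‖fderiv ℝ v x‖ₑ ^ 2 ≤ ENNReal.ofReal D → (∀ x ∉ B, v x = 0) →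
      ∫⁻ x in B, ENNReal.ofReal (Real.exp (p * |v x|)) ≤ ENNReal.ofReal C := by
  obtain ⟨c, hc, hdec⟩ := exists_levelSet_decay
  -- Decay rate q = p + 1 is used: e^{p(n+1)} e^{-(p+1)n} = e^p e^{-n} is summable.
  set A : ℝ := Real.exp p * Real.exp (Real.exp (p + 1) * c * D) with hA
  have hgeo : Summable fun n : ℕ ↦ Real.exp (-(n : ℝ)) := by
    have := summable_geometric_of_lt_one (Real.exp_pos (-1)).le
      (by rw [Real.exp_lt_one_iff]; norm_num)
    refine this.congr fun n ↦ ?_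
    rw [← Real.exp_nat_mul]; congr 1; ring
  set Z : ℝ := ∑' n : ℕ, Real.exp (-(n : ℝ))
  have hZ0 : 0 ≤ Z := tsum_nonneg fun n ↦ (Real.exp_pos _).le
  set V : ℝ := (volume B).toReal with hV
  have hVof : volume B = ENNReal.ofReal V := (ENNReal.ofReal_toReal hBfin).symm
  have hV0 : 0 ≤ V := ENNReal.toReal_nonneg
  have hA0 : 0 ≤ A := by positivity
  have one (v : Plane → ℝ) (hv : ContDiff ℝ 1 v) (hvc : HasCompactSupport v)
      (hD : ∫⁻ x, ‖fderiv ℝ v x‖ₑ ^ 2 ≤ ENNReal.ofReal D) (hvB : ∀ x ∉ B, v x = 0) :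
      ∫⁻ x in B, ENNReal.ofReal (Real.exp (p * v x)) ≤ ENNReal.ofReal (V * (1 + A * Z)) := by
    -- Layer decomposition: for v > 0 the term with n = ⌈v⌉ - 1, that is n < v ≤ n + 1, already
    -- dominates; for v ≤ 0 the summand 1 does.
    have hpt (x : Plane) : ENNReal.ofReal (Real.exp (p * v x)) ≤
        1 + ∑' n : ℕ, {x | (n : ℝ) < v x}.indicator
          (fun _ ↦ ENNReal.ofReal (Real.exp (p * (n + 1)))) x := by
      rcases le_or_gt (v x) 0 with h | h
      · refine le_add_right ?_
        rw [← ENNReal.ofReal_one]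
        refine ENNReal.ofReal_le_ofReal ?_
        rw [Real.exp_le_one_iff]
        exact mul_nonpos_of_nonneg_of_nonpos hp h
      · refine le_add_left ?_
        obtain ⟨n, hn⟩ : ∃ n : ℕ, ⌈v x⌉₊ = n + 1 :=
          ⟨⌈v x⌉₊ - 1, (Nat.succ_pred_eq_of_pos (Nat.ceil_pos.2 h)).symm⟩
        refine le_trans ?_ (ENNReal.le_tsum n)
        have h1 : (n : ℝ) < v x := by
          have := Nat.ceil_lt_add_one h.le
          rw [hn] at this; push_cast at this; linarith
        have h2 : v x ≤ n + 1 := by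
          have := Nat.le_ceil (v x); rw [hn] at this; exact_mod_cast this
        rw [indicator_of_mem (show x ∈ {x | (n : ℝ) < v x} from h1)]
        gcongr
    have hm (n : ℕ) : MeasurableSet {x | (n : ℝ) < v x} :=
      (isOpen_lt continuous_const hv.continuous).measurableSet
    calc ∫⁻ x in B, ENNReal.ofReal (Real.exp (p * v x))
        ≤ ∫⁻ x in B, (1 + ∑' n : ℕ, {x | (n : ℝ) < v x}.indicator
          (fun _ ↦ ENNReal.ofReal (Real.exp (p * (n + 1)))) x) := lintegral_mono hpt
      _ = volume B + ∑' n : ℕ, ∫⁻ x in B, {x | (n : ℝ) < v x}.indicator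
          (fun _ ↦ ENNReal.ofReal (Real.exp (p * (n + 1)))) x := by
          rw [lintegral_add_left measurable_const, lintegral_tsum]
          · simp
          · exact fun n ↦ (measurable_const.indicator (hm n)).aemeasurable
      _ ≤ volume B + ∑' n : ℕ, volume B * ENNReal.ofReal (A * Real.exp (-(n : ℝ))) := by
          gcongr with n
          refine (setLIntegral_le_lintegral _ _).trans ?_
          rw [lintegral_indicator (hm n), setLIntegral_const]
          calc ENNReal.ofReal (Real.exp (p * (n + 1))) * volume {x | (n : ℝ) < v x}
              ≤ ENNReal.ofReal (Real.exp (p * (n + 1))) * (volume B * ENNReal.ofReal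
                (Real.exp (-(p + 1) * n) * Real.exp (Real.exp (p + 1) * c * D))) := by
                gcongr
                exact hdec v hv hvc D hD0 hD B hvB (p + 1) n
            _ = volume B * ENNReal.ofReal (Real.exp (p * (n + 1)) *
                (Real.exp (-(p + 1) * n) * Real.exp (Real.exp (p + 1) * c * D))) := by
                rw [ENNReal.ofReal_mul (by positivity) (p := Real.exp (p * (n + 1)))]; ring
            _ = _ := by
                congr 2
                rw [hA, ← Real.exp_add, ← Real.exp_add, ← Real.exp_add, ← Real.exp_add]
                congr 1; ring
      _ = ENNReal.ofReal (V * (1 + A * Z)) := by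
          rw [ENNReal.tsum_mul_left, ← ENNReal.ofReal_tsum_of_nonneg (fun n ↦ by positivity)
            (hgeo.mul_left A), tsum_mul_left, hVof, ENNReal.ofReal_mul hV0,
            ENNReal.ofReal_add zero_le_one (by positivity), ENNReal.ofReal_one]
          ring
  -- The factor 2 comes from applying the one-sided bound to `v` and to `-v`.
  refine ⟨2 * (V * (1 + A * Z)), by positivity, fun v hv hvc hD hvB ↦ ?_⟩
  have h1 := one v hv hvc hD hvB
  have h2 := one (fun x ↦ -v x) hv.neg hvc.neg (by
    have (x : Plane) : fderiv ℝ (fun x ↦ -v x) x = -fderiv ℝ v x := fderiv_fun_neg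
    simpa [this] using hD) (fun x hx ↦ by simp [hvB x hx])
  calc ∫⁻ x in B, ENNReal.ofReal (Real.exp (p * |v x|))
      ≤ ∫⁻ x in B, (ENNReal.ofReal (Real.exp (p * v x)) +
          ENNReal.ofReal (Real.exp (p * -v x))) := by
        refine lintegral_mono fun x ↦ ?_
        rcases abs_cases (v x) with ⟨h, -⟩ | ⟨h, -⟩ <;> rw [h]
        · exact le_add_right le_rfl
        · exact le_add_left le_rfl
    _ ≤ ENNReal.ofReal (V * (1 + A * Z)) + ENNReal.ofReal (V * (1 + A * Z)) := by
        rw [lintegral_add_left]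
        · gcongr
        · have := hv.continuous
          fun_prop
    _ = _ := by rw [← ENNReal.ofReal_add (by positivity) (by positivity)]; ring_nf

end PlaneAnalysis

/-! ### Mollification and Sobolev functions on the plane -/

section Mollify

/-- A bump function at the origin of the plane, supported in the ball of radius `1 / (k + 1)`. -/
def bumpSeq (k : ℕ) : ContDiffBump (0 : Plane) where
  rIn := 1 / (2 * (k + 1))
  rOut := 1 / (k + 1)
  rIn_pos := by positivity
  rIn_lt_rOut := by
    refine one_div_lt_one_div_of_lt (by positivity) ?_
    have : (0 : ℝ) ≤ k := k.cast_nonneg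
    linarith

/-- The standard mollifiers. -/
def mollifier (k : ℕ) : Plane → ℝ := (bumpSeq k).normed volume

/-- The mollification of a function. -/
def mollify (k : ℕ) (v : Plane → ℝ) (x : Plane) : ℝ := ∫ t, v t * mollifier k (x - t)

lemma mollifier_contDiff (k : ℕ) {n : ℕ∞} : ContDiff ℝ n (mollifier k) :=
  (bumpSeq k).contDiff_normed

lemma mollifier_continuous (k : ℕ) : Continuous (mollifier k) := (bumpSeq k).continuous_normed

lemma mollifier_hasCompactSupport (k : ℕ) : HasCompactSupport (mollifier k) :=
  (bumpSeq k).hasCompactSupport_normed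

lemma mollifier_nonneg (k : ℕ) (x : Plane) : 0 ≤ mollifier k x := (bumpSeq k).nonneg_normed x

lemma mollifier_integral (k : ℕ) : ∫ x, mollifier k x = 1 := (bumpSeq k).integral_normed

lemma mollifier_integrable (k : ℕ) : Integrable (mollifier k) := (bumpSeq k).integrable_normed

lemma mollifier_eq_zero (k : ℕ) {x : Plane} (hx : 1 / ((k : ℝ) + 1) ≤ ‖x‖) :
    mollifier k x = 0 := by
  refine Function.notMem_support.1 fun h ↦ ?_
  rw [mollifier, (bumpSeq k).support_normed_eq, mem_ball_zero_iff] at h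
  exact absurd h (not_lt.2 hx)

lemma mollify_eq_convolution (k : ℕ) (v : Plane → ℝ) :
    mollify k v = convolution v (mollifier k) (ContinuousLinearMap.lsmul ℝ ℝ) volume := rfl

lemma mollify_eq_convolution_left (k : ℕ) (v : Plane → ℝ) (x : Plane) :
    mollify k v x = convolution (mollifier k) v (ContinuousLinearMap.lsmul ℝ ℝ) volume x := by
  rw [convolution_lsmul_swap]
  simp only [mollify, smul_eq_mul, mul_comm]

lemma mollify_eq_integral_sub (k : ℕ) (v : Plane → ℝ) (x : Plane) :
    mollify k v x = ∫ z, v (x - z) * mollifier k z := by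
  rw [mollify_eq_convolution_left, convolution_lsmul]
  simp only [smul_eq_mul, mul_comm]

lemma mollify_contDiff (k : ℕ) {v : Plane → ℝ} (hv : LocallyIntegrable v) :
    ContDiff ℝ 1 (mollify k v) := by
  rw [mollify_eq_convolution]
  exact (mollifier_hasCompactSupport k).contDiff_convolution_right (n := 1) _ hv
    (mollifier_contDiff k)

/-- The ratio of outer to inner radius of the bumps is always 2, the uniformity that convergence at
Lebesgue points requires. -/
lemma mollify_tendsto_ae {v : Plane → ℝ} (hv : LocallyIntegrable v) :
    ∀ᵐ x, Tendsto (fun k ↦ mollify k v x) atTop (𝓝 (v x)) := by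
  simp only [mollify_eq_convolution_left]
  refine ContDiffBump.ae_convolution_tendsto_right_of_locallyIntegrable (φ := bumpSeq) (K := 2)
    tendsto_one_div_add_atTop_nhds_zero_nat (Eventually.of_forall fun k ↦ ?_) hv
  change 1 / ((k : ℝ) + 1) ≤ 2 * (1 / (2 * ((k : ℝ) + 1)))
  field_simp
  exact le_rfl

lemma mollify_eq_zero (k : ℕ) {v : Plane → ℝ} {y₀ : Plane} {r : ℝ}
    (hv : ∀ y ∉ Metric.closedBall y₀ r, v y = 0) {x : Plane}
    (hx : x ∉ Metric.closedBall y₀ (r + 1)) : mollify k v x = 0 := by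
  rw [mollify]
  refine integral_eq_zero_of_ae (Eventually.of_forall fun t ↦ ?_)
  by_cases ht : t ∈ Metric.closedBall y₀ r
  · have : mollifier k (x - t) = 0 := by
      refine mollifier_eq_zero k ?_
      rw [Metric.mem_closedBall, not_le] at hx
      rw [Metric.mem_closedBall] at ht
      have h1 := dist_triangle x t y₀
      rw [dist_eq_norm x t] at h1
      have h2 : 1 / ((k : ℝ) + 1) ≤ 1 := by
        rw [div_le_one (by positivity)]; linarith [(k.cast_nonneg : (0 : ℝ) ≤ k)]
      linarith
    simp [this]
  · simp [hv t ht]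

lemma mollify_hasCompactSupport (k : ℕ) {v : Plane → ℝ} {y₀ : Plane} {r : ℝ}
    (hv : ∀ y ∉ Metric.closedBall y₀ r, v y = 0) : HasCompactSupport (mollify k v) :=
  HasCompactSupport.intro (isCompact_closedBall y₀ (r + 1)) fun _ hx ↦ mollify_eq_zero k hv hx

/-- The derivatives of the mollification are the mollifications of the weak derivatives. -/
lemma fderiv_mollify (k : ℕ) {v w : Plane → ℝ} {i : Fin 2} (h : HasWeakPartialDeriv univ i v w)
    (x : Plane) : fderiv ℝ (mollify k v) x (stdVec i) = mollify k w x := by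
  have hv : LocallyIntegrable v := locallyIntegrableOn_univ.1 h.locInt
  have h1 := (mollifier_hasCompactSupport k).hasFDerivAt_convolution_right
    (ContinuousLinearMap.lsmul ℝ ℝ) hv (mollifier_contDiff k (n := 1)) x
  rw [← mollify_eq_convolution] at h1
  rw [h1.fderiv, convolution_precompR_apply _ hv ((mollifier_hasCompactSupport k).fderiv ℝ)
    ((mollifier_contDiff k (n := 1)).continuous_fderiv one_ne_zero)]
  -- Differentiating in t rather than x changes the sign, which cancels the sign in the definition
  -- of the weak derivative.
  have hd (t : Plane) : fderiv ℝ (fun t ↦ mollifier k (x - t)) t (stdVec i) =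
      -fderiv ℝ (mollifier k) (x - t) (stdVec i) := by
    have h2 : HasFDerivAt (fun t : Plane ↦ x - t) (-ContinuousLinearMap.id ℝ Plane) t :=
      (hasFDerivAt_id t).const_sub x
    have h3 := (((mollifier_contDiff k (n := 1)).differentiable one_ne_zero
      (x - t)).hasFDerivAt).comp t h2
    have h4 : fderiv ℝ (fun t ↦ mollifier k (x - t)) t = _ := h3.fderiv
    rw [h4]; simp
  have hp := h.parts (fun t ↦ mollifier k (x - t))
    ((mollifier_contDiff k (n := ⊤)).comp (contDiff_const.sub contDiff_id))
    ((mollifier_hasCompactSupport k).comp_homeomorph (Homeomorph.subLeft x)) (subset_univ _)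
  simp only [hd, Measure.restrict_univ, mul_neg, integral_neg, neg_inj] at hp
  exact hp

/-- Jensen's inequality for averages against a mollifier. -/
lemma lintegral_average_sq_le (k : ℕ) {h : Plane → Plane → ℝ}
    (hm : Measurable (Function.uncurry h)) :
    ∫⁻ x, ‖∫ z, h x z * mollifier k z‖ₑ ^ 2 ≤
      ∫⁻ z, ENNReal.ofReal (mollifier k z) * ∫⁻ x, ‖h x z‖ₑ ^ 2 := by
  have hρm : Measurable fun z ↦ ENNReal.ofReal (mollifier k z) :=
    (mollifier_continuous k).measurable.ennreal_ofReal
  -- The mollifier is the density of a probability measure, so Cauchy–Schwarz against the constant 1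
  -- is Jensen's inequality for the square.
  set μ : Measure Plane := volume.withDensity fun z ↦ ENNReal.ofReal (mollifier k z) with hμ
  have hone : μ univ = 1 := by
    rw [hμ, withDensity_apply _ MeasurableSet.univ, Measure.restrict_univ,
      ← ofReal_integral_eq_lintegral_ofReal (mollifier_integrable k)
      (Eventually.of_forall (mollifier_nonneg k)), mollifier_integral, ENNReal.ofReal_one]
  have : IsProbabilityMeasure μ := ⟨hone⟩
  have hpt (x : Plane) : ‖∫ z, h x z * mollifier k z‖ₑ ^ 2 ≤ ∫⁻ z, ‖h x z‖ₑ ^ 2 ∂μ := by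
    have hmx : Measurable fun z ↦ ‖h x z‖ₑ := (hm.comp measurable_prodMk_left).enorm
    calc ‖∫ z, h x z * mollifier k z‖ₑ ^ 2
        ≤ (∫⁻ z, ‖h x z‖ₑ ∂μ) ^ 2 := by
          gcongr
          refine (enorm_integral_le_lintegral_enorm _).trans ?_
          rw [hμ, lintegral_withDensity_eq_lintegral_mul _ hρm hmx]
          refine lintegral_mono fun z ↦ ?_
          rw [enorm_mul, Pi.mul_apply, mul_comm, Real.enorm_of_nonneg (mollifier_nonneg k z)]
      _ ≤ 1 * ∫⁻ z, ‖h x z‖ₑ ^ 2 ∂μ := by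
          rw [← hone]; exact sq_lintegral_le μ hmx.aemeasurable
      _ = _ := one_mul _
  calc ∫⁻ x, ‖∫ z, h x z * mollifier k z‖ₑ ^ 2
      ≤ ∫⁻ x, ∫⁻ z, ‖h x z‖ₑ ^ 2 ∂μ := lintegral_mono hpt
    _ = ∫⁻ z, (∫⁻ x, ‖h x z‖ₑ ^ 2) ∂μ :=
        lintegral_lintegral_swap (hm.enorm.pow_const 2).aemeasurable
    _ = _ := by
        rw [hμ, lintegral_withDensity_eq_lintegral_mul _ hρm]
        · rfl
        · exact (hm.enorm.pow_const 2).lintegral_prod_left'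

lemma lintegral_mollifier (k : ℕ) : ∫⁻ z, ENNReal.ofReal (mollifier k z) = 1 := by
  rw [← ofReal_integral_eq_lintegral_ofReal (mollifier_integrable k)
      (Eventually.of_forall (mollifier_nonneg k)), mollifier_integral, ENNReal.ofReal_one]

lemma lintegral_mollify_sq_le (k : ℕ) {w : Plane → ℝ} (hw : Measurable w) :
    ∫⁻ x, ‖mollify k w x‖ₑ ^ 2 ≤ ∫⁻ x, ‖w x‖ₑ ^ 2 := by
  simp only [mollify_eq_integral_sub]
  refine (lintegral_average_sq_le k (h := fun x z ↦ w (x - z)) ?_).trans ?_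
  · exact hw.comp (measurable_fst.sub measurable_snd)
  · have (z : Plane) : ∫⁻ x, ‖w (x - z)‖ₑ ^ 2 = ∫⁻ x, ‖w x‖ₑ ^ 2 :=
      lintegral_sub_right_eq_self (fun x ↦ ‖w x‖ₑ ^ 2) z
    simp only [this]
    rw [lintegral_mul_const _ (mollifier_continuous k).measurable.ennreal_ofReal,
      lintegral_mollifier, one_mul]

/-- `v` is a function on the plane with support in a closed ball, with square integrable weak
partial derivatives `w i`; the Dirichlet integral is at most `D`. -/
structure IsPlaneH1 (y₀ : Plane) (r D : ℝ) (v : Plane → ℝ) (w : Fin 2 → Plane → ℝ) : Prop where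
  measurable : Measurable v
  measurable_deriv : ∀ i, Measurable (w i)
  supp : ∀ y ∉ Metric.closedBall y₀ r, v y = 0
  weak : ∀ i, HasWeakPartialDeriv univ i v (w i)
  bound : (∫⁻ x, ‖w 0 x‖ₑ ^ 2) + ∫⁻ x, ‖w 1 x‖ₑ ^ 2 ≤ ENNReal.ofReal D

variable {y₀ : Plane} {r D : ℝ} {v : Plane → ℝ} {w : Fin 2 → Plane → ℝ}

lemma IsPlaneH1.locallyIntegrable (h : IsPlaneH1 y₀ r D v w) : LocallyIntegrable v :=
  locallyIntegrableOn_univ.1 (h.weak 0).locInt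

/-- The gradient of the mollification is the mollified weak gradient, and averaging does not
increase the L² norm. The estimates for smooth functions therefore apply with the same `D`. -/
lemma IsPlaneH1.lintegral_fderiv_mollify_le (h : IsPlaneH1 y₀ r D v w) (k : ℕ) :
    ∫⁻ x, ‖fderiv ℝ (mollify k v) x‖ₑ ^ 2 ≤ ENNReal.ofReal D := by
  have hc := (mollify_contDiff k h.locallyIntegrable).continuous_fderiv one_ne_zero
  calc ∫⁻ x, ‖fderiv ℝ (mollify k v) x‖ₑ ^ 2
      ≤ ∫⁻ x, (‖fderiv ℝ (mollify k v) x (stdVec 0)‖ₑ ^ 2 +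
        ‖fderiv ℝ (mollify k v) x (stdVec 1)‖ₑ ^ 2) :=
        lintegral_mono fun x ↦ norm_fderiv_sq_le _ x
    _ = (∫⁻ x, ‖mollify k (w 0) x‖ₑ ^ 2) + ∫⁻ x, ‖mollify k (w 1) x‖ₑ ^ 2 := by
        rw [lintegral_add_left]
        · simp only [fderiv_mollify k (h.weak _)]
        · exact ((hc.clm_apply continuous_const).enorm.measurable.pow_const 2)
    _ ≤ _ := (add_le_add (lintegral_mollify_sq_le k (h.measurable_deriv 0))
        (lintegral_mollify_sq_le k (h.measurable_deriv 1))).trans h.bound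

/-- Exponential integrability, uniformly for bounded Dirichlet integrals. -/
lemma exists_exp_bound_planeH1 (p : ℝ) (hp : 0 ≤ p) (D : ℝ) (hD : 0 ≤ D) (y₀ : Plane) (r : ℝ) :
    ∃ C : ℝ, 0 ≤ C ∧ ∀ v w, IsPlaneH1 y₀ r D v w →
      ∫⁻ x in Metric.closedBall y₀ r, ENNReal.ofReal (Real.exp (p * |v x|)) ≤
        ENNReal.ofReal C := by
  obtain ⟨C, hC0, hC⟩ := exists_exp_bound_of_smooth p hp D hD
    (B := Metric.closedBall y₀ (r + 1)) measure_closedBall_lt_top.ne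
  refine ⟨C, hC0, fun v w h ↦ ?_⟩
  have hmono : ∫⁻ x in Metric.closedBall y₀ r, ENNReal.ofReal (Real.exp (p * |v x|)) ≤
      ∫⁻ x in Metric.closedBall y₀ (r + 1), ENNReal.ofReal (Real.exp (p * |v x|)) :=
    lintegral_mono_set (Metric.closedBall_subset_closedBall (by linarith))
  refine hmono.trans ?_
  -- Fatou's lemma along the mollifications carries the smooth bound over to `v`; their supports lie
  -- in a common ball, with radius larger by 1.
  have hlim : ∀ᵐ x ∂(volume.restrict (Metric.closedBall y₀ (r + 1))),
      ENNReal.ofReal (Real.exp (p * |v x|)) =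
      liminf (fun k ↦ ENNReal.ofReal (Real.exp (p * |mollify k v x|))) atTop := by
    filter_upwards [ae_restrict_of_ae (mollify_tendsto_ae h.locallyIntegrable)] with x hx
    refine (Tendsto.liminf_eq ?_).symm
    exact (ENNReal.continuous_ofReal.tendsto _).comp
      ((Real.continuous_exp.tendsto _).comp ((hx.abs).const_mul p))
  rw [lintegral_congr_ae hlim]
  refine (lintegral_liminf_le fun k ↦ ?_).trans ?_
  · have := (mollify_contDiff k h.locallyIntegrable).continuous
    fun_prop
  · refine liminf_le_of_frequently_le' (Frequently.of_forall fun k ↦ ?_)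
    exact hC _ (mollify_contDiff k h.locallyIntegrable) (mollify_hasCompactSupport k h.supp)
      (h.lintegral_fderiv_mollify_le k) fun x hx ↦ mollify_eq_zero k h.supp hx

/-- Fatou's lemma again: mollifications satisfy the estimate with a uniform constant and converge
almost everywhere. -/
lemma IsPlaneH1.lintegral_translate_le (h : IsPlaneH1 y₀ r D v w) (z : Plane) :
    ∫⁻ x, ‖v (x + z) - v x‖ₑ ^ 2 ≤ ‖z‖ₑ ^ 2 * ENNReal.ofReal D := by
  have hae := mollify_tendsto_ae h.locallyIntegrable
  have hae2 : ∀ᵐ x, Tendsto (fun k ↦ mollify k v (x + z)) atTop (𝓝 (v (x + z))) :=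
    (measurePreserving_add_right volume z).quasiMeasurePreserving.ae hae
  have hlim : ∀ᵐ x, ‖v (x + z) - v x‖ₑ ^ 2 =
      liminf (fun k ↦ ‖mollify k v (x + z) - mollify k v x‖ₑ ^ 2) atTop := by
    filter_upwards [hae, hae2] with x h1 h2
    refine (Tendsto.liminf_eq ?_).symm
    exact (ENNReal.continuous_pow 2).continuousAt.tendsto.comp (h2.sub h1).enorm
  rw [lintegral_congr_ae hlim]
  refine (lintegral_liminf_le fun k ↦ ?_).trans ?_
  · have := (mollify_contDiff k h.locallyIntegrable).continuous.measurable
    fun_prop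
  · refine liminf_le_of_frequently_le' (Frequently.of_forall fun k ↦ ?_)
    refine (lintegral_translate_sub_sq_le (mollify_contDiff k h.locallyIntegrable) z).trans ?_
    gcongr
    exact h.lintegral_fderiv_mollify_le k

/-- The mollification converges in `L²` at a uniform rate. -/
lemma IsPlaneH1.lintegral_mollify_sub_le (h : IsPlaneH1 y₀ r D v w) (k : ℕ) :
    ∫⁻ x, ‖mollify k v x - v x‖ₑ ^ 2 ≤ ENNReal.ofReal ((1 / (k + 1)) ^ 2 * D) := by
  have hint (x : Plane) : Integrable fun z ↦ v (x - z) * mollifier k z := by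
    have h1 : LocallyIntegrable v := h.locallyIntegrable
    have := (mollifier_hasCompactSupport k).convolutionExists_right
      (ContinuousLinearMap.lsmul ℝ ℝ) h1 (mollifier_continuous k) x
    have h2 := this.integrable_swap
    simpa using h2
  -- As the mollifier has integral 1, the error is an average of increments of `v` over shifts
  -- shorter than 1/(k+1).
  have heq (x : Plane) : mollify k v x - v x = ∫ z, (v (x - z) - v x) * mollifier k z := by
    simp only [sub_mul]
    rw [integral_sub (hint x) ((mollifier_integrable k).const_mul _), integral_const_mul,
      mollifier_integral, mul_one, mollify_eq_integral_sub]
  simp only [heq]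
  refine (lintegral_average_sq_le k (h := fun x z ↦ v (x - z) - v x) ?_).trans ?_
  · exact (h.measurable.comp (measurable_fst.sub measurable_snd)).sub
      (h.measurable.comp measurable_fst)
  · calc ∫⁻ z, ENNReal.ofReal (mollifier k z) * ∫⁻ x, ‖v (x - z) - v x‖ₑ ^ 2
        ≤ ∫⁻ z, ENNReal.ofReal (mollifier k z) * ENNReal.ofReal ((1 / (k + 1)) ^ 2 * D) := by
          refine lintegral_mono fun z ↦ ?_
          rcases le_or_gt (1 / ((k : ℝ) + 1)) ‖z‖ with hz | hz
          · simp [mollifier_eq_zero k hz]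
          · dsimp only
            gcongr
            have := h.lintegral_translate_le (-z)
            simp only [← sub_eq_add_neg, enorm_neg] at this
            refine this.trans ?_
            rw [ENNReal.ofReal_mul (by positivity), ENNReal.ofReal_pow (by positivity)]
            gcongr
            rw [← ofReal_norm]
            exact ENNReal.ofReal_le_ofReal hz.le
      _ = _ := by
          rw [lintegral_mul_const _ (mollifier_continuous k).measurable.ennreal_ofReal,
            lintegral_mollifier, one_mul]

end Mollify

/-! ### Change of charts and the Riemannian volume -/

section ChartChange

variable {M : Type*} [TopologicalSpace M] [ChartedSpace Plane M] [IsManifold (𝓡 2) ∞ M]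

lemma plane_eq_sum (z : Plane) : z = z 0 • stdVec 0 + z 1 • stdVec 1 := by
  ext i; fin_cases i <;> simp

lemma plane_det (L : Plane →L[ℝ] Plane) :
    L.det = L (stdVec 0) 0 * L (stdVec 1) 1 - L (stdVec 0) 1 * L (stdVec 1) 0 := by
  have := LinearMap.det_toMatrix (EuclideanSpace.basisFun (Fin 2) ℝ).toBasis
    (L : Plane →ₗ[ℝ] Plane)
  rw [ContinuousLinearMap.det, ← this, Matrix.det_fin_two]
  simp [LinearMap.toMatrix_apply]
  ring

/-- The metric as a bilinear form on the model space. -/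
def metricForm (g : Metric M) (p : M) : Plane →L[ℝ] Plane →L[ℝ] ℝ := g.inner p

lemma bilin_gram_transform (b : Plane →L[ℝ] Plane →L[ℝ] ℝ) (c d : Plane) (h : b d c = b c d)
    (s t s' t' : ℝ) :
    b (s • c + t • d) (s • c + t • d) * b (s' • c + t' • d) (s' • c + t' • d) -
      b (s • c + t • d) (s' • c + t' • d) ^ 2 =
      (s * t' - t * s') ^ 2 * (b c c * b d d - b c d ^ 2) := by
  simp only [map_add, map_smul, add_apply, smul_apply, smul_eq_mul, h]
  ring

lemma transition_differentiableAt (x x' : M) {y : Plane} (hy : y ∈ (chartAt Plane x').target)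
    (hy' : (chartAt Plane x').symm y ∈ (chartAt Plane x).source) :
    DifferentiableAt ℝ (chartAt Plane x ∘ (chartAt Plane x').symm) y := by
  have h1 : MDifferentiableAt (𝓡 2) (𝓡 2) (chartAt Plane x').symm y :=
    (mdifferentiable_chart (I := 𝓡 2) x').mdifferentiableAt_symm hy
  have h2 : MDifferentiableAt (𝓡 2) (𝓡 2) (chartAt Plane x) ((chartAt Plane x').symm y) :=
    (mdifferentiable_chart (I := 𝓡 2) x).mdifferentiableAt hy'
  exact mdifferentiableAt_iff_differentiableAt.1 (h2.comp y h1)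

/-- Chain rule for the identity e'⁻¹ = e⁻¹ ∘ τ near y. The two base points are equal only
propositionally, so the vectors are compared in the common model plane. -/
lemma coordVec_transition (x x' : M) {y : Plane} (hy : y ∈ (chartAt Plane x').target)
    (hy' : (chartAt Plane x').symm y ∈ (chartAt Plane x).source) (i : Fin 2) :
    (coordVec x' y i : Plane) =
      chartDeriv x ((chartAt Plane x ∘ (chartAt Plane x').symm) y)
        (fderiv ℝ (chartAt Plane x ∘ (chartAt Plane x').symm) y (stdVec i)) := by
  set e := chartAt Plane x with he
  set e' := chartAt Plane x' with he'
  set τ : Plane → Plane := e ∘ e'.symm with hτ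
  have hτd := transition_differentiableAt x x' hy hy'
  have hτm : MDifferentiableAt (𝓡 2) (𝓡 2) τ y := hτd.mdifferentiableAt
  have hτy : τ y ∈ e.target := e.map_source hy'
  have h2 : MDifferentiableAt (𝓡 2) (𝓡 2) e.symm (τ y) :=
    (mdifferentiable_chart (I := 𝓡 2) x).mdifferentiableAt_symm hτy
  have hev : e'.symm =ᶠ[𝓝 y] e.symm ∘ τ := by
    have hc : ContinuousAt e'.symm y := e'.continuousAt_symm hy
    filter_upwards [hc.preimage_mem_nhds (e.open_source.mem_nhds hy')] with z hz
    exact (e.left_inv hz).symm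
  have h3 : mfderiv (𝓡 2) (𝓡 2) e'.symm y = mfderiv (𝓡 2) (𝓡 2) (e.symm ∘ τ) y := hev.mfderiv_eq
  have h4 := mfderiv_comp y h2 hτm
  have h5 : mfderiv (𝓡 2) (𝓡 2) τ y = fderiv ℝ τ y := mfderiv_eq_fderiv
  unfold coordVec chartDeriv
  rw [← he', h3, h4, h5]
  rfl

/-- The new coordinate fields are combinations of the old ones with Jacobian coefficients, so the
Gram determinant acquires the square of the Jacobian. Its root is thus a density. -/
lemma gram_det_transition (g : Metric M) (x x' : M) {y : Plane}
    (hy : y ∈ (chartAt Plane x').target)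
    (hy' : (chartAt Plane x').symm y ∈ (chartAt Plane x).source) :
    (gram g x' y).det = (fderiv ℝ (chartAt Plane x ∘ (chartAt Plane x').symm) y).det ^ 2 *
      (gram g x ((chartAt Plane x ∘ (chartAt Plane x').symm) y)).det := by
  have hp : (chartAt Plane x).symm ((chartAt Plane x ∘ (chartAt Plane x').symm) y) =
    (chartAt Plane x').symm y := (chartAt Plane x).left_inv hy'
  have c (i : Fin 2) := coordVec_transition x x' hy hy' i
  set L := fderiv ℝ (chartAt Plane x ∘ (chartAt Plane x').symm) y with hL
  set z := (chartAt Plane x ∘ (chartAt Plane x').symm) y with hz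
  have h1 : (gram g x' y).det = metricForm g ((chartAt Plane x').symm y) (coordVec x' y 0)
      (coordVec x' y 0) * metricForm g ((chartAt Plane x').symm y) (coordVec x' y 1)
      (coordVec x' y 1) - metricForm g ((chartAt Plane x').symm y) (coordVec x' y 0)
      (coordVec x' y 1) ^ 2 := gram_det g x' y
  have h2 : (gram g x z).det = metricForm g ((chartAt Plane x).symm z) (coordVec x z 0)
      (coordVec x z 0) * metricForm g ((chartAt Plane x).symm z) (coordVec x z 1)
      (coordVec x z 1) - metricForm g ((chartAt Plane x).symm z) (coordVec x z 0)
      (coordVec x z 1) ^ 2 := gram_det g x z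
  have hsymm : metricForm g ((chartAt Plane x').symm y) (coordVec x z 1) (coordVec x z 0) =
      metricForm g ((chartAt Plane x').symm y) (coordVec x z 0) (coordVec x z 1) :=
    g.symm _ _ _
  have hexp (i : Fin 2) : (coordVec x' y i : Plane) =
      (L (stdVec i) 0) • (coordVec x z 0 : Plane) +
        (L (stdVec i) 1) • (coordVec x z 1 : Plane) := by
    rw [c i]
    conv_lhs => rw [plane_eq_sum (L (stdVec i))]
    rw [map_add, map_smul, map_smul]
    rfl
  rw [h1, h2, hp, hexp 0, hexp 1, plane_det]
  exact bilin_gram_transform _ _ _ hsymm _ _ _ _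

section Measure

variable [MeasurableSpace M] [BorelSpace M]

lemma measurableSet_chart_preimage (x : M) {S : Set M} (hS : MeasurableSet S) :
    MeasurableSet ((chartAt Plane x).target ∩ (chartAt Plane x).symm ⁻¹' S) := by
  have h1 : Measurable ((chartAt Plane x).target.domRestrict (chartAt Plane x).symm) :=
    (continuousOn_iff_continuous_domRestrict.1 (chartAt Plane x).continuousOn_symm).measurable
  have h2 := (chartAt Plane x).open_target.measurableSet.subtype_image (h1 hS)
  convert h2 using 1
  ext y
  simp [and_comm]

/-- The density of the chart measure. -/
def density (g : Metric M) (x : M) (y : Plane) : ℝ≥0∞ := ENNReal.ofReal (√(gram g x y).det)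

lemma lintegral_chartVolume (g : Metric M) (x : M) {f : M → ℝ≥0∞} (hf : Measurable f) :
    ∫⁻ p, f p ∂(chartVolume g x) =
      ∫⁻ y in (chartAt Plane x).target, density g x y * f ((chartAt Plane x).symm y) := by
  have h1 := chart_symm_aemeasurable x
  rw [chartVolume, lintegral_map' hf.aemeasurable
    (h1.mono_ac (withDensity_absolutelyContinuous _ _)),
    lintegral_withDensity_eq_lintegral_mul₀ (g := fun y ↦ f ((chartAt Plane x).symm y))
      (density_aemeasurable g x) (hf.comp_aemeasurable h1)]
  rfl

lemma chartVolume_apply (g : Metric M) (x : M) {S : Set M} (hS : MeasurableSet S) :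
    chartVolume g x S = ∫⁻ y in (chartAt Plane x).target ∩ (chartAt Plane x).symm ⁻¹' S,
      density g x y := by
  have h := lintegral_chartVolume g x (f := S.indicator 1) (measurable_one.indicator hS)
  rw [lintegral_indicator_one hS] at h
  rw [h]
  have hm := measurableSet_chart_preimage x hS
  have ht := (chartAt Plane x).open_target.measurableSet
  rw [← lintegral_indicator hm, ← lintegral_indicator ht]
  refine lintegral_congr fun y ↦ ?_
  by_cases h1 : y ∈ (chartAt Plane x).target <;> by_cases h2 : (chartAt Plane x).symm y ∈ S <;>
    simp [indicator, h1, h2]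

/-- The chart measures agree on overlaps of charts. -/
lemma chartVolume_apply_le (g : Metric M) (x x' : M) {S : Set M} (hS : MeasurableSet S)
    (hSx : S ⊆ (chartAt Plane x).source) : chartVolume g x' S ≤ chartVolume g x S := by
  rw [chartVolume_apply g x' hS, chartVolume_apply g x hS]
  set e := chartAt Plane x with he
  set e' := chartAt Plane x' with he'
  set τ : Plane → Plane := e ∘ e'.symm with hτ
  set A := e'.target ∩ e'.symm ⁻¹' S with hA
  have hAm : MeasurableSet A := measurableSet_chart_preimage x' hS
  have hdiff : ∀ y ∈ A, HasFDerivWithinAt τ (fderiv ℝ τ y) A y := fun y hy ↦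
    (transition_differentiableAt x x' hy.1 (hSx hy.2)).hasFDerivAt.hasFDerivWithinAt
  have hinj : InjOn τ A := by
    intro y hy z hz h
    have h1 : e'.symm y = e'.symm z := e.injOn (hSx hy.2) (hSx hz.2) h
    exact e'.symm.injOn hy.1 hz.1 h1
  have himg : τ '' A ⊆ e.target ∩ e.symm ⁻¹' S := by
    rintro _ ⟨y, hy, rfl⟩
    refine ⟨e.map_source (hSx hy.2), ?_⟩
    change e.symm (e (e'.symm y)) ∈ S
    rw [e.left_inv (hSx hy.2)]
    exact hy.2
  calc ∫⁻ y in A, density g x' y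
      = ∫⁻ y in A, ENNReal.ofReal |(fderiv ℝ τ y).det| * density g x (τ y) := by
        refine setLIntegral_congr_fun hAm fun y hy ↦ ?_
        rw [density, density, ← ENNReal.ofReal_mul (abs_nonneg _),
          gram_det_transition g x x' hy.1 (hSx hy.2), Real.sqrt_mul (sq_nonneg _),
          Real.sqrt_sq_eq_abs]
    -- Change of variables: the Jacobian factor of `√det` is exactly the one in the area formula.
    _ = ∫⁻ y in τ '' A, density g x y :=
        (lintegral_image_eq_lintegral_abs_det_fderiv_mul volume hAm hdiff hinj _).symm
    _ ≤ _ := lintegral_mono_set himg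

lemma chartVolume_compl_source (g : Metric M) (x : M) :
    chartVolume g x (chartAt Plane x).sourceᶜ = 0 := by
  rw [chartVolume_apply g x (chartAt Plane x).open_source.measurableSet.compl]
  have : (chartAt Plane x).target ∩ (chartAt Plane x).symm ⁻¹' (chartAt Plane x).sourceᶜ = ∅ := by
    ext y
    simp only [mem_inter_iff, mem_preimage, mem_compl_iff, mem_empty_iff_false, iff_false,
      not_and, not_not]
    exact fun hy ↦ (chartAt Plane x).map_target hy
  rw [this]; simp

/-- On the domain of a chart the Riemannian volume is the chart measure. -/
lemma riemannianVolume_restrict_source (g : Metric M) (x : M) :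
    (riemannianVolume g).restrict (chartAt Plane x).source = chartVolume g x := by
  have hsm := (chartAt Plane x).open_source.measurableSet
  refine le_antisymm ?_ ?_
  -- Each chart measure is split along the domain of the chart at `x`: the inner part is dominated
  -- by `chartVolume g x`, the outer part disappears after restriction. So the supremum adds nothing
  -- inside a chart.
  · have h1 : riemannianVolume g ≤
        chartVolume g x + (riemannianVolume g).restrict (chartAt Plane x).sourceᶜ := by
      refine iSup_le fun x' ↦ ?_
      refine Measure.le_iff.2 fun S hS ↦ ?_
      rw [← measure_inter_add_sdiff S hsm, Measure.add_apply,
        Measure.restrict_apply hS]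
      refine add_le_add ?_ ?_
      · exact (chartVolume_apply_le g x x' (hS.inter hsm) inter_subset_right).trans
          (measure_mono inter_subset_left)
      · rw [sdiff_eq]
        exact chartVolume_le g x' _
    refine (Measure.restrict_mono le_rfl h1).trans ?_
    rw [Measure.restrict_add, Measure.restrict_restrict hsm]
    simp only [inter_compl_self, Measure.restrict_empty, add_zero]
    exact Measure.restrict_le_self
  · rw [← Measure.restrict_eq_self_of_ae_mem (s := (chartAt Plane x).source)
      (μ := chartVolume g x) (measure_eq_zero_iff_ae_notMem.1
        (chartVolume_compl_source g x) |>.mono fun p hp ↦ not_not.1 hp)]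
    exact Measure.restrict_mono le_rfl (chartVolume_le g x)

lemma setLIntegral_source (g : Metric M) (x : M) {f : M → ℝ≥0∞} (hf : Measurable f) :
    ∫⁻ p in (chartAt Plane x).source, f p ∂(riemannianVolume g) =
      ∫⁻ y in (chartAt Plane x).target, density g x y * f ((chartAt Plane x).symm y) := by
  rw [riemannianVolume_restrict_source, lintegral_chartVolume g x hf]

end Measure

end ChartChange

/-! ### Cutoffs of weakly differentiable functions -/

section Cutoff

/-- Testing against η ψ is allowed for every ψ on the plane, because η already has compact support
in Ω. The product rule then moves one term to the other side, and extension by zero stays weakly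
differentiable. -/
lemma HasWeakPartialDeriv.cutoff {Ω : Set Plane} (hΩ : IsOpen Ω) {i : Fin 2} {f w : Plane → ℝ}
    (h : HasWeakPartialDeriv Ω i f w) {η : Plane → ℝ} (h1 : ContDiff ℝ ∞ η)
    (h2 : HasCompactSupport η) (h3 : tsupport η ⊆ Ω) :
    HasWeakPartialDeriv univ i (Ω.indicator fun y ↦ f y * η y)
      (Ω.indicator fun y ↦ f y * fderiv ℝ η y (stdVec i) + w y * η y) := by
  have hc : Continuous fun y ↦ fderiv ℝ η y (stdVec i) :=
    (h1.continuous_fderiv (by simp)).clm_apply continuous_const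
  have hcs : HasCompactSupport fun y ↦ fderiv ℝ η y (stdVec i) := h2.fderiv_apply ℝ _
  have hss : tsupport (fun y ↦ fderiv ℝ η y (stdVec i)) ⊆ Ω :=
    (tsupport_fderiv_apply_subset ℝ _).trans h3
  have i1 := integrable_mul_test h.locInt h1.continuous h2 h3
  have i2 := integrable_mul_test h.locInt hc hcs hss
  have i3 := integrable_mul_test h.locInt_deriv h1.continuous h2 h3
  refine ⟨?_, ?_, fun ψ hψ1 hψ2 hψ3 ↦ ?_⟩
  · exact ((integrable_indicator_iff hΩ.measurableSet).2 i1).locallyIntegrable.locallyIntegrableOn _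
  · exact ((integrable_indicator_iff hΩ.measurableSet).2
      (i2.add i3)).locallyIntegrable.locallyIntegrableOn _
  · have hηψ := h.parts (fun y ↦ η y * ψ y) (h1.mul hψ1) (h2.mul_right)
      ((tsupport_mul_subset_left).trans h3)
    have hd (y : Plane) : fderiv ℝ (fun y ↦ η y * ψ y) y (stdVec i) =
        η y * fderiv ℝ ψ y (stdVec i) + ψ y * fderiv ℝ η y (stdVec i) := by
      rw [fderiv_fun_mul (h1.differentiable (by simp) y) (hψ1.differentiable (by simp) y)]
      simp
    simp only [hd] at hηψ
    have hψc : Continuous fun y ↦ fderiv ℝ ψ y (stdVec i) :=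
      (hψ1.continuous_fderiv (by simp)).clm_apply continuous_const
    have j1 : Integrable (fun y ↦ f y * (η y * fderiv ℝ ψ y (stdVec i))) (volume.restrict Ω) :=
      integrable_mul_test h.locInt (h1.continuous.mul hψc) h2.mul_right
        (tsupport_mul_subset_left.trans h3)
    have j2 : Integrable (fun y ↦ f y * (ψ y * fderiv ℝ η y (stdVec i))) (volume.restrict Ω) :=
      integrable_mul_test h.locInt (hψ1.continuous.mul hc) hcs.mul_left
        (tsupport_mul_subset_right.trans hss)
    have j3 : Integrable (fun y ↦ w y * (η y * ψ y)) (volume.restrict Ω) :=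
      integrable_mul_test h.locInt_deriv (h1.continuous.mul hψ1.continuous) h2.mul_right
        (tsupport_mul_subset_left.trans h3)
    simp only [mul_add] at hηψ
    rw [integral_add j1 j2] at hηψ
    simp only [Measure.restrict_univ]
    have e1 : ∫ y, Ω.indicator (fun y ↦ f y * η y) y * fderiv ℝ ψ y (stdVec i) =
        ∫ y in Ω, f y * (η y * fderiv ℝ ψ y (stdVec i)) := by
      rw [← integral_indicator hΩ.measurableSet]
      refine integral_congr_ae (Eventually.of_forall fun y ↦ ?_)
      by_cases hy : y ∈ Ω <;> simp [hy, mul_assoc]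
    have e2 : ∫ y, Ω.indicator (fun y ↦ f y * fderiv ℝ η y (stdVec i) + w y * η y) y * ψ y =
        ∫ y in Ω, (f y * (ψ y * fderiv ℝ η y (stdVec i)) + w y * (η y * ψ y)) := by
      rw [← integral_indicator hΩ.measurableSet]
      refine integral_congr_ae (Eventually.of_forall fun y ↦ ?_)
      by_cases hy : y ∈ Ω
      · simp only [hy, indicator_of_mem]; ring
      · simp [hy]
    rw [e1, e2, integral_add j2 j3]
    linarith

end Cutoff

/-! ### Localization of Sobolev functions in charts -/

section Localization

variable {M : Type*} [TopologicalSpace M] [ChartedSpace Plane M] [IsManifold (𝓡 2) ∞ M]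

lemma metric_cauchySchwarz (g : Metric M) (p : M) (v w : TangentSpace (𝓡 2) p) :
    g.inner p v w ^ 2 ≤ g.inner p v v * g.inner p w w := by
  by_cases hw : w = 0
  · simp [hw]
  have h1 := g.pos p w hw
  set t := g.inner p v w / g.inner p w w with ht
  have h2 := metric_nonneg g p (v - t • w)
  have h3 : t * g.inner p w w = g.inner p v w := by rw [ht]; field_simp
  simp only [map_sub, map_smul, sub_apply, smul_apply, smul_eq_mul, g.symm p w v] at h2
  have h4 := mul_nonneg h2 h1.le
  have h5 : (g.inner p v v - t * g.inner p v w - t * (g.inner p v w - t * g.inner p w w)) *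
      g.inner p w w = g.inner p v v * g.inner p w w - t * g.inner p w w * g.inner p v w -
      t * g.inner p w w * g.inner p v w + (t * g.inner p w w) ^ 2 := by ring
  have h4' : 0 ≤ (g.inner p v v - t * g.inner p v w - t * (g.inner p v w - t * g.inner p w w)) *
      g.inner p w w := by simpa [mul_comm, mul_sub, sub_mul] using h4
  rw [h5, h3] at h4'
  nlinarith

/-- Bounds for the metric on compact subsets of a chart. -/
lemma exists_chart_bounds (g : Metric M) (x : M) {K : Set Plane} (hK : IsCompact K)
    (hKt : K ⊆ (chartAt Plane x).target) :
    ∃ A : ℝ, 0 < A ∧ ∀ y ∈ K, √(gram g x y).det ≤ A ∧ 1 ≤ A * √(gram g x y).det ∧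
      ∀ i, g.inner _ (coordVec x y i) (coordVec x y i) ≤ A := by
  have hG (i j : Fin 2) := (gram_continuousOn g x i j).mono hKt
  have hdet : ContinuousOn (fun y ↦ √(gram g x y).det) K := by
    simp only [gram_det]
    exact (((hG 0 0).mul (hG 1 1)).sub ((hG 0 1).pow 2)).sqrt
  have hpos : ∀ y ∈ K, √(gram g x y).det ≠ 0 := fun y hy ↦
    (Real.sqrt_pos.2 (gram_det_pos g x (hKt hy))).ne'
  obtain ⟨A1, h1⟩ := hK.exists_bound_of_continuousOn hdet
  obtain ⟨A2, h2⟩ := hK.exists_bound_of_continuousOn (hdet.inv₀ hpos)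
  obtain ⟨A3, h3⟩ := hK.exists_bound_of_continuousOn (hG 0 0)
  obtain ⟨A4, h4⟩ := hK.exists_bound_of_continuousOn (hG 1 1)
  set A := max 1 (max A1 (max A2 (max A3 A4))) with hA
  have hA1 : A1 ≤ A := by simp [hA]
  have hA2 : A2 ≤ A := by simp [hA]
  have hA3 : A3 ≤ A := by simp [hA]
  have hA4 : A4 ≤ A := by simp [hA]
  refine ⟨A, lt_of_lt_of_le one_pos (le_max_left _ _), fun y hy ↦ ⟨?_, ?_, ?_⟩⟩
  · exact ((Real.le_norm_self _).trans (h1 y hy)).trans hA1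
  · have hp : 0 < √(gram g x y).det := Real.sqrt_pos.2 (gram_det_pos g x (hKt hy))
    have := ((Real.le_norm_self _).trans (h2 y hy)).trans hA2
    rw [Pi.inv_apply, inv_le_iff_one_le_mul₀ hp] at this
    exact this
  · intro i
    fin_cases i
    · exact ((Real.le_norm_self _).trans (h3 y hy)).trans hA3
    · exact ((Real.le_norm_self _).trans (h4 y hy)).trans hA4

lemma exists_chartRadius (x : M) : ∃ r : ℝ, 0 < r ∧
    Metric.closedBall (chartAt Plane x x) (2 * r) ⊆ (chartAt Plane x).target := by
  obtain ⟨ε, hε, h⟩ := Metric.isOpen_iff.1 (chartAt Plane x).open_target _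
    (mem_chart_target Plane x)
  refine ⟨ε / 4, by positivity, (Metric.closedBall_subset_ball (by linarith)).trans h⟩

/-- A radius such that the closed ball of twice this radius lies in the chart. -/
def chartRadius (x : M) : ℝ := Classical.choose (exists_chartRadius x)

lemma chartRadius_pos (x : M) : 0 < chartRadius x :=
  (Classical.choose_spec (exists_chartRadius x)).1

/-- A closed ball inside the target of the chart. -/
def chartBall (x : M) : Set Plane := Metric.closedBall (chartAt Plane x x) (2 * chartRadius x)

lemma chartBall_subset (x : M) : chartBall x ⊆ (chartAt Plane x).target :=
  (Classical.choose_spec (exists_chartRadius x)).2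

lemma isCompact_chartBall (x : M) : IsCompact (chartBall x) := isCompact_closedBall _ _

/-- A cutoff function in the chart. -/
def cutoff (x : M) : ContDiffBump (chartAt Plane x x) where
  rIn := chartRadius x
  rOut := 2 * chartRadius x
  rIn_pos := chartRadius_pos x
  rIn_lt_rOut := by linarith [chartRadius_pos x]

lemma cutoff_tsupport (x : M) : tsupport (cutoff x) = chartBall x := (cutoff x).tsupport_eq

/-- A neighbourhood of `x` on which the cutoff function is `1`. -/
def chartNhd (x : M) : Set M :=
  (chartAt Plane x).source ∩ chartAt Plane x ⁻¹' Metric.ball (chartAt Plane x x) (chartRadius x)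

lemma isOpen_chartNhd (x : M) : IsOpen (chartNhd x) :=
  (chartAt Plane x).isOpen_inter_preimage Metric.isOpen_ball

lemma mem_chartNhd (x : M) : x ∈ chartNhd x :=
  ⟨mem_chart_source Plane x, Metric.mem_ball_self (chartRadius_pos x)⟩

lemma exists_finite_cover [CompactSpace M] : ∃ t : Finset M, ∀ p : M, ∃ x ∈ t, p ∈ chartNhd x := by
  obtain ⟨t, -, ht⟩ := isCompact_univ.elim_nhds_subcover
    (fun x : M ↦ chartNhd x) (fun x _ ↦ (isOpen_chartNhd x).mem_nhds (mem_chartNhd x))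
  exact ⟨t, fun p ↦ by simpa using ht (mem_univ p)⟩

/-- The localization of a function on `M` by means of the cutoff function. -/
def localize (x : M) (u : M → ℝ) : Plane → ℝ :=
  (chartAt Plane x).target.indicator fun y ↦ u ((chartAt Plane x).symm y) * cutoff x y

/-- The weak partial derivatives of `localize x u`. -/
def localizeDeriv (g : Metric M) (x : M) (u : M → ℝ) (X : ∀ p : M, TangentSpace (𝓡 2) p)
    (i : Fin 2) : Plane → ℝ :=
  (chartAt Plane x).target.indicator fun y ↦
    u ((chartAt Plane x).symm y) * fderiv ℝ (cutoff x) y (stdVec i) +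
      component g X x i y * cutoff x y

lemma localize_of_mem_ball {x : M} (u : M → ℝ) {y : Plane}
    (hy : y ∈ Metric.ball (chartAt Plane x x) (chartRadius x)) :
    localize x u y = u ((chartAt Plane x).symm y) := by
  have h1 : y ∈ Metric.closedBall (chartAt Plane x x) (cutoff x).rIn :=
    Metric.ball_subset_closedBall hy
  have h2 : y ∈ (chartAt Plane x).target := chartBall_subset x
    (Metric.closedBall_subset_closedBall (by linarith [chartRadius_pos x])
      (Metric.ball_subset_closedBall hy))
  rw [localize, indicator_of_mem h2, (cutoff x).one_of_mem_closedBall h1, mul_one]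

lemma localize_of_notMem {x : M} (u : M → ℝ) {y : Plane} (hy : y ∉ chartBall x) :
    localize x u y = 0 := by
  rw [← cutoff_tsupport] at hy
  have := image_eq_zero_of_notMem_tsupport hy
  rw [localize, indicator]
  split_ifs <;> simp [this]

lemma localize_abs_le (x : M) (u : M → ℝ) (y : Plane) :
    |localize x u y| ≤ (chartAt Plane x).target.indicator
      (fun y ↦ |u ((chartAt Plane x).symm y)|) y := by
  rw [localize, indicator, indicator]
  split_ifs
  · rw [abs_mul, abs_of_nonneg (cutoff x).nonneg]
    exact mul_le_of_le_one_right (abs_nonneg _) (cutoff x).le_one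
  · simp

lemma measurable_indicator_target (x : M) {f : Plane → ℝ}
    (hf : Measurable fun y : (chartAt Plane x).target ↦ f y) :
    Measurable ((chartAt Plane x).target.indicator f) := by
  have h := (chartAt Plane x).open_target.measurableSet
  refine measurable_of_restrict_of_restrict_compl h ?_ ?_
  · convert hf using 1
    ext y; simp
  · convert measurable_const (a := (0 : ℝ)) using 1
    ext y
    exact indicator_of_notMem y.2 _

variable [MeasurableSpace M] [BorelSpace M]

lemma measurable_comp_chart_symm (x : M) {u : M → ℝ} (hu : Measurable u) :
    Measurable fun y : (chartAt Plane x).target ↦ u ((chartAt Plane x).symm y) :=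
  hu.comp (continuousOn_iff_continuous_domRestrict.1
    (chartAt Plane x).continuousOn_symm).measurable

lemma measurable_localize (x : M) {u : M → ℝ} (hu : Measurable u) :
    Measurable (localize x u) := by
  refine measurable_indicator_target x ?_
  exact (measurable_comp_chart_symm x hu).mul
    ((cutoff x).continuous.measurable.comp measurable_subtype_coe)

lemma cutoff_contDiff (x : M) : ContDiff ℝ ∞ (cutoff x) := (cutoff x).contDiff

lemma measurable_localizeDeriv (g : Metric M) (x : M) {u : M → ℝ} (hu : Measurable u)
    {X : ∀ p : M, TangentSpace (𝓡 2) p} (hX : IsWeakGradient g u X) (i : Fin 2) :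
    Measurable (localizeDeriv g x u X i) := by
  refine measurable_indicator_target x ?_
  have h1 : Continuous fun y ↦ fderiv ℝ (cutoff x) y (stdVec i) :=
    ((cutoff_contDiff x).continuous_fderiv (by simp)).clm_apply continuous_const
  exact ((measurable_comp_chart_symm x hu).mul
    (h1.measurable.comp measurable_subtype_coe)).add ((hX.measurable x i).mul
    ((cutoff x).continuous.measurable.comp measurable_subtype_coe))

/-- On a compact part of the chart the volume density is bounded away from 0. This carries integrals
from the surface to the plane. -/
lemma exists_setLIntegral_compact_le (g : Metric M) (x : M) {K : Set Plane} (hK : IsCompact K)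
    (hKt : K ⊆ (chartAt Plane x).target) : ∃ A : ℝ, 0 < A ∧
    ∀ F : M → ℝ≥0∞, Measurable F → ∫⁻ y in K, F ((chartAt Plane x).symm y) ≤
      ENNReal.ofReal A * ∫⁻ p, F p ∂(riemannianVolume g) := by
  obtain ⟨A, hA, hb⟩ := exists_chart_bounds g x hK hKt
  refine ⟨A, hA, fun F hF ↦ ?_⟩
  calc ∫⁻ y in K, F ((chartAt Plane x).symm y)
      ≤ ∫⁻ y in K, ENNReal.ofReal A *
        (density g x y * F ((chartAt Plane x).symm y)) := by
        refine setLIntegral_mono' hK.measurableSet fun y hy ↦ ?_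
        rw [← mul_assoc, density, ← ENNReal.ofReal_mul hA.le]
        refine le_mul_of_one_le_left bot_le ?_
        rw [← ENNReal.ofReal_one]
        exact ENNReal.ofReal_le_ofReal (hb y hy).2.1
    _ = ENNReal.ofReal A * ∫⁻ y in K,
        (density g x y * F ((chartAt Plane x).symm y)) :=
        lintegral_const_mul' _ _ ENNReal.ofReal_ne_top
    _ ≤ ENNReal.ofReal A * ∫⁻ y in (chartAt Plane x).target,
        (density g x y * F ((chartAt Plane x).symm y)) := by
        gcongr
    _ ≤ _ := by
        rw [← setLIntegral_source g x hF]
        gcongr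
        exact Measure.restrict_le_self

/-- The density is bounded above on the chart ball. This carries estimates in the plane back to the
surface, on the region where the cutoff is 1. -/
lemma exists_setLIntegral_chartNhd_le (g : Metric M) (x : M) : ∃ A : ℝ, 0 < A ∧
    ∀ F : M → ℝ≥0∞, Measurable F → ∫⁻ p in chartNhd x, F p ∂(riemannianVolume g) ≤
      ENNReal.ofReal A * ∫⁻ y in Metric.ball (chartAt Plane x x) (chartRadius x),
        F ((chartAt Plane x).symm y) := by
  obtain ⟨A, hA, hb⟩ := exists_chart_bounds g x (isCompact_chartBall x) (chartBall_subset x)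
  refine ⟨A, hA, fun F hF ↦ ?_⟩
  have hVm := (isOpen_chartNhd x).measurableSet
  have hsub : Metric.ball (chartAt Plane x x) (chartRadius x) ⊆ chartBall x :=
    Metric.ball_subset_closedBall.trans
      (Metric.closedBall_subset_closedBall (by linarith [chartRadius_pos x]))
  have h1 : ∫⁻ p in chartNhd x, F p ∂(riemannianVolume g) =
      ∫⁻ p in (chartAt Plane x).source, (chartNhd x).indicator F p ∂(riemannianVolume g) := by
    rw [setLIntegral_indicator hVm, inter_eq_self_of_subset_left]
    exact inter_subset_left
  rw [h1, setLIntegral_source g x (hF.indicator hVm)]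
  rw [← lintegral_const_mul' _ _ ENNReal.ofReal_ne_top,
    ← lintegral_indicator (chartAt Plane x).open_target.measurableSet,
    ← lintegral_indicator Metric.isOpen_ball.measurableSet]
  refine lintegral_mono fun y ↦ ?_
  by_cases hy : y ∈ (chartAt Plane x).target
  · rw [indicator_of_mem hy]
    by_cases hy2 : (chartAt Plane x).symm y ∈ chartNhd x
    · have hy3 : y ∈ Metric.ball (chartAt Plane x x) (chartRadius x) := by
        have := hy2.2
        rwa [mem_preimage, (chartAt Plane x).right_inv hy] at this
      rw [indicator_of_mem hy2, indicator_of_mem hy3]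
      gcongr
      exact ENNReal.ofReal_le_ofReal (hb y (hsub hy3)).1
    · rw [indicator_of_notMem hy2, mul_zero]; exact bot_le
  · rw [indicator_of_notMem hy]; exact bot_le

/-- The localization of a Sobolev function is a Sobolev function of the plane. -/
lemma exists_isPlaneH1_localize [CompactSpace M] (g : Metric M) (x : M) : ∃ C : ℝ, 0 < C ∧
    ∀ (u : M → ℝ) (X : ∀ p : M, TangentSpace (𝓡 2) p), Measurable u → IsWeakGradient g u X →
      Integrable (fun p ↦ u p ^ 2) (riemannianVolume g) →
      IsPlaneH1 (chartAt Plane x x) (2 * chartRadius x)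
        (C * (∫ p, u p ^ 2 ∂(riemannianVolume g) +
          ∫ p, g.inner p (X p) (X p) ∂(riemannianVolume g)))
        (localize x u) (localizeDeriv g x u X) := by
  obtain ⟨A, hA, hb⟩ := exists_chart_bounds g x (isCompact_chartBall x) (chartBall_subset x)
  obtain ⟨B, hB, hFB⟩ :=
    exists_setLIntegral_compact_le g x (isCompact_chartBall x) (chartBall_subset x)
  have hc (i : Fin 2) : Continuous fun y ↦ fderiv ℝ (cutoff x) y (stdVec i) :=
    ((cutoff_contDiff x).continuous_fderiv (by simp)).clm_apply continuous_const
  obtain ⟨L0, hL0⟩ := (isCompact_chartBall x).exists_bound_of_continuousOn (hc 0).continuousOn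
  obtain ⟨L1, hL1⟩ := (isCompact_chartBall x).exists_bound_of_continuousOn (hc 1).continuousOn
  set L := max L0 L1 with hLdef
  have hL (i : Fin 2) : ∀ y ∈ chartBall x, |fderiv ℝ (cutoff x) y (stdVec i)| ≤ L := by
    intro y hy
    fin_cases i
    · exact (hL0 y hy).trans (le_max_left _ _)
    · exact (hL1 y hy).trans (le_max_right _ _)
  -- Factor 2 from (a + b)² ≤ 2a² + 2b², another 2 from the two partial derivatives, L for the
  -- gradient of the cutoff, A for the coordinate fields, B for the comparison of measures.
  refine ⟨4 * B * (L ^ 2 + A), by positivity, fun u X hu hX hui ↦ ?_⟩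
  set I1 := ∫ p, u p ^ 2 ∂(riemannianVolume g)
  set I2 := ∫ p, g.inner p (X p) (X p) ∂(riemannianVolume g)
  have hI1 : 0 ≤ I1 := integral_nonneg fun p ↦ sq_nonneg _
  have hI2 : 0 ≤ I2 := integral_nonneg fun p ↦ metric_nonneg g p _
  have hGm : Measurable fun p ↦ g.inner p (X p) (X p) :=
    measurable_inner g hX.measurable hX.measurable
  have hbound (i : Fin 2) : ∫⁻ y, ‖localizeDeriv g x u X i y‖ₑ ^ 2 ≤
      ENNReal.ofReal (2 * B * (L ^ 2 + A) * (I1 + I2)) := by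
    let F : M → ℝ≥0∞ := fun p ↦
      ENNReal.ofReal (2 * (L ^ 2 + A) * (u p ^ 2 + g.inner p (X p) (X p)))
    have hF : Measurable F := (((hu.pow_const 2).add hGm).const_mul _).ennreal_ofReal
    have hpt (y : Plane) : ‖localizeDeriv g x u X i y‖ₑ ^ 2 ≤
        (chartBall x).indicator (fun y ↦ F ((chartAt Plane x).symm y)) y := by
      by_cases hy : y ∈ chartBall x
      · rw [indicator_of_mem hy, localizeDeriv, indicator_of_mem (chartBall_subset x hy),
          ← ofReal_norm, ← ENNReal.ofReal_pow (norm_nonneg _), Real.norm_eq_abs, sq_abs]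
        refine ENNReal.ofReal_le_ofReal ?_
        have h1 : component g X x i y ^ 2 ≤
            g.inner _ (X ((chartAt Plane x).symm y)) (X ((chartAt Plane x).symm y)) * A := by
          refine (metric_cauchySchwarz g _ _ _).trans ?_
          exact mul_le_mul_of_nonneg_left ((hb y hy).2.2 i) (metric_nonneg g _ _)
        have h2 : (component g X x i y * cutoff x y) ^ 2 ≤ component g X x i y ^ 2 := by
          rw [mul_pow]
          refine mul_le_of_le_one_right (sq_nonneg _) ?_
          exact pow_le_one₀ (cutoff x).nonneg (cutoff x).le_one
        have h3 : (u ((chartAt Plane x).symm y) * fderiv ℝ (cutoff x) y (stdVec i)) ^ 2 ≤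
            u ((chartAt Plane x).symm y) ^ 2 * L ^ 2 := by
          rw [mul_pow]
          refine mul_le_mul_of_nonneg_left ?_ (sq_nonneg _)
          exact sq_le_sq' (by linarith [(abs_le.1 (hL i y hy)).1]) (abs_le.1 (hL i y hy)).2
        have h4 := metric_nonneg g _ (X ((chartAt Plane x).symm y))
        have h5 := mul_nonneg h4 (sq_nonneg L)
        have h6 := mul_nonneg (sq_nonneg (u ((chartAt Plane x).symm y))) hA.le
        nlinarith [sq_nonneg (u ((chartAt Plane x).symm y) * fderiv ℝ (cutoff x) y (stdVec i) -
          component g X x i y * cutoff x y)]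
      · rw [indicator_of_notMem hy]
        rw [← cutoff_tsupport] at hy
        have e1 : cutoff x y = 0 := image_eq_zero_of_notMem_tsupport hy
        have e2 : fderiv ℝ (cutoff x) y = 0 :=
          image_eq_zero_of_notMem_tsupport fun h ↦ hy (tsupport_fderiv_subset ℝ h)
        have : localizeDeriv g x u X i y = 0 := by
          rw [localizeDeriv, indicator]
          split_ifs <;> simp [e1, e2]
        simp [this]
    calc ∫⁻ y, ‖localizeDeriv g x u X i y‖ₑ ^ 2
        ≤ ∫⁻ y in chartBall x, F ((chartAt Plane x).symm y) := by
          rw [← lintegral_indicator (isCompact_chartBall x).measurableSet]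
          exact lintegral_mono hpt
      _ ≤ ENNReal.ofReal B * ∫⁻ p, F p ∂(riemannianVolume g) := hFB F hF
      _ = _ := by
          have e := ofReal_integral_eq_lintegral_ofReal
            (f := fun p ↦ 2 * (L ^ 2 + A) * (u p ^ 2 + g.inner p (X p) (X p)))
            ((hui.add hX.sq_integrable).const_mul _) (Eventually.of_forall fun p ↦ by
              have := metric_nonneg g p (X p)
              simp only [Pi.zero_apply]
              positivity)
          rw [integral_const_mul, integral_add hui hX.sq_integrable] at e
          change ENNReal.ofReal B * ∫⁻ p, ENNReal.ofReal
            (2 * (L ^ 2 + A) * (u p ^ 2 + g.inner p (X p) (X p))) ∂(riemannianVolume g) = _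
          rw [← e, ← ENNReal.ofReal_mul hB.le]
          congr 1
          ring
  refine ⟨measurable_localize x hu, measurable_localizeDeriv g x hu hX,
    fun y hy ↦ localize_of_notMem u hy, fun i ↦ ?_, ?_⟩
  · exact (hX.weak x i).cutoff (chartAt Plane x).open_target (cutoff_contDiff x)
      (cutoff x).hasCompactSupport ((cutoff_tsupport x).subset.trans (chartBall_subset x))
  · refine (add_le_add (hbound 0) (hbound 1)).trans ?_
    rw [← ENNReal.ofReal_add (by positivity) (by positivity)]
    refine ENNReal.ofReal_le_ofReal (le_of_eq ?_)
    ring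

end Localization

/-! ### L² bounds for pairings with test functions; components of vectors -/

section TestBound

variable {M : Type*} [TopologicalSpace M] [ChartedSpace Plane M] [IsManifold (𝓡 2) ∞ M]
  [CompactSpace M] [MeasurableSpace M] [BorelSpace M]

lemma aestronglyMeasurable_restrict_target (x : M) {h : Plane → ℝ}
    (hm : Measurable fun y : (chartAt Plane x).target ↦ h y) :
    AEStronglyMeasurable h (volume.restrict (chartAt Plane x).target) := by
  refine ((measurable_indicator_target x hm).aestronglyMeasurable).congr ?_
  exact indicator_ae_eq_restrict (chartAt Plane x).open_target.measurableSet

/-- Cauchy–Schwarz on compact sets: a square bounded by an integrable function on the surface is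
locally integrable in the chart, hence so is the function. -/
lemma locallyIntegrableOn_target (g : Metric M) (x : M) {h : Plane → ℝ}
    (hm : Measurable fun y : (chartAt Plane x).target ↦ h y) {F : M → ℝ≥0∞} (hF : Measurable F)
    (hFi : ∫⁻ p, F p ∂(riemannianVolume g) ≠ ⊤)
    (hb : ∀ K : Set Plane, IsCompact K → K ⊆ (chartAt Plane x).target → ∃ A : ℝ, ∀ y ∈ K,
      ‖h y‖ₑ ^ 2 ≤ ENNReal.ofReal A * F ((chartAt Plane x).symm y)) :
    LocallyIntegrableOn h (chartAt Plane x).target := by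
  refine (locallyIntegrableOn_iff (chartAt Plane x).open_target.isLocallyClosed).2
    fun K hKt hK ↦ ?_
  obtain ⟨A, hA⟩ := hb K hK hKt
  obtain ⟨B, hB, hFB⟩ := exists_setLIntegral_compact_le g x hK hKt
  have hmeas : AEStronglyMeasurable h (volume.restrict K) :=
    (aestronglyMeasurable_restrict_target x hm).mono_measure (Measure.restrict_mono hKt le_rfl)
  refine ⟨hmeas, ?_⟩
  rw [hasFiniteIntegral_iff_enorm]
  have h1 := sq_lintegral_le (volume.restrict K) (F := fun y ↦ ‖h y‖ₑ) hmeas.enorm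
  have h2 : ∫⁻ y in K, ‖h y‖ₑ ^ 2 ≤ ENNReal.ofReal A * (ENNReal.ofReal B *
      ∫⁻ p, F p ∂(riemannianVolume g)) := by
    refine le_trans (setLIntegral_mono' hK.measurableSet hA) ?_
    rw [lintegral_const_mul' _ _ ENNReal.ofReal_ne_top]
    gcongr
    exact hFB F hF
  have h3 : (∫⁻ y in K, ‖h y‖ₑ) ^ 2 < ⊤ := by
    refine h1.trans_lt ?_
    rw [Measure.restrict_apply_univ]
    refine ENNReal.mul_lt_top hK.measure_lt_top (h2.trans_lt ?_)
    exact ENNReal.mul_lt_top ENNReal.ofReal_lt_top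
      (ENNReal.mul_lt_top ENNReal.ofReal_lt_top hFi.lt_top)
  by_contra hcon
  rw [not_lt, top_le_iff] at hcon
  simp [hcon] at h3

/-- Pairing with a test function is continuous for the L² size on the surface, with a constant
depending only on the test function and `A`. This lets the weak gradient identity pass to limits. -/
lemma exists_enorm_integral_test_le (g : Metric M) (x : M) {φ : Plane → ℝ} (hφ : Continuous φ)
    (hφc : HasCompactSupport φ) (hφs : tsupport φ ⊆ (chartAt Plane x).target) (A : ℝ) :
    ∃ C : ℝ, 0 ≤ C ∧ ∀ (h : Plane → ℝ) (F : M → ℝ≥0∞), Measurable F →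
      (Measurable fun y : (chartAt Plane x).target ↦ h y) →
      (∀ y ∈ tsupport φ, ‖h y‖ₑ ^ 2 ≤ ENNReal.ofReal A * F ((chartAt Plane x).symm y)) →
      ‖∫ y in (chartAt Plane x).target, h y * φ y‖ₑ ^ 2 ≤
        ENNReal.ofReal C * ∫⁻ p, F p ∂(riemannianVolume g) := by
  set K := tsupport φ with hKdef
  have hK : IsCompact K := hφc
  obtain ⟨B, hB, hFB⟩ := exists_setLIntegral_compact_le g x hK hφs
  obtain ⟨S, hS⟩ := hφ.bounded_above_of_compact_support hφc
  have hS0 : 0 ≤ S := (norm_nonneg _).trans (hS 0)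
  refine ⟨S ^ 2 * ((volume K).toReal * (max A 0 * B)), by positivity, fun h F hF hm hb ↦ ?_⟩
  have hmeas : AEStronglyMeasurable h (volume.restrict K) :=
    (aestronglyMeasurable_restrict_target x hm).mono_measure (Measure.restrict_mono hφs le_rfl)
  have hind (y : Plane) : ‖h y * φ y‖ₑ ≤ K.indicator (fun y ↦ ENNReal.ofReal S * ‖h y‖ₑ) y := by
    by_cases hy : y ∈ K
    · rw [indicator_of_mem hy, enorm_mul, mul_comm]
      gcongr
      rw [← ofReal_norm]
      exact ENNReal.ofReal_le_ofReal (hS y)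
    · rw [image_eq_zero_of_notMem_tsupport hy]; simp
  have h1 : ‖∫ y in (chartAt Plane x).target, h y * φ y‖ₑ ≤
      ENNReal.ofReal S * ∫⁻ y in K, ‖h y‖ₑ := by
    refine (enorm_integral_le_lintegral_enorm _).trans ?_
    refine (setLIntegral_le_lintegral _ _).trans ?_
    refine (lintegral_mono hind).trans ?_
    rw [lintegral_indicator hK.measurableSet, lintegral_const_mul' _ _ ENNReal.ofReal_ne_top]
  calc ‖∫ y in (chartAt Plane x).target, h y * φ y‖ₑ ^ 2
      ≤ (ENNReal.ofReal S * ∫⁻ y in K, ‖h y‖ₑ) ^ 2 := by gcongr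
    _ ≤ ENNReal.ofReal S ^ 2 * (volume K * ∫⁻ y in K, ‖h y‖ₑ ^ 2) := by
        rw [mul_pow]
        gcongr
        simpa using sq_lintegral_le (volume.restrict K) (F := fun y ↦ ‖h y‖ₑ) hmeas.enorm
    _ ≤ ENNReal.ofReal S ^ 2 * (volume K * (ENNReal.ofReal (max A 0) * (ENNReal.ofReal B *
          ∫⁻ p, F p ∂(riemannianVolume g)))) := by
        gcongr
        refine le_trans (setLIntegral_mono' hK.measurableSet hb) ?_
        rw [lintegral_const_mul' _ _ ENNReal.ofReal_ne_top]
        gcongr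
        · exact le_max_left _ _
        · exact hFB F hF
    _ = _ := by
        rw [ENNReal.ofReal_mul (by positivity), ENNReal.ofReal_pow hS0,
          ENNReal.ofReal_mul (by positivity), ENNReal.ofReal_mul (by positivity),
          ENNReal.ofReal_toReal hK.measure_lt_top.ne]
        ring

lemma component_sq_le (g : Metric M) (x : M)
    {K : Set Plane} (hK : IsCompact K) (hKt : K ⊆ (chartAt Plane x).target) :
    ∃ A : ℝ, ∀ (X : ∀ p : M, TangentSpace (𝓡 2) p) (i : Fin 2), ∀ y ∈ K,
      ‖component g X x i y‖ₑ ^ 2 ≤ ENNReal.ofReal A *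
        ENNReal.ofReal (g.inner _ (X ((chartAt Plane x).symm y))
          (X ((chartAt Plane x).symm y))) := by
  obtain ⟨A, hA, hb⟩ := exists_chart_bounds g x hK hKt
  refine ⟨A, fun X i y hy ↦ ?_⟩
  rw [← ofReal_norm, ← ENNReal.ofReal_pow (norm_nonneg _), Real.norm_eq_abs, sq_abs,
    ← ENNReal.ofReal_mul hA.le]
  refine ENNReal.ofReal_le_ofReal ((metric_cauchySchwarz g _ _ _).trans ?_)
  rw [mul_comm]
  exact mul_le_mul_of_nonneg_right ((hb y hy).2.2 i) (metric_nonneg g _ _)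

/-- Recovering a tangent vector from its covariant components. -/
lemma eq_of_components (g : Metric M) (x : M) {y : Plane} (hy : y ∈ (chartAt Plane x).target)
    (v : TangentSpace (𝓡 2) ((chartAt Plane x).symm y)) :
    v = (((gram g x y).det)⁻¹ * (g.inner _ (coordVec x y 1) (coordVec x y 1) *
        g.inner _ v (coordVec x y 0) - g.inner _ (coordVec x y 0) (coordVec x y 1) *
        g.inner _ v (coordVec x y 1))) • coordVec x y 0 +
      (((gram g x y).det)⁻¹ * (g.inner _ (coordVec x y 0) (coordVec x y 0) *
        g.inner _ v (coordVec x y 1) - g.inner _ (coordVec x y 0) (coordVec x y 1) *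
        g.inner _ v (coordVec x y 0))) • coordVec x y 1 := by
  have hd := (gram_det_pos g x hy).ne'
  obtain ⟨a, ha⟩ := coordVec_span x hy v
  have e0 : ((gram g x y).det)⁻¹ * (g.inner _ (coordVec x y 1) (coordVec x y 1) *
        g.inner _ v (coordVec x y 0) - g.inner _ (coordVec x y 0) (coordVec x y 1) *
        g.inner _ v (coordVec x y 1)) = a 0 := by
    rw [inv_mul_eq_iff_eq_mul₀ hd, gram_det, ha]
    simp only [map_add, map_smul, add_apply, smul_apply, smul_eq_mul,
      g.symm _ (coordVec x y 1) (coordVec x y 0)]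
    ring
  have e1 : ((gram g x y).det)⁻¹ * (g.inner _ (coordVec x y 0) (coordVec x y 0) *
        g.inner _ v (coordVec x y 1) - g.inner _ (coordVec x y 0) (coordVec x y 1) *
        g.inner _ v (coordVec x y 0)) = a 1 := by
    rw [inv_mul_eq_iff_eq_mul₀ hd, gram_det, ha]
    simp only [map_add, map_smul, add_apply, smul_apply, smul_eq_mul,
      g.symm _ (coordVec x y 1) (coordVec x y 0)]
    ring
  rw [e0, e1]
  exact ha

/-- The inverse Gram matrix recovers a vector linearly from its two covariant components, so
convergence of vectors is convergence of real sequences, and measurability of the convergence set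
becomes accessible. -/
lemma exists_tendsto_iff_components (g : Metric M) (x : M) {y : Plane}
    (hy : y ∈ (chartAt Plane x).target)
    (v : ℕ → TangentSpace (𝓡 2) ((chartAt Plane x).symm y)) :
    (∃ z, Tendsto v atTop (𝓝 z)) ↔
      ∀ i, ∃ c, Tendsto (fun n ↦ g.inner _ (v n) (coordVec x y i)) atTop (𝓝 c) := by
  constructor
  · rintro ⟨z, hz⟩ i
    refine ⟨g.inner _ z (coordVec x y i), ?_⟩
    have hcont : Continuous fun w : TangentSpace (𝓡 2) ((chartAt Plane x).symm y) ↦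
        g.inner _ w (coordVec x y i) :=
      (g.inner _ (coordVec x y i)).continuous.congr fun w ↦ g.symm _ _ _
    exact (hcont.tendsto z).comp hz
  · intro h
    obtain ⟨c0, h0⟩ := h 0
    obtain ⟨c1, h1⟩ := h 1
    have h2 := (((h0.const_mul (g.inner _ (coordVec x y 1) (coordVec x y 1))).sub
      (h1.const_mul (g.inner _ (coordVec x y 0) (coordVec x y 1)))).const_mul
      ((gram g x y).det)⁻¹).smul_const (coordVec x y 0)
    have h3 := (((h1.const_mul (g.inner _ (coordVec x y 0) (coordVec x y 0))).sub
      (h0.const_mul (g.inner _ (coordVec x y 0) (coordVec x y 1)))).const_mul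
      ((gram g x y).det)⁻¹).smul_const (coordVec x y 1)
    exact ⟨_, (h2.add h3).congr fun n ↦ (eq_of_components g x hy (v n)).symm⟩

end TestBound

/-! ### Limits of gradient fields and closedness of the weak gradient -/

section GradientLimit

variable {M : Type*} [TopologicalSpace M] [ChartedSpace Plane M] [IsManifold (𝓡 2) ∞ M]
  [CompactSpace M] [MeasurableSpace M] [BorelSpace M] {g : Metric M}

/-- The Dirichlet integral of a vector field, as an extended nonnegative number. -/
def fieldEnergy (g : Metric M) (X : ∀ p : M, TangentSpace (𝓡 2) p) : ℝ≥0∞ :=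
  ∫⁻ p, ENNReal.ofReal (g.inner p (X p) (X p)) ∂(riemannianVolume g)

/-- The components of the vector field are Borel functions. -/
def IsBorelField (g : Metric M) (X : ∀ p : M, TangentSpace (𝓡 2) p) : Prop :=
  ∀ x i, Measurable fun y : (chartAt Plane x).target ↦ component g X x i (y : Plane)

lemma IsBorelField.sub {X Y : ∀ p : M, TangentSpace (𝓡 2) p} (hX : IsBorelField g X)
    (hY : IsBorelField g Y) : IsBorelField g fun p ↦ X p - Y p := fun x i ↦ by
  rw [component_sub]; exact (hX x i).sub (hY x i)

open Classical in
/-- The pointwise limit of a sequence of vector fields, and zero where there is no limit. -/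
def fieldLimit (X : ℕ → ∀ p : M, TangentSpace (𝓡 2) p) (p : M) : TangentSpace (𝓡 2) p :=
  if h : ∃ z, Tendsto (fun n ↦ X n p) atTop (𝓝 z) then Classical.choose h else 0

lemma fieldLimit_tendsto {X : ℕ → ∀ p : M, TangentSpace (𝓡 2) p} {p : M}
    (h : ∃ z, Tendsto (fun n ↦ X n p) atTop (𝓝 z)) :
    Tendsto (fun n ↦ X n p) atTop (𝓝 (fieldLimit X p)) := by
  rw [fieldLimit, dif_pos h]
  exact Classical.choose_spec h

lemma tendsto_metric {p : M} {v w : ℕ → TangentSpace (𝓡 2) p} {v' w' : TangentSpace (𝓡 2) p}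
    (hv : Tendsto v atTop (𝓝 v')) (hw : Tendsto w atTop (𝓝 w')) :
    Tendsto (fun n ↦ g.inner p (v n) (w n)) atTop (𝓝 (g.inner p v' w')) := by
  have h1 : Continuous fun z : Plane × Plane ↦ metricForm g p z.1 z.2 := by fun_prop
  exact (h1.tendsto (v', w')).comp (Tendsto.prodMk_nhds hv hw)

/-- In a chart the convergence set is measurable, being described by components. Off it the limit
field is 0 by convention, so the components are pointwise limits of truncated measurable ones. -/
lemma isBorelField_fieldLimit {X : ℕ → ∀ p : M, TangentSpace (𝓡 2) p}
    (hX : ∀ n, IsBorelField g (X n)) : IsBorelField g (fieldLimit X) := by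
  intro x i
  set S : Set (chartAt Plane x).target := {y | ∀ i, ∃ c,
    Tendsto (fun n ↦ component g (X n) x i (y : Plane)) atTop (𝓝 c)} with hS
  have hSm : MeasurableSet S := by
    have : S = ⋂ i, {y : (chartAt Plane x).target | ∃ c,
      Tendsto (fun n ↦ component g (X n) x i (y : Plane)) atTop (𝓝 c)} := by ext; simp [hS]
    rw [this]
    exact MeasurableSet.iInter fun i ↦
      measurableSet_exists_tendsto fun n ↦ hX n x i
  refine measurable_of_tendsto_metrizable
    (f := fun n ↦ S.indicator fun y ↦ component g (X n) x i (y : Plane))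
    (fun n ↦ (hX n x i).indicator hSm) (tendsto_pi_nhds.2 fun y ↦ ?_)
  by_cases hy : y ∈ S
  · simp only [indicator_of_mem hy]
    have h := fieldLimit_tendsto ((exists_tendsto_iff_components g x y.2
      (fun n ↦ X n ((chartAt Plane x).symm y))).2 hy)
    exact tendsto_metric h tendsto_const_nhds
  · simp only [indicator_of_notMem hy]
    have : fieldLimit X ((chartAt Plane x).symm y) = 0 := by
      rw [fieldLimit, dif_neg]
      exact fun h ↦ hy ((exists_tendsto_iff_components g x y.2 _).1 h)
    simp [component, this]

/-- A rapidly converging sequence of vector fields converges almost everywhere. -/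
lemma ae_exists_tendsto_field {X : ℕ → ∀ p : M, TangentSpace (𝓡 2) p}
    (hX : ∀ n, IsBorelField g (X n))
    (hfast : ∀ n, fieldEnergy g (fun p ↦ X (n + 1) p - X n p) ≤ ENNReal.ofReal ((1 / 4) ^ n)) :
    ∀ᵐ p ∂(riemannianVolume g), ∃ z, Tendsto (fun n ↦ X n p) atTop (𝓝 z) := by
  -- The weights 2^n still leave a summable series, since 2^n · 4^{-n} = 2^{-n}. Almost everywhere
  -- the weighted sum is then finite, which forces the increments to decay geometrically.
  have hm (n : ℕ) : Measurable fun p ↦ ENNReal.ofReal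
      (2 ^ n * g.inner p (X (n + 1) p - X n p) (X (n + 1) p - X n p)) :=
    ((measurable_inner g ((hX (n + 1)).sub (hX n)) ((hX (n + 1)).sub (hX n))).const_mul
      _).ennreal_ofReal
  have hsum : ∫⁻ p, ∑' n, ENNReal.ofReal
      (2 ^ n * g.inner p (X (n + 1) p - X n p) (X (n + 1) p - X n p)) ∂(riemannianVolume g) ≠
      ⊤ := by
    rw [lintegral_tsum fun n ↦ (hm n).aemeasurable]
    have hle (n : ℕ) : ∫⁻ p, ENNReal.ofReal
        (2 ^ n * g.inner p (X (n + 1) p - X n p) (X (n + 1) p - X n p)) ∂(riemannianVolume g) ≤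
        ENNReal.ofReal ((1 / 2) ^ n) := by
      have e (p : M) : ENNReal.ofReal
          (2 ^ n * g.inner p (X (n + 1) p - X n p) (X (n + 1) p - X n p)) =
          ENNReal.ofReal (2 ^ n) * ENNReal.ofReal
            (g.inner p (X (n + 1) p - X n p) (X (n + 1) p - X n p)) :=
        ENNReal.ofReal_mul (by positivity)
      simp only [e]
      rw [lintegral_const_mul' _ _ ENNReal.ofReal_ne_top]
      calc _ ≤ ENNReal.ofReal (2 ^ n) * ENNReal.ofReal ((1 / 4) ^ n) := by
            gcongr; exact hfast n
        _ = _ := by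
            rw [← ENNReal.ofReal_mul (by positivity), ← mul_pow]; norm_num
    refine ne_top_of_le_ne_top ?_ (ENNReal.tsum_le_tsum hle)
    rw [← ENNReal.ofReal_tsum_of_nonneg (fun n ↦ by positivity) summable_geometric_two]
    exact ENNReal.ofReal_ne_top
  filter_upwards [ae_lt_top (Measurable.tsum hm) hsum] with p hp
  obtain ⟨x, hx⟩ : ∃ x : M, p ∈ (chartAt Plane x).source := ⟨p, mem_chart_source Plane p⟩
  set y := chartAt Plane x p with hy
  have hyt : y ∈ (chartAt Plane x).target := (chartAt Plane x).map_source hx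
  have hpy : (chartAt Plane x).symm y = p := (chartAt Plane x).left_inv hx
  rw [← hpy] at hp ⊢
  set q := (chartAt Plane x).symm y
  refine (exists_tendsto_iff_components g x hyt _).2 fun i ↦ ?_
  refine cauchySeq_tendsto_of_complete ?_
  set T := (∑' n, ENNReal.ofReal
      (2 ^ n * g.inner q (X (n + 1) q - X n q) (X (n + 1) q - X n q))).toReal with hT
  have hbd (n : ℕ) : g.inner q (X (n + 1) q - X n q) (X (n + 1) q - X n q) ≤
      T * (1 / 2) ^ n := by
    have h1 := ENNReal.le_tsum (f := fun n ↦ ENNReal.ofReal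
      (2 ^ n * g.inner q (X (n + 1) q - X n q) (X (n + 1) q - X n q))) n
    have h2 := (ENNReal.ofReal_le_iff_le_toReal hp.ne).1 h1
    have h3 : (0 : ℝ) < 2 ^ n := by positivity
    rw [one_div, inv_pow, ← div_eq_mul_inv, le_div_iff₀ h3, mul_comm]
    exact h2
  have hT0 : 0 ≤ T := ENNReal.toReal_nonneg
  set G := g.inner q (coordVec x y i) (coordVec x y i) with hG
  have hG0 : 0 ≤ G := metric_nonneg g _ _
  have hr : √(1 / 2) < 1 := by
    rw [Real.sqrt_lt' one_pos]; norm_num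
  refine cauchySeq_of_le_geometric (√(1 / 2)) (√(T * G)) hr fun n ↦ ?_
  rw [dist_comm, Real.dist_eq]
  have h1 : g.inner q (X (n + 1) q) (coordVec x y i) - g.inner q (X n q) (coordVec x y i) =
      g.inner q (X (n + 1) q - X n q) (coordVec x y i) := by simp
  rw [h1]
  have h2 := metric_cauchySchwarz g q (X (n + 1) q - X n q) (coordVec x y i)
  have h3 : √(T * G) * √(1 / 2) ^ n = √(T * G * (1 / 2) ^ n) := by
    rw [Real.sqrt_mul (mul_nonneg hT0 hG0), Real.sqrt_eq_rpow (1 / 2),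
      Real.sqrt_eq_rpow ((1 / 2) ^ n), ← Real.rpow_natCast, ← Real.rpow_mul (by norm_num),
      ← Real.rpow_natCast, ← Real.rpow_mul (by norm_num), mul_comm (1 / 2 : ℝ) (n : ℝ)]
  rw [h3]
  refine Real.abs_le_sqrt (h2.trans ?_)
  have := mul_le_mul_of_nonneg_right (hbd n) hG0
  calc _ ≤ T * (1 / 2) ^ n * G := this
    _ = _ := by ring

/-- Fatou's lemma, with the pointwise limit taken in the first field only. -/
lemma fieldEnergy_limit_sub_le {X : ℕ → ∀ p : M, TangentSpace (𝓡 2) p}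
    (hX : ∀ n, IsBorelField g (X n))
    (hlim : ∀ᵐ p ∂(riemannianVolume g), ∃ z, Tendsto (fun n ↦ X n p) atTop (𝓝 z)) {n : ℕ}
    {D : ℝ≥0∞} (hD : ∀ m, n ≤ m → fieldEnergy g (fun p ↦ X m p - X n p) ≤ D) :
    fieldEnergy g (fun p ↦ fieldLimit X p - X n p) ≤ D := by
  have h1 : ∀ᵐ p ∂(riemannianVolume g), ENNReal.ofReal
      (g.inner p (fieldLimit X p - X n p) (fieldLimit X p - X n p)) =
      liminf (fun m ↦ ENNReal.ofReal (g.inner p (X m p - X n p) (X m p - X n p))) atTop := by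
    filter_upwards [hlim] with p hp
    have h2 := (fieldLimit_tendsto hp).sub_const (X n p)
    exact ((ENNReal.continuous_ofReal.tendsto _).comp
      (tendsto_metric (g := g) h2 h2)).liminf_eq.symm
  rw [fieldEnergy, lintegral_congr_ae h1]
  refine (lintegral_liminf_le fun m ↦ ?_).trans ?_
  · exact (measurable_inner g ((hX m).sub (hX n)) ((hX m).sub (hX n))).ennreal_ofReal
  · refine liminf_le_of_frequently_le' (Eventually.frequently ?_)
    filter_upwards [eventually_ge_atTop n] with m hm using hD m hm

lemma IsWeakGradient.isBorelField {u : M → ℝ} {X : ∀ p : M, TangentSpace (𝓡 2) p}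
    (h : IsWeakGradient g u X) : IsBorelField g X := h.measurable

lemma IsWeakGradient.sub {u v : M → ℝ} {X Y : ∀ p : M, TangentSpace (𝓡 2) p}
    (h : IsWeakGradient g u X) (h' : IsWeakGradient g v Y) :
    IsWeakGradient g (fun p ↦ u p - v p) (fun p ↦ X p - Y p) := by
  have := h.add (h'.smul (-1))
  simpa [sub_eq_add_neg] using this

lemma integrable_of_fieldEnergy {X : ∀ p : M, TangentSpace (𝓡 2) p} (hX : IsBorelField g X)
    (h : fieldEnergy g X ≠ ⊤) :
    Integrable (fun p ↦ g.inner p (X p) (X p)) (riemannianVolume g) := by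
  refine ⟨(measurable_inner g hX hX).aestronglyMeasurable, ?_⟩
  rw [hasFiniteIntegral_iff_ofReal (Eventually.of_forall fun p ↦ metric_nonneg g p _)]
  exact h.lt_top

lemma tendsto_of_enorm_sub_sq_le {a : ℕ → ℝ} {b : ℝ} {C : ℝ} {e : ℕ → ℝ≥0∞}
    (he : Tendsto e atTop (𝓝 0)) (h : ∀ n, ‖a n - b‖ₑ ^ 2 ≤ ENNReal.ofReal C * e n) :
    Tendsto a atTop (𝓝 b) := by
  have h1 : Tendsto (fun n ↦ ENNReal.ofReal C * e n) atTop (𝓝 0) := by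
    simpa using ENNReal.Tendsto.const_mul he (Or.inr ENNReal.ofReal_ne_top)
  have h2 : Tendsto (fun n ↦ ‖a n - b‖ₑ ^ 2) atTop (𝓝 0) :=
    tendsto_of_tendsto_of_tendsto_of_le_of_le tendsto_const_nhds h1 (fun _ ↦ bot_le) h
  have h3 : Tendsto (fun n ↦ (a n - b) ^ 2) atTop (𝓝 0) := by
    have := (ENNReal.continuousAt_toReal ENNReal.zero_ne_top).tendsto.comp h2
    refine (this.congr fun n ↦ ?_)
    simp
  have h4 : Tendsto (fun n ↦ |a n - b|) atTop (𝓝 0) := by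
    have := (Real.continuous_sqrt.tendsto 0).comp h3
    simpa [Function.comp_def, Real.sqrt_sq_eq_abs] using this
  have h5 := tendsto_zero_iff_abs_tendsto_zero _ |>.2 h4
  simpa using h5.add_const b

/-- The weak gradient is a closed operator. -/
lemma isWeakGradient_of_tendsto {u : ℕ → M → ℝ} {X : ℕ → ∀ p : M, TangentSpace (𝓡 2) p}
    {U : M → ℝ} {Y : ∀ p : M, TangentSpace (𝓡 2) p} (hu : ∀ n, Measurable (u n))
    (hX : ∀ n, IsWeakGradient g (u n) (X n)) (hU : Measurable U) (hY : IsBorelField g Y)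
    (hUi : ∫⁻ p, ‖U p‖ₑ ^ 2 ∂(riemannianVolume g) ≠ ⊤) (hYi : fieldEnergy g Y ≠ ⊤)
    (h1 : Tendsto (fun n ↦ ∫⁻ p, ‖u n p - U p‖ₑ ^ 2 ∂(riemannianVolume g)) atTop (𝓝 0))
    (h2 : Tendsto (fun n ↦ fieldEnergy g (fun p ↦ X n p - Y p)) atTop (𝓝 0)) :
    IsWeakGradient g U Y where
  measurable := hY
  sq_integrable := integrable_of_fieldEnergy hY hYi
  weak x i := by
    have hUloc : LocallyIntegrableOn (fun y ↦ U ((chartAt Plane x).symm y))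
        (chartAt Plane x).target :=
      locallyIntegrableOn_target g x (measurable_comp_chart_symm x hU)
        (hU.enorm.pow_const 2) hUi fun K _ _ ↦ ⟨1, fun y _ ↦ by simp⟩
    have hYloc : LocallyIntegrableOn (component g Y x i) (chartAt Plane x).target := by
      refine locallyIntegrableOn_target g x (hY x i)
        (measurable_inner g hY hY).ennreal_ofReal hYi fun K hK hKt ↦ ?_
      obtain ⟨A, hA⟩ := component_sq_le g x hK hKt
      exact ⟨A, fun y hy ↦ hA Y i y hy⟩
    refine ⟨hUloc, hYloc, fun ψ hψ1 hψ2 hψ3 ↦ ?_⟩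
    have hc : Continuous fun y ↦ fderiv ℝ ψ y (stdVec i) :=
      (hψ1.continuous_fderiv (by simp)).clm_apply continuous_const
    have hcs : HasCompactSupport fun y ↦ fderiv ℝ ψ y (stdVec i) := hψ2.fderiv_apply ℝ _
    have hss : tsupport (fun y ↦ fderiv ℝ ψ y (stdVec i)) ⊆ (chartAt Plane x).target :=
      (tsupport_fderiv_apply_subset ℝ _).trans hψ3
    obtain ⟨C1, -, hC1⟩ := exists_enorm_integral_test_le g x hc hcs hss 1
    obtain ⟨A, hA⟩ := component_sq_le g x hψ2 hψ3
    obtain ⟨C2, -, hC2⟩ := exists_enorm_integral_test_le g x hψ1.continuous hψ2 hψ3 A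
    -- Both sides of the integration by parts formula are continuous under the assumed convergences,
    -- so the formula survives in the limit.
    have t1 : Tendsto (fun n ↦ ∫ y in (chartAt Plane x).target,
        u n ((chartAt Plane x).symm y) * fderiv ℝ ψ y (stdVec i)) atTop
        (𝓝 (∫ y in (chartAt Plane x).target,
          U ((chartAt Plane x).symm y) * fderiv ℝ ψ y (stdVec i))) := by
      refine tendsto_of_enorm_sub_sq_le h1 (C := C1) fun n ↦ ?_
      rw [← integral_sub (integrable_mul_test ((hX n).weak x i).locInt hc hcs hss)
        (integrable_mul_test hUloc hc hcs hss)]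
      simp only [← sub_mul]
      refine hC1 (fun y ↦ u n ((chartAt Plane x).symm y) - U ((chartAt Plane x).symm y))
        (fun p ↦ ‖u n p - U p‖ₑ ^ 2) (((hu n).sub hU).enorm.pow_const 2) ?_ fun y _ ↦ by simp
      exact (measurable_comp_chart_symm x (hu n)).sub (measurable_comp_chart_symm x hU)
    have t2 : Tendsto (fun n ↦ ∫ y in (chartAt Plane x).target,
        component g (X n) x i y * ψ y) atTop
        (𝓝 (∫ y in (chartAt Plane x).target, component g Y x i y * ψ y)) := by
      refine tendsto_of_enorm_sub_sq_le h2 (C := C2) fun n ↦ ?_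
      rw [← integral_sub
        (integrable_mul_test ((hX n).weak x i).locInt_deriv hψ1.continuous hψ2 hψ3)
        (integrable_mul_test hYloc hψ1.continuous hψ2 hψ3)]
      simp only [← sub_mul]
      have hsub := (hX n).isBorelField.sub hY
      have := hC2 (component g (fun p ↦ X n p - Y p) x i)
        (fun p ↦ ENNReal.ofReal (g.inner p (X n p - Y p) (X n p - Y p)))
        (measurable_inner g hsub hsub).ennreal_ofReal (hsub x i)
        fun y hy ↦ hA (fun p ↦ X n p - Y p) i y hy
      rwa [component_sub] at this
    refine tendsto_nhds_unique t1 (Tendsto.congr (fun n ↦ ?_) t2.neg)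
    exact (((hX n).weak x i).parts ψ hψ1 hψ2 hψ3).symm

end GradientLimit

/-! ### Poincaré inequality and completeness of E -/

section Space

variable {M : Type*} [TopologicalSpace M] [ChartedSpace Plane M] [IsManifold (𝓡 2) ∞ M]
  [CompactSpace M] [MeasurableSpace M] [BorelSpace M] {g : Metric M}

lemma E.fn_add (u v : E g) : (u + v).fn =ᵐ[riemannianVolume g] fun p ↦ u.fn p + v.fn p :=
  Lp.coeFn_add u.toLp v.toLp

lemma E.fn_sub (u v : E g) : (u - v).fn =ᵐ[riemannianVolume g] fun p ↦ u.fn p - v.fn p :=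
  Lp.coeFn_sub u.toLp v.toLp

lemma E.fn_neg (u : E g) : (-u).fn =ᵐ[riemannianVolume g] fun p ↦ -u.fn p :=
  Lp.coeFn_neg u.toLp

lemma E.fn_zero : (0 : E g).fn =ᵐ[riemannianVolume g] fun _ ↦ 0 :=
  Lp.coeFn_zero ℝ 2 (riemannianVolume g)

lemma E.fn_smul (c : ℝ) (u : E g) : (c • u).fn =ᵐ[riemannianVolume g] fun p ↦ c * u.fn p :=
  Lp.coeFn_smul c u.toLp

lemma E.memLp (u : E g) : MemLp u.fn 2 (riemannianVolume g) := Lp.memLp u.toLp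

lemma E.measurable_fn (u : E g) : Measurable u.fn := (Lp.stronglyMeasurable u.toLp).measurable

lemma E.integrable_fn (u : E g) : Integrable u.fn (riemannianVolume g) :=
  (show meanZeroSubmodule g from u).2.2.1

lemma E.integral_fn (u : E g) : ∫ p, u.fn p ∂(riemannianVolume g) = 0 :=
  (show meanZeroSubmodule g from u).2.2.2

lemma E.integrable_sq (u : E g) : Integrable (fun p ↦ u.fn p ^ 2) (riemannianVolume g) :=
  u.memLp.integrable_sq

lemma E.norm_toLp_sq (u : E g) : ‖u.toLp‖ ^ 2 = ∫ p, u.fn p ^ 2 ∂(riemannianVolume g) := by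
  rw [← real_inner_self_eq_norm_sq, L2.inner_def]
  refine integral_congr_ae (Eventually.of_forall fun p ↦ ?_)
  simp [E.fn, sq]

lemma E.ext_toLp {u v : E g} (h : u.toLp = v.toLp) : u = v := Subtype.ext h

/-- The field `grad` is an arbitrary choice; uniqueness almost everywhere lets the norm be computed
from any weak gradient at hand. -/
lemma E.norm_sq_of_isWeakGradient (u : E g) {X : ∀ p : M, TangentSpace (𝓡 2) p}
    (hX : IsWeakGradient g u.fn X) :
    ‖u‖ ^ 2 = ∫ p, g.inner p (X p) (X p) ∂(riemannianVolume g) := by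
  rw [E.norm_sq]
  refine integral_congr_ae ?_
  filter_upwards [u.isWeakGradient.unique hX] with p hp
  rw [hp]

lemma E.ofReal_norm_sq_of_isWeakGradient (u : E g) {X : ∀ p : M, TangentSpace (𝓡 2) p}
    (hX : IsWeakGradient g u.fn X) : ENNReal.ofReal (‖u‖ ^ 2) = fieldEnergy g X := by
  rw [u.norm_sq_of_isWeakGradient hX, ofReal_integral_eq_lintegral_ofReal hX.sq_integrable
    (Eventually.of_forall fun p ↦ metric_nonneg g p _)]
  rfl

/-- The Poincaré inequality. -/
lemma E.poincare (u : E g) :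
    firstEigenvalue g * ∫ p, u.fn p ^ 2 ∂(riemannianVolume g) ≤ ‖u‖ ^ 2 := by
  by_cases hu : u = 0
  · have h0 : ∫ p, u.fn p ^ 2 ∂(riemannianVolume g) = 0 := by
      rw [← E.norm_toLp_sq]
      have : u.toLp = 0 := by rw [hu]; rfl
      simp [this]
    rw [h0, mul_zero]; positivity
  · have hpos : 0 < ∫ p, u.fn p ^ 2 ∂(riemannianVolume g) := by
      rw [← E.norm_toLp_sq]
      have : u.toLp ≠ 0 := fun h ↦ hu (E.ext_toLp h)
      positivity
    have hbdd : BddBelow (range fun u : {u : E g // u ≠ 0} ↦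
        (∫ p, g.inner p (u.1.grad p) (u.1.grad p) ∂(riemannianVolume g)) /
        ∫ p, u.1.fn p ^ 2 ∂(riemannianVolume g)) := by
      refine ⟨0, ?_⟩
      rintro _ ⟨v, rfl⟩
      exact div_nonneg (integral_nonneg fun p ↦ metric_nonneg g p _)
        (integral_nonneg fun p ↦ sq_nonneg _)
    have := ciInf_le hbdd ⟨u, hu⟩
    rw [E.norm_sq]
    exact (le_div_iff₀ hpos).1 this

lemma E.norm_toLp_le (hμ : 0 < firstEigenvalue g) (u : E g) :
    ‖u.toLp‖ ≤ √((firstEigenvalue g)⁻¹) * ‖u‖ := by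
  have h := u.poincare
  rw [← E.norm_toLp_sq] at h
  rw [← Real.sqrt_sq (norm_nonneg u), ← Real.sqrt_mul (by positivity)]
  refine Real.le_sqrt_of_sq_le ?_
  rw [inv_mul_eq_div, le_div_iff₀ hμ, mul_comm]
  exact h

lemma E.eq_zero_of_norm (hμ : 0 < firstEigenvalue g) (u : E g) (hu : ‖u‖ = 0) : u = 0 := by
  have h := u.norm_toLp_le hμ
  rw [hu, mul_zero] at h
  exact E.ext_toLp (norm_le_zero_iff.1 h)

/-- The inclusion of `E` in `L²`. -/
def E.toLpCLM (hμ : 0 < firstEigenvalue g) : E g →L[ℝ] Lp ℝ 2 (riemannianVolume g) :=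
  LinearMap.mkContinuous
    { toFun := E.toLp
      map_add' := fun _ _ ↦ rfl
      map_smul' := fun _ _ ↦ rfl } (√((firstEigenvalue g)⁻¹)) (E.norm_toLp_le hμ)

lemma lintegral_enorm_sub_sq_Lp (f h : Lp ℝ 2 (riemannianVolume g)) :
    ∫⁻ p, ‖f p - h p‖ₑ ^ 2 ∂(riemannianVolume g) = ENNReal.ofReal (‖f - h‖ ^ 2) := by
  have h1 : ‖f - h‖ ^ 2 = ∫ p, (f p - h p) ^ 2 ∂(riemannianVolume g) := by
    rw [← real_inner_self_eq_norm_sq, L2.inner_def]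
    refine integral_congr_ae ?_
    filter_upwards [Lp.coeFn_sub f h] with p hp
    rw [hp]
    simp [sq]
  have h2 : Integrable (fun p ↦ (f p - h p) ^ 2) (riemannianVolume g) := by
    refine ((Lp.memLp (f - h)).integrable_sq).congr ?_
    filter_upwards [Lp.coeFn_sub f h] with p hp
    rw [hp]; rfl
  rw [h1, ofReal_integral_eq_lintegral_ofReal h2 (Eventually.of_forall fun p ↦ sq_nonneg _)]
  refine lintegral_congr fun p ↦ ?_
  rw [← ofReal_norm, ← ENNReal.ofReal_pow (norm_nonneg _), Real.norm_eq_abs, sq_abs]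

/-- For a rapidly Cauchy sequence the functions converge in L² by the Poincaré inequality and the
gradients converge almost everywhere. Closedness of the weak gradient identifies the limit field as
the gradient of the limit function. -/
lemma E.completeSpace [IsFiniteMeasure (riemannianVolume g)] (hμ : 0 < firstEigenvalue g) :
    CompleteSpace (E g) := by
  refine Metric.complete_of_convergent_controlled_sequences (fun n ↦ (1 / 2 : ℝ) ^ n)
    (fun n ↦ by positivity) fun u hu ↦ ?_
  have hcauchy : CauchySeq u := by
    refine cauchySeq_of_le_geometric (1 / 2) 1 (by norm_num) fun n ↦ ?_
    rw [one_mul]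
    exact (hu n n (n + 1) le_rfl (Nat.le_succ n)).le
  obtain ⟨U, hU⟩ := cauchySeq_tendsto_of_complete
    ((E.toLpCLM hμ).uniformContinuous.comp_cauchySeq hcauchy)
  have hUm : Measurable U := (Lp.stronglyMeasurable U).measurable
  have hWsub (n m : ℕ) : IsWeakGradient g (u n - u m).fn
      (fun p ↦ (u n).grad p - (u m).grad p) :=
    ((u n).isWeakGradient.sub (u m).isWeakGradient).congr (E.fn_sub _ _).symm
  have hen (n m : ℕ) : fieldEnergy g (fun p ↦ (u n).grad p - (u m).grad p) =
      ENNReal.ofReal (‖u n - u m‖ ^ 2) :=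
    ((u n - u m).ofReal_norm_sq_of_isWeakGradient (hWsub n m)).symm
  have hquarter {N n m : ℕ} (hn : N ≤ n) (hm : N ≤ m) :
      fieldEnergy g (fun p ↦ (u n).grad p - (u m).grad p) ≤ ENNReal.ofReal ((1 / 4) ^ N) := by
    rw [hen]
    refine ENNReal.ofReal_le_ofReal ?_
    have h1 := hu N n m hn hm
    rw [dist_eq_norm] at h1
    calc ‖u n - u m‖ ^ 2 ≤ ((1 / 2) ^ N) ^ 2 := pow_le_pow_left₀ (norm_nonneg _) h1.le 2
      _ = (1 / 4) ^ N := by rw [← pow_mul, mul_comm, pow_mul]; norm_num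
  have hB (n : ℕ) : IsBorelField g (u n).grad := (u n).isWeakGradient.isBorelField
  set X : ℕ → ∀ p : M, TangentSpace (𝓡 2) p := fun n ↦ (u n).grad with hX
  have hae := ae_exists_tendsto_field (X := X) hB
    fun n ↦ hquarter (N := n) (Nat.le_succ n) le_rfl
  set Y := fieldLimit X with hYdef
  have hY : IsBorelField g Y := isBorelField_fieldLimit hB
  have hYn (n : ℕ) : fieldEnergy g (fun p ↦ Y p - X n p) ≤ ENNReal.ofReal ((1 / 4) ^ n) :=
    fieldEnergy_limit_sub_le hB hae fun m hm ↦ hquarter hm le_rfl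
  have hsymm (n : ℕ) : fieldEnergy g (fun p ↦ X n p - Y p) =
      fieldEnergy g (fun p ↦ Y p - X n p) := by
    refine lintegral_congr fun p ↦ ?_
    simp only [map_sub, sub_apply]
    congr 1
    ring
  have hgeo : Tendsto (fun n : ℕ ↦ ENNReal.ofReal ((1 / 4) ^ n)) atTop (𝓝 0) := by
    have := (ENNReal.continuous_ofReal.tendsto 0).comp
      (tendsto_pow_atTop_nhds_zero_of_lt_one (r := (1 / 4 : ℝ)) (by norm_num) (by norm_num))
    rwa [ENNReal.ofReal_zero] at this
  have hlimX : Tendsto (fun n ↦ fieldEnergy g (fun p ↦ X n p - Y p)) atTop (𝓝 0) := by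
    refine tendsto_of_tendsto_of_tendsto_of_le_of_le tendsto_const_nhds hgeo (fun _ ↦ bot_le)
      fun n ↦ ?_
    rw [hsymm]; exact hYn n
  have hYfin : fieldEnergy g Y ≠ ⊤ := by
    have i1 := integrable_of_fieldEnergy (hY.sub (hB 0))
      (ne_top_of_le_ne_top ENNReal.ofReal_ne_top (hYn 0))
    have i2 := (u 0).isWeakGradient.sq_integrable
    have i3 : Integrable (fun p ↦ g.inner p (Y p) (Y p)) (riemannianVolume g) := by
      refine ((i1.const_mul 2).add (i2.const_mul 2)).mono'
        (measurable_inner g hY hY).aestronglyMeasurable (Eventually.of_forall fun p ↦ ?_)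
      rw [Real.norm_of_nonneg (metric_nonneg g p _)]
      -- Expanding |Y - 2X₀|² ≥ 0 gives |Y|² ≤ 2|Y - X₀|² + 2|X₀|².
      have h1 := metric_nonneg g p (Y p - (2 : ℝ) • X 0 p)
      simp only [Pi.add_apply, hX, map_sub, sub_apply, map_smul, smul_apply, smul_eq_mul,
        g.symm p ((u 0).grad p) (Y p)] at h1 ⊢
      linarith
    have := (hasFiniteIntegral_iff_ofReal
      (Eventually.of_forall fun p ↦ metric_nonneg g p _)).1 i3.2
    exact this.ne
  have hlimU : Tendsto (fun n ↦ ∫⁻ p, ‖(u n).fn p - U p‖ₑ ^ 2 ∂(riemannianVolume g)) atTop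
      (𝓝 0) := by
    have h1 : Tendsto (fun n ↦ ENNReal.ofReal (‖(u n).toLp - U‖ ^ 2)) atTop (𝓝 0) := by
      have h2 := ((hU.sub_const U).norm.pow 2)
      simp only [sub_self, norm_zero, ne_eq, OfNat.ofNat_ne_zero, not_false_eq_true,
        zero_pow] at h2
      have := (ENNReal.continuous_ofReal.tendsto 0).comp h2
      rwa [ENNReal.ofReal_zero] at this
    refine h1.congr fun n ↦ ?_
    exact (lintegral_enorm_sub_sq_Lp (u n).toLp U).symm
  have hUi : ∫⁻ p, ‖U p‖ₑ ^ 2 ∂(riemannianVolume g) ≠ ⊤ := by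
    have h1 := ((hasFiniteIntegral_iff_ofReal (Eventually.of_forall fun p ↦ sq_nonneg _)).1
      (Lp.memLp U).integrable_sq.2).ne
    convert h1 using 3 with p
    rw [← ofReal_norm, ← ENNReal.ofReal_pow (norm_nonneg _), Real.norm_eq_abs, sq_abs]
  have hW : IsWeakGradient g U Y := isWeakGradient_of_tendsto (fun n ↦ (u n).measurable_fn)
    (fun n ↦ (u n).isWeakGradient) hUm hY hUi hYfin hlimU hlimX
  have hUint : Integrable U (riemannianVolume g) := (Lp.memLp U).integrable one_le_two
  -- Finite volume makes the mean L²-continuous, so the constraint is closed.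
  have hUmean : ∫ p, U p ∂(riemannianVolume g) = 0 := by
    have h1 : Tendsto (fun n ↦ ∫ p, (u n).fn p ∂(riemannianVolume g)) atTop
        (𝓝 (∫ p, U p ∂(riemannianVolume g))) := by
      refine tendsto_of_enorm_sub_sq_le hlimU (C := (riemannianVolume g).real univ) fun n ↦ ?_
      rw [← integral_sub (u n).integrable_fn hUint]
      calc _ ≤ (∫⁻ p, ‖(u n).fn p - U p‖ₑ ∂(riemannianVolume g)) ^ 2 := by
            gcongr; exact enorm_integral_le_lintegral_enorm _
        _ ≤ _ := by
            rw [measureReal_def, ENNReal.ofReal_toReal (measure_ne_top _ _)]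
            exact sq_lintegral_le _ (((u n).measurable_fn.sub hUm).enorm.aemeasurable)
    simp only [E.integral_fn] at h1
    exact tendsto_nhds_unique h1 tendsto_const_nhds
  let v : E g := (⟨U, ⟨Y, hW⟩, hUint, hUmean⟩ : meanZeroSubmodule g)
  refine ⟨v, tendsto_iff_norm_sub_tendsto_zero.2 ?_⟩
  have hvn (n : ℕ) : ‖u n - v‖ ≤ (1 / 2) ^ n := by
    have h1 : IsWeakGradient g (u n - v).fn (fun p ↦ X n p - Y p) :=
      ((u n).isWeakGradient.sub hW).congr (E.fn_sub (u n) v).symm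
    have h2 := (u n - v).ofReal_norm_sq_of_isWeakGradient h1
    have h3 : ENNReal.ofReal (‖u n - v‖ ^ 2) ≤ ENNReal.ofReal ((1 / 4) ^ n) := by
      rw [h2, hsymm]; exact hYn n
    rw [ENNReal.ofReal_le_ofReal_iff (by positivity)] at h3
    refine le_of_sq_le_sq ?_ (by positivity)
    refine h3.trans (le_of_eq ?_)
    rw [← pow_mul, mul_comm n 2, pow_mul]; norm_num
  exact squeeze_zero (fun n ↦ norm_nonneg _) hvn
    (tendsto_pow_atTop_nhds_zero_of_lt_one (by norm_num) (by norm_num))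

end Space

/-! ### Weak compactness and separability in Hilbert spaces -/

section WeakCompactness

/-- Bounded sequences in separable Hilbert spaces have weakly convergent subsequences. -/
lemma exists_weakly_convergent_subseq {H : Type*} [NormedAddCommGroup H] [InnerProductSpace ℝ H]
    [CompleteSpace H] [TopologicalSpace.SeparableSpace H] (u : ℕ → H) (R : ℝ)
    (hu : ∀ n, ‖u n‖ ≤ R) :
    ∃ φ : ℕ → ℕ, StrictMono φ ∧ ∃ z : H, ∀ l : H →L[ℝ] ℝ,
      Tendsto (fun n ↦ l (u (φ n) - z)) atTop (𝓝 0) := by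
  -- Sequential Banach–Alaoglu in the dual of a separable space, transported by the Riesz
  -- isomorphism.
  have hseq := WeakDual.isSeqCompact_closedBall ℝ H (0 : StrongDual ℝ H) R
  let f : ℕ → WeakDual ℝ H := fun n ↦ StrongDual.toWeakDual (InnerProductSpace.toDual ℝ H (u n))
  obtain ⟨a, -, φ, hφ, hlim⟩ := hseq (x := f) fun n ↦ by
    simp only [f, mem_preimage]
    rw [mem_closedBall_zero_iff]
    exact ((InnerProductSpace.toDual ℝ H).norm_map (u n)).le.trans (hu n)
  refine ⟨φ, hφ, (InnerProductSpace.toDual ℝ H).symm (WeakDual.toStrongDual a), fun l ↦ ?_⟩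
  set v := (InnerProductSpace.toDual ℝ H).symm l with hv
  have hl (w : H) : l w = ⟪v, w⟫ := by
    rw [hv, InnerProductSpace.toDual_symm_apply]
  have h1 : Tendsto (fun n ↦ f (φ n) v) atTop (𝓝 (a v)) :=
    ((WeakDual.eval_continuous v).tendsto a).comp hlim
  have h2 : Tendsto (fun n ↦ f (φ n) v - a v) atTop (𝓝 0) := by
    simpa using h1.sub_const (a v)
  refine h2.congr fun n ↦ ?_
  rw [hl, inner_sub_right]
  congr 1
  · simp only [f]
    rw [real_inner_comm]
    rfl
  · rw [real_inner_comm, InnerProductSpace.toDual_symm_apply]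
    rfl

/-- A Hilbert space with a continuous linear injection in a separable Hilbert space is
separable. -/
lemma separableSpace_of_injective {H K : Type*} [NormedAddCommGroup H] [InnerProductSpace ℝ H]
    [CompleteSpace H] [NormedAddCommGroup K] [InnerProductSpace ℝ K] [CompleteSpace K]
    [TopologicalSpace.SeparableSpace K] (T : H →L[ℝ] K) (hT : Function.Injective T) :
    TopologicalSpace.SeparableSpace H := by
  have h1 : DenseRange (ContinuousLinearMap.adjoint T) := by
    -- The orthogonal complement of the range of the adjoint is the kernel of `T`; injectivity thus
    -- makes the image of the separable space dense.
    have h2 : (ContinuousLinearMap.adjoint T).rangeᗮ = ⊥ := by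
      rw [ContinuousLinearMap.orthogonal_range, ContinuousLinearMap.adjoint_adjoint]
      exact LinearMap.ker_eq_bot.2 hT
    have h3 := (Submodule.topologicalClosure_eq_top_iff
      (K := (ContinuousLinearMap.adjoint T).range)).2 h2
    have h4 : Dense ((ContinuousLinearMap.adjoint T).range : Set H) :=
      Submodule.dense_iff_topologicalClosure_eq_top.2 h3
    exact h4
  exact h1.separableSpace (ContinuousLinearMap.adjoint T).continuous

end WeakCompactness

/-! ### Trudinger and Rellich theorems on the surface -/

section Embedding

variable {M : Type*} [TopologicalSpace M] [ChartedSpace Plane M] [IsManifold (𝓡 2) ∞ M]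
  [CompactSpace M] [MeasurableSpace M] [BorelSpace M] {g : Metric M}

lemma IsPlaneH1.mono {y₀ : Plane} {r D D' : ℝ} {v : Plane → ℝ} {w : Fin 2 → Plane → ℝ}
    (h : IsPlaneH1 y₀ r D v w) (hD : D ≤ D') : IsPlaneH1 y₀ r D' v w :=
  { h with bound := h.bound.trans (ENNReal.ofReal_le_ofReal hD) }

lemma E.exists_isPlaneH1 (hμ : 0 < firstEigenvalue g) (x : M) : ∃ C : ℝ, 0 < C ∧ ∀ u : E g,
    IsPlaneH1 (chartAt Plane x x) (2 * chartRadius x) (C * ‖u‖ ^ 2)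
      (localize x u.fn) (localizeDeriv g x u.fn u.grad) := by
  obtain ⟨C, hC, h⟩ := exists_isPlaneH1_localize g x
  refine ⟨C * ((firstEigenvalue g)⁻¹ + 1), by positivity, fun u ↦ ?_⟩
  refine (h u.fn u.grad u.measurable_fn u.isWeakGradient u.integrable_sq).mono ?_
  rw [← E.norm_sq, mul_assoc, add_mul, one_mul]
  gcongr
  rw [inv_mul_eq_div, le_div_iff₀ hμ, mul_comm]
  exact u.poincare

lemma lintegral_le_sum_chartNhd {t : Finset M} (ht : ∀ p : M, ∃ x ∈ t, p ∈ chartNhd x)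
    (F : M → ℝ≥0∞) : ∫⁻ p, F p ∂(riemannianVolume g) ≤
      ∑ x ∈ t, ∫⁻ p in chartNhd x, F p ∂(riemannianVolume g) := by
  have : (univ : Set M) ⊆ ⋃ x ∈ t, chartNhd x := fun p _ ↦ by simpa using ht p
  calc ∫⁻ p, F p ∂(riemannianVolume g) = ∫⁻ p in univ, F p ∂(riemannianVolume g) := by simp
    _ ≤ ∫⁻ p in ⋃ x ∈ t, chartNhd x, F p ∂(riemannianVolume g) := lintegral_mono_set this
    _ ≤ _ := by
        rw [← Finset.tsum_subtype]
        refine le_trans (le_of_eq ?_) (lintegral_iUnion_le (fun x : t ↦ chartNhd (x : M)) F)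
        congr 2
        ext p; simp

/-- The Trudinger inequality: exponential integrability, uniformly on bounded sets. -/
lemma E.exists_exp_bound (hμ : 0 < firstEigenvalue g) (p R : ℝ) (hp : 0 ≤ p) :
    ∃ C : ℝ, 0 ≤ C ∧ ∀ u : E g, ‖u‖ ≤ R →
      ∫⁻ q, ENNReal.ofReal (Real.exp (p * |u.fn q|)) ∂(riemannianVolume g) ≤
        ENNReal.ofReal C := by
  obtain ⟨t, ht⟩ := exists_finite_cover (M := M)
  have hloc (x : M) : ∃ C : ℝ, 0 ≤ C ∧ ∀ u : E g, ‖u‖ ≤ R →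
      ∫⁻ q in chartNhd x, ENNReal.ofReal (Real.exp (p * |u.fn q|)) ∂(riemannianVolume g) ≤
        ENNReal.ofReal C := by
    obtain ⟨C1, hC1, h1⟩ := E.exists_isPlaneH1 hμ x
    obtain ⟨A, hA, hF⟩ := exists_setLIntegral_chartNhd_le g x
    obtain ⟨C, hC, h⟩ := exists_exp_bound_planeH1 p hp (C1 * R ^ 2) (by positivity)
      (chartAt Plane x x) (2 * chartRadius x)
    refine ⟨A * C, by positivity, fun u hu ↦ ?_⟩
    have hm : Measurable fun q ↦ ENNReal.ofReal (Real.exp (p * |u.fn q|)) := by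
      have := u.measurable_fn
      fun_prop
    refine (hF _ hm).trans ?_
    rw [ENNReal.ofReal_mul hA.le]
    gcongr
    refine le_trans ?_ (h _ _ ((h1 u).mono (by gcongr)))
    -- On the inner ball the cutoff is 1, so the localized function is the function itself.
    calc _ = ∫⁻ y in Metric.ball (chartAt Plane x x) (chartRadius x),
          ENNReal.ofReal (Real.exp (p * |localize x u.fn y|)) := by
          refine setLIntegral_congr_fun Metric.isOpen_ball.measurableSet fun y hy ↦ ?_
          rw [localize_of_mem_ball u.fn hy]
      _ ≤ _ := lintegral_mono_set (Metric.ball_subset_closedBall.trans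
          (Metric.closedBall_subset_closedBall (by linarith [chartRadius_pos x])))
  choose C hC0 hC using hloc
  refine ⟨∑ x ∈ t, C x, Finset.sum_nonneg fun x _ ↦ hC0 x, fun u hu ↦ ?_⟩
  refine (lintegral_le_sum_chartNhd ht _).trans ?_
  rw [ENNReal.ofReal_sum_of_nonneg fun x _ ↦ hC0 x]
  exact Finset.sum_le_sum fun x _ ↦ hC x u hu

lemma E.lintegral_enorm_sq (u : E g) :
    ∫⁻ p, ‖u.fn p‖ₑ ^ 2 ∂(riemannianVolume g) = ENNReal.ofReal (‖u.toLp‖ ^ 2) := by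
  rw [E.norm_toLp_sq, ofReal_integral_eq_lintegral_ofReal u.integrable_sq
    (Eventually.of_forall fun p ↦ sq_nonneg _)]
  refine lintegral_congr fun p ↦ ?_
  rw [← ofReal_norm, ← ENNReal.ofReal_pow (norm_nonneg _), Real.norm_eq_abs, sq_abs]

/-- Integration against a test function in a chart, as a continuous linear functional on `E`. -/
lemma E.exists_testFunctional (hμ : 0 < firstEigenvalue g) (x : M) {φ : Plane → ℝ}
    (hφ : Continuous φ) (hφc : HasCompactSupport φ)
    (hφs : tsupport φ ⊆ (chartAt Plane x).target) :
    ∃ l : E g →L[ℝ] ℝ, ∀ u : E g,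
      l u = ∫ y in (chartAt Plane x).target, u.fn ((chartAt Plane x).symm y) * φ y := by
  obtain ⟨C, hC0, hC⟩ := exists_enorm_integral_test_le g x hφ hφc hφs 1
  have hint (u : E g) : Integrable (fun y ↦ u.fn ((chartAt Plane x).symm y) * φ y)
      (volume.restrict (chartAt Plane x).target) :=
    integrable_mul_test (u.isWeakGradient.weak x 0).locInt hφ hφc hφs
  let L : E g →ₗ[ℝ] ℝ :=
    { toFun := fun u ↦ ∫ y in (chartAt Plane x).target,
        u.fn ((chartAt Plane x).symm y) * φ y
      map_add' := fun u v ↦ by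
        rw [← integral_add (hint u) (hint v)]
        refine integral_congr_ae ?_
        filter_upwards [ae_chart g (E.fn_add u v) x] with y hy
        rw [hy, add_mul]
      map_smul' := fun c u ↦ by
        rw [RingHom.id_apply, smul_eq_mul, ← integral_const_mul]
        refine integral_congr_ae ?_
        filter_upwards [ae_chart g (E.fn_smul c u) x] with y hy
        rw [hy, mul_assoc] }
  refine ⟨L.mkContinuous (√C * √((firstEigenvalue g)⁻¹)) fun u ↦ ?_, fun u ↦ rfl⟩
  have h1 := hC (fun y ↦ u.fn ((chartAt Plane x).symm y)) (fun p ↦ ‖u.fn p‖ₑ ^ 2)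
    (u.measurable_fn.enorm.pow_const 2) (measurable_comp_chart_symm x u.measurable_fn)
    fun y _ ↦ by simp
  rw [E.lintegral_enorm_sq, ← ENNReal.ofReal_mul hC0, ← ofReal_norm,
    ← ENNReal.ofReal_pow (norm_nonneg _), ENNReal.ofReal_le_ofReal_iff (by positivity)] at h1
  have h2 : ‖L u‖ ≤ √C * ‖u.toLp‖ := by
    rw [← Real.sqrt_sq (norm_nonneg u.toLp), ← Real.sqrt_mul hC0]
    exact Real.le_sqrt_of_sq_le h1
  rw [mul_assoc]
  exact h2.trans (mul_le_mul_of_nonneg_left (u.norm_toLp_le hμ) (Real.sqrt_nonneg _))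

/-- This exhibits the mollified value at a point as the pairing of `u` with a test function, hence
as a continuous functional on E that weak convergence can be tested on. -/
lemma mollify_localize_eq (x : M) (k : ℕ) (u : M → ℝ) (y : Plane) :
    mollify k (localize x u) y = ∫ z in (chartAt Plane x).target,
      u ((chartAt Plane x).symm z) * (cutoff x z * mollifier k (y - z)) := by
  rw [mollify, ← integral_indicator (chartAt Plane x).open_target.measurableSet]
  refine integral_congr_ae (Eventually.of_forall fun z ↦ ?_)
  by_cases hz : z ∈ (chartAt Plane x).target <;> simp [localize, hz, mul_assoc]

lemma mollifier_bound (k : ℕ) : ∃ S : ℝ, 0 ≤ S ∧ ∀ y, ‖mollifier k y‖ ≤ S := by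
  obtain ⟨S, hS⟩ := (mollifier_continuous k).bounded_above_of_compact_support
    (mollifier_hasCompactSupport k)
  exact ⟨S, (norm_nonneg _).trans (hS 0), hS⟩

lemma E.exists_mollify_localize_bound (hμ : 0 < firstEigenvalue g) (x : M) (k : ℕ) (R : ℝ) :
    ∃ B : ℝ, ∀ u : E g, ‖u‖ ≤ R → ∀ y, ‖mollify k (localize x u.fn) y‖ₑ ^ 2 ≤
      ENNReal.ofReal B := by
  obtain ⟨S, hS0, hS⟩ := mollifier_bound k
  obtain ⟨A, hA, hF⟩ := exists_setLIntegral_compact_le g x (isCompact_chartBall x)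
    (chartBall_subset x)
  refine ⟨S ^ 2 * ((volume (chartBall x)).toReal * (A * (√((firstEigenvalue g)⁻¹) * R) ^ 2)),
    fun u hu y ↦ ?_⟩
  have hlm := measurable_localize x u.measurable_fn
  have h1 : ‖mollify k (localize x u.fn) y‖ₑ ≤
      ENNReal.ofReal S * ∫⁻ z in chartBall x, ‖localize x u.fn z‖ₑ := by
    rw [mollify, ← lintegral_const_mul' _ _ ENNReal.ofReal_ne_top,
      ← lintegral_indicator (isCompact_chartBall x).measurableSet]
    refine (enorm_integral_le_lintegral_enorm _).trans (lintegral_mono fun z ↦ ?_)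
    by_cases hz : z ∈ chartBall x
    · rw [indicator_of_mem hz, enorm_mul, mul_comm]
      gcongr
      rw [← ofReal_norm]
      exact ENNReal.ofReal_le_ofReal (hS _)
    · rw [localize_of_notMem _ hz]; simp
  have h2 : ∫⁻ z in chartBall x, ‖localize x u.fn z‖ₑ ^ 2 ≤
      ENNReal.ofReal A * ENNReal.ofReal ((√((firstEigenvalue g)⁻¹) * R) ^ 2) := by
    calc _ ≤ ∫⁻ z in chartBall x, ‖u.fn ((chartAt Plane x).symm z)‖ₑ ^ 2 := by
          refine setLIntegral_mono' (isCompact_chartBall x).measurableSet fun z hz ↦ ?_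
          gcongr
          have := localize_abs_le x u.fn z
          rw [indicator_of_mem (chartBall_subset x hz)] at this
          rw [← ofReal_norm, ← ofReal_norm]
          exact ENNReal.ofReal_le_ofReal this
      _ ≤ ENNReal.ofReal A * ∫⁻ p, ‖u.fn p‖ₑ ^ 2 ∂(riemannianVolume g) :=
          hF (fun p ↦ ‖u.fn p‖ₑ ^ 2) (u.measurable_fn.enorm.pow_const 2)
      _ ≤ _ := by
          rw [E.lintegral_enorm_sq]
          gcongr
          exact (u.norm_toLp_le hμ).trans (mul_le_mul_of_nonneg_left hu (Real.sqrt_nonneg _))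
  calc ‖mollify k (localize x u.fn) y‖ₑ ^ 2
      ≤ (ENNReal.ofReal S * ∫⁻ z in chartBall x, ‖localize x u.fn z‖ₑ) ^ 2 := by gcongr
    _ ≤ ENNReal.ofReal S ^ 2 * (volume (chartBall x) *
        ∫⁻ z in chartBall x, ‖localize x u.fn z‖ₑ ^ 2) := by
        rw [mul_pow]
        gcongr
        simpa using sq_lintegral_le (volume.restrict (chartBall x)) hlm.enorm.aemeasurable
    _ ≤ ENNReal.ofReal S ^ 2 * (volume (chartBall x) *
        (ENNReal.ofReal A * ENNReal.ofReal ((√((firstEigenvalue g)⁻¹) * R) ^ 2))) := by gcongr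
    _ = _ := by
        rw [ENNReal.ofReal_mul (by positivity), ENNReal.ofReal_pow hS0,
          ENNReal.ofReal_mul (by positivity), ENNReal.ofReal_mul (by positivity),
          ENNReal.ofReal_toReal (isCompact_chartBall x).measure_lt_top.ne]

/-- Weakly null bounded sequences converge to zero in `L²` locally. -/
lemma E.tendsto_local (hμ : 0 < firstEigenvalue g) (x : M) {w : ℕ → E g} {R : ℝ}
    (hw : ∀ n, ‖w n‖ ≤ R) (hweak : ∀ l : E g →L[ℝ] ℝ, Tendsto (fun n ↦ l (w n)) atTop (𝓝 0)) :
    Tendsto (fun n ↦ ∫⁻ y, ‖localize x (w n).fn y‖ₑ ^ 2) atTop (𝓝 0) := by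
  obtain ⟨C1, hC1, h1⟩ := E.exists_isPlaneH1 hμ x
  have hH1 (n : ℕ) := (h1 (w n)).mono (D' := C1 * R ^ 2)
    (mul_le_mul_of_nonneg_left (pow_le_pow_left₀ (norm_nonneg _) (hw n) 2) hC1.le)
  have hpt (k : ℕ) (y : Plane) :
      Tendsto (fun n ↦ mollify k (localize x (w n).fn) y) atTop (𝓝 0) := by
    obtain ⟨l, hl⟩ := E.exists_testFunctional (g := g) hμ x
      (φ := fun z ↦ cutoff x z * mollifier k (y - z))
      ((cutoff x).continuous.mul
        ((mollifier_continuous k).comp (continuous_const.sub continuous_id)))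
      (cutoff x).hasCompactSupport.mul_right
      (tsupport_mul_subset_left.trans ((cutoff_tsupport x).subset.trans (chartBall_subset x)))
    refine (hweak l).congr fun n ↦ ?_
    rw [hl, mollify_localize_eq]
  -- At a fixed scale k, weak convergence gives pointwise convergence, and dominated convergence
  -- applies with a constant on a fixed ball as majorant.
  have hmoll (k : ℕ) :
      Tendsto (fun n ↦ ∫⁻ y, ‖mollify k (localize x (w n).fn) y‖ₑ ^ 2) atTop (𝓝 0) := by
    obtain ⟨B, hB⟩ := E.exists_mollify_localize_bound hμ x k R
    have hdom := tendsto_lintegral_of_dominated_convergence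
      (μ := volume) (F := fun n y ↦ ‖mollify k (localize x (w n).fn) y‖ₑ ^ 2) (f := fun _ ↦ 0)
      ((Metric.closedBall (chartAt Plane x x) (2 * chartRadius x + 1)).indicator
        fun _ ↦ ENNReal.ofReal B) (fun n ↦ ?_) (fun n ↦ Eventually.of_forall fun y ↦ ?_) ?_
      (Eventually.of_forall fun y ↦ ?_)
    · simpa using hdom
    · exact (mollify_contDiff k (hH1 n).locallyIntegrable).continuous.enorm.measurable.pow_const 2
    · by_cases hy : y ∈ Metric.closedBall (chartAt Plane x x) (2 * chartRadius x + 1)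
      · simp only [indicator_of_mem hy]
        exact hB (w n) (hw n) y
      · simp only [indicator_of_notMem hy]
        rw [mollify_eq_zero k (hH1 n).supp hy]
        simp
    · rw [lintegral_indicator Metric.isClosed_closedBall.measurableSet, setLIntegral_const]
      exact (ENNReal.mul_lt_top ENNReal.ofReal_lt_top measure_closedBall_lt_top).ne
    · have := (ENNReal.continuous_pow 2).continuousAt.tendsto.comp (hpt k y).enorm
      simpa [Function.comp_def] using this
  have hsplit (k n : ℕ) : ∫⁻ y, ‖localize x (w n).fn y‖ₑ ^ 2 ≤
      2 * (∫⁻ y, ‖mollify k (localize x (w n).fn) y‖ₑ ^ 2) +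
        2 * ENNReal.ofReal ((1 / (k + 1)) ^ 2 * (C1 * R ^ 2)) := by
    have hm1 : Measurable fun y ↦ ‖mollify k (localize x (w n).fn) y‖ₑ ^ 2 :=
      (mollify_contDiff k (hH1 n).locallyIntegrable).continuous.enorm.measurable.pow_const 2
    calc ∫⁻ y, ‖localize x (w n).fn y‖ₑ ^ 2
        ≤ ∫⁻ y, (2 * ‖mollify k (localize x (w n).fn) y‖ₑ ^ 2 +
          2 * ‖mollify k (localize x (w n).fn) y - localize x (w n).fn y‖ₑ ^ 2) := by
          refine lintegral_mono fun y ↦ ?_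
          have e (a : ℝ) : ‖a‖ₑ ^ 2 = ENNReal.ofReal (a ^ 2) := by
            rw [← ofReal_norm, ← ENNReal.ofReal_pow (norm_nonneg _), Real.norm_eq_abs, sq_abs]
          have two : (2 : ℝ≥0∞) = ENNReal.ofReal 2 := by simp
          dsimp only
          rw [e, e, e, two, ← ENNReal.ofReal_mul (by norm_num),
            ← ENNReal.ofReal_mul (by norm_num), ← ENNReal.ofReal_add (by positivity)
              (by positivity)]
          refine ENNReal.ofReal_le_ofReal ?_
          nlinarith [sq_nonneg (2 * mollify k (localize x (w n).fn) y - localize x (w n).fn y)]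
      _ = 2 * (∫⁻ y, ‖mollify k (localize x (w n).fn) y‖ₑ ^ 2) +
          2 * ∫⁻ y, ‖mollify k (localize x (w n).fn) y - localize x (w n).fn y‖ₑ ^ 2 := by
          rw [lintegral_add_left (hm1.const_mul 2), lintegral_const_mul _ hm1,
            lintegral_const_mul' _ _ (by simp)]
      _ ≤ _ := by
          gcongr
          exact (hH1 n).lintegral_mollify_sub_le k
  have hk : Tendsto (fun k : ℕ ↦ 2 * ENNReal.ofReal ((1 / ((k : ℝ) + 1)) ^ 2 * (C1 * R ^ 2)))
      atTop (𝓝 0) := by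
    have h2 := ((tendsto_one_div_add_atTop_nhds_zero_nat (𝕜 := ℝ)).pow 2).mul_const (C1 * R ^ 2)
    have h3 := ENNReal.Tendsto.const_mul (a := 2) ((ENNReal.continuous_ofReal.tendsto _).comp h2)
      (Or.inr (by simp))
    simpa [Function.comp_def] using h3
  rw [ENNReal.tendsto_nhds_zero]
  intro ε hε
  have hε2 : 0 < ε / 2 := ENNReal.half_pos hε.ne'
  -- The mollification error is uniform in n, so the scale k is fixed before n is taken large.
  obtain ⟨k, hk'⟩ := ((ENNReal.tendsto_nhds_zero.1 hk) (ε / 2) hε2).exists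
  have h4 : Tendsto (fun n ↦ 2 * ∫⁻ y, ‖mollify k (localize x (w n).fn) y‖ₑ ^ 2) atTop
      (𝓝 0) := by
    simpa using ENNReal.Tendsto.const_mul (a := 2) (hmoll k) (Or.inr (by simp))
  filter_upwards [(ENNReal.tendsto_nhds_zero.1 h4) (ε / 2) hε2] with n hn
  refine (hsplit k n).trans ((add_le_add hn hk').trans ?_)
  rw [ENNReal.add_halves]

lemma E.tendsto_toLp_of_weak (hμ : 0 < firstEigenvalue g) {w : ℕ → E g} {R : ℝ}
    (hw : ∀ n, ‖w n‖ ≤ R) (hweak : ∀ l : E g →L[ℝ] ℝ, Tendsto (fun n ↦ l (w n)) atTop (𝓝 0)) :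
    Tendsto (fun n ↦ ‖(w n).toLp‖) atTop (𝓝 0) := by
  obtain ⟨t, ht⟩ := exists_finite_cover (M := M)
  choose A hA hF using exists_setLIntegral_chartNhd_le g
  have h1 : Tendsto (fun n ↦ ∑ x ∈ t, ENNReal.ofReal (A x) *
      ∫⁻ y, ‖localize x (w n).fn y‖ₑ ^ 2) atTop (𝓝 0) := by
    have := tendsto_finsetSum t fun x _ ↦ ENNReal.Tendsto.const_mul
      (a := ENNReal.ofReal (A x)) (E.tendsto_local hμ x hw hweak) (Or.inr ENNReal.ofReal_ne_top)
    simpa using this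
  have h2 : Tendsto (fun n ↦ ENNReal.ofReal (‖(w n).toLp‖ ^ 2)) atTop (𝓝 0) := by
    refine tendsto_of_tendsto_of_tendsto_of_le_of_le tendsto_const_nhds h1 (fun _ ↦ bot_le)
      fun n ↦ ?_
    dsimp only
    rw [← E.lintegral_enorm_sq]
    refine (lintegral_le_sum_chartNhd ht _).trans (Finset.sum_le_sum fun x _ ↦ ?_)
    refine (hF x _ ((w n).measurable_fn.enorm.pow_const 2)).trans ?_
    refine mul_le_mul_right ?_ _
    refine le_trans (le_of_eq ?_) (setLIntegral_le_lintegral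
      (Metric.ball (chartAt Plane x x) (chartRadius x)) _)
    refine setLIntegral_congr_fun Metric.isOpen_ball.measurableSet fun y hy ↦ ?_
    rw [localize_of_mem_ball (w n).fn hy]
  have h3 := (ENNReal.continuousAt_toReal ENNReal.zero_ne_top).tendsto.comp h2
  have h4 := (Real.continuous_sqrt.tendsto _).comp h3
  simpa [Function.comp_def, ENNReal.toReal_ofReal, Real.sqrt_sq] using h4

/-- `E` with its norm, under the assumption that the first eigenvalue is positive. -/
@[reducible] def E.normedAddCommGroup (hμ : 0 < firstEigenvalue g) : NormedAddCommGroup (E g) :=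
  NormedAddCommGroup.ofSeparation (E.eq_zero_of_norm hμ)

/-- A compact surface is second countable, so L² is separable, and E injects continuously into it.
-/
lemma E.separableSpace [IsFiniteMeasure (riemannianVolume g)] (hμ : 0 < firstEigenvalue g) :
    TopologicalSpace.SeparableSpace (E g) := by
  let _ := E.normedAddCommGroup hμ
  have _ := E.completeSpace hμ
  have _ : SecondCountableTopology M := ChartedSpace.secondCountable_of_sigmaCompact Plane M
  have _ : Fact ((2 : ℝ≥0∞) ≠ ⊤) := ⟨by simp⟩
  exact separableSpace_of_injective (E.toLpCLM hμ) fun u v h ↦ E.ext_toLp h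

/-- The Rellich theorem. -/
lemma E.rellich [IsFiniteMeasure (riemannianVolume g)] (hμ : 0 < firstEigenvalue g)
    (u : ℕ → E g) (R : ℝ) (hu : ∀ n, ‖u n‖ ≤ R) :
    ∃ φ : ℕ → ℕ, StrictMono φ ∧ ∃ z : E g,
      Tendsto (fun n ↦ ‖(u (φ n) - z).toLp‖) atTop (𝓝 0) := by
  let _ := E.normedAddCommGroup hμ
  have _ := E.completeSpace hμ
  have _ := E.separableSpace hμ
  obtain ⟨φ, hφ, z, hz⟩ := exists_weakly_convergent_subseq u R hu
  refine ⟨φ, hφ, z, E.tendsto_toLp_of_weak hμ (R := R + ‖z‖) (fun n ↦ ?_) hz⟩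
  exact (norm_sub_le _ _).trans (by gcongr; exact hu _)

end Embedding

/-! ### Reflection of a compact potential -/

section NegPotential

variable {H : Type*} [NormedAddCommGroup H] [InnerProductSpace ℝ H]

lemma IsCompactPotential.neg {P : H → ℝ} {p : H → H} (h : IsCompactPotential P p) :
    IsCompactPotential (fun u ↦ P (-u)) (fun u ↦ -p (-u)) where
  nonneg u := h.nonneg _
  zero := by simpa using h.zero
  cont := (h.cont.comp continuous_neg).neg
  tangent u w := by
    have := h.tangent (-u) (-w)
    rwa [← neg_sub', inner_neg_right, ← inner_neg_left] at this
  compact u R hu := by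
    obtain ⟨φ, hφ, z, hz⟩ := h.compact (fun n ↦ -u n) R fun n ↦ by simpa using hu n
    exact ⟨φ, hφ, -z, hz.neg⟩

end NegPotential

/-! ### The potential log ∫ e^u: convexity, compact gradient, behaviour at the origin -/

section ExpPotential

lemma integral_mul_le_sqrt {X : Type*} [MeasurableSpace X] {ν : Measure X} {f h : X → ℝ}
    (hf : MemLp f 2 ν) (hh : MemLp h 2 ν) :
    ∫ x, f x * h x ∂ν ≤ √(∫ x, f x ^ 2 ∂ν) * √(∫ x, h x ^ 2 ∂ν) := by
  have hn {f : X → ℝ} (hf : MemLp f 2 ν) : ‖hf.toLp f‖ = √(∫ x, f x ^ 2 ∂ν) := by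
    rw [eq_comm, Real.sqrt_eq_iff_eq_sq (integral_nonneg fun x ↦ sq_nonneg _) (norm_nonneg _),
      ← real_inner_self_eq_norm_sq, L2.inner_def]
    refine integral_congr_ae ?_
    filter_upwards [hf.coeFn_toLp] with x hx
    simp [hx, sq]
  have h1 := real_inner_le_norm (hf.toLp f) (hh.toLp h)
  rw [hn hf, hn hh, L2.inner_def] at h1
  refine le_trans (le_of_eq (integral_congr_ae ?_)) h1
  filter_upwards [hf.coeFn_toLp, hh.coeFn_toLp] with x hx hx'
  simp [hx, hx', mul_comm]

/-- One factor of the square is bounded by a mean value estimate, the other trivially. Keeping |a -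
b| to the first power lets Cauchy–Schwarz use only the L² distance and exponential integrals. -/
lemma exp_sub_exp_sq_le (a b : ℝ) : (Real.exp a - Real.exp b) ^ 2 ≤
    |a - b| * (2 * (Real.exp (2 * |a|) + Real.exp (2 * |b|))) := by
  have key (a b : ℝ) : Real.exp a - Real.exp b ≤ |a - b| * (Real.exp |a| + Real.exp |b|) := by
    have h1 := Real.add_one_le_exp (b - a)
    have h2 : Real.exp b = Real.exp (b - a) * Real.exp a := by rw [← Real.exp_add]; simp
    have h3 : Real.exp a ≤ Real.exp |a| := Real.exp_le_exp.2 (le_abs_self a)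
    have h4 := Real.exp_pos a
    have h5 : (a - b) * Real.exp a ≤ |a - b| * Real.exp |a| :=
      mul_le_mul (le_abs_self _) h3 h4.le (abs_nonneg _)
    have h6 : 0 ≤ |a - b| * Real.exp |b| := by positivity
    rw [h2]
    nlinarith
  have k2 (a b : ℝ) : Real.exp a - Real.exp b ≤ Real.exp |a| + Real.exp |b| := by
    have h3 : Real.exp a ≤ Real.exp |a| := Real.exp_le_exp.2 (le_abs_self a)
    have := Real.exp_pos |b|
    have := Real.exp_pos b
    linarith
  have e1 : |Real.exp a - Real.exp b| ≤ |a - b| * (Real.exp |a| + Real.exp |b|) := by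
    rw [abs_le']
    refine ⟨key a b, ?_⟩
    have := key b a
    rw [abs_sub_comm, add_comm] at this
    linarith
  have e2 : |Real.exp a - Real.exp b| ≤ Real.exp |a| + Real.exp |b| := by
    rw [abs_le']
    exact ⟨k2 a b, by linarith [k2 b a]⟩
  have e3 (x : ℝ) : Real.exp (2 * x) = Real.exp x ^ 2 := by
    rw [← Real.exp_nat_mul]; norm_num
  rw [e3, e3, ← sq_abs]
  calc |Real.exp a - Real.exp b| ^ 2 = |Real.exp a - Real.exp b| * |Real.exp a - Real.exp b| := sq _
    _ ≤ |a - b| * (Real.exp |a| + Real.exp |b|) * (Real.exp |a| + Real.exp |b|) :=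
        mul_le_mul e1 e2 (abs_nonneg _) (by positivity)
    _ = |a - b| * (Real.exp |a| + Real.exp |b|) ^ 2 := by ring
    _ ≤ _ := by
        gcongr
        nlinarith [sq_nonneg (Real.exp |a| - Real.exp |b|)]

variable {M : Type*} [TopologicalSpace M] [ChartedSpace Plane M] [IsManifold (𝓡 2) ∞ M]
  [CompactSpace M] [MeasurableSpace M] [BorelSpace M] {g : Metric M}

lemma E.integrable_exp_abs (hμ : 0 < firstEigenvalue g) (u : E g) {c : ℝ} (hc : 0 ≤ c) :
    Integrable (fun q ↦ Real.exp (c * |u.fn q|)) (riemannianVolume g) := by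
  obtain ⟨C, hC, h⟩ := E.exists_exp_bound (g := g) hμ c ‖u‖ hc
  have hm := u.measurable_fn
  refine ⟨by fun_prop, ?_⟩
  rw [hasFiniteIntegral_iff_ofReal (Eventually.of_forall fun q ↦ (Real.exp_pos _).le)]
  exact (h u le_rfl).trans_lt ENNReal.ofReal_lt_top

lemma E.exists_integral_exp_le (hμ : 0 < firstEigenvalue g) (R : ℝ) {c : ℝ} (hc : 0 ≤ c) :
    ∃ C : ℝ, 0 ≤ C ∧ ∀ u : E g, ‖u‖ ≤ R →
      ∫ q, Real.exp (c * |u.fn q|) ∂(riemannianVolume g) ≤ C := by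
  obtain ⟨C, hC, h⟩ := E.exists_exp_bound (g := g) hμ c R hc
  refine ⟨C, hC, fun u hu ↦ ?_⟩
  rw [integral_eq_lintegral_of_nonneg_ae (Eventually.of_forall fun q ↦ (Real.exp_pos _).le)
    (u.integrable_exp_abs hμ hc).aestronglyMeasurable]
  exact ENNReal.toReal_le_of_le_ofReal hC (h u hu)

lemma E.integrable_exp (hμ : 0 < firstEigenvalue g) (u : E g) :
    Integrable (fun q ↦ Real.exp (u.fn q)) (riemannianVolume g) := by
  have hm := u.measurable_fn
  refine (u.integrable_exp_abs hμ zero_le_one).mono' (by fun_prop)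
    (Eventually.of_forall fun q ↦ ?_)
  rw [Real.norm_eq_abs, Real.abs_exp, one_mul]
  exact Real.exp_le_exp.2 (le_abs_self _)

lemma E.memLp_exp_abs (hμ : 0 < firstEigenvalue g) (u : E g) {c : ℝ} (hc : 0 ≤ c) :
    MemLp (fun q ↦ Real.exp (c * |u.fn q|)) 2 (riemannianVolume g) := by
  have hm := u.measurable_fn
  rw [memLp_two_iff_integrable_sq (by fun_prop)]
  refine (u.integrable_exp_abs hμ (c := 2 * c) (by positivity)).congr
    (Eventually.of_forall fun q ↦ ?_)
  simp only [← Real.exp_nat_mul]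
  congr 1; push_cast; ring

lemma E.memLp_exp (hμ : 0 < firstEigenvalue g) (u : E g) :
    MemLp (fun q ↦ Real.exp (u.fn q)) 2 (riemannianVolume g) := by
  have hm := u.measurable_fn
  refine (u.memLp_exp_abs hμ zero_le_one).mono (by fun_prop) (Eventually.of_forall fun q ↦ ?_)
  rw [Real.norm_eq_abs, Real.norm_eq_abs, Real.abs_exp, Real.abs_exp, one_mul]
  exact Real.exp_le_exp.2 (le_abs_self _)

/-- The convex function `u ↦ log (1 / |M| ∫ e^u)`. -/
def E.potential (u : E g) : ℝ :=
  Real.log (1 / area g * ∫ q, Real.exp (u.fn q) ∂(riemannianVolume g))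

lemma E.integral_exp_neg (u : E g) : ∫ q, Real.exp (-u.fn q) ∂(riemannianVolume g) =
    ∫ q, Real.exp ((-u).fn q) ∂(riemannianVolume g) := by
  refine integral_congr_ae ?_
  filter_upwards [u.fn_neg] with q hq
  rw [hq]

lemma functional_eq (g : Metric M) (l : ℝ × ℝ) (u : E g) :
    functional g l u = 1 / 2 * ‖u‖ ^ 2 - l.1 * u.potential - l.2 * (-u).potential := by
  rw [functional, E.integral_exp_neg, ← E.norm_sq]
  rfl

/-- The norm obtained by separation is definitionally the Dirichlet seminorm, so the abstract
theorem applies to the concrete functional without a change of topology. -/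
lemma functional_eq_energy (hμ : 0 < firstEigenvalue g) (l : ℝ × ℝ) :
    functional g l = @energy (E g) (E.normedAddCommGroup hμ) E.potential
      (fun u ↦ E.potential (-u)) l := by
  ext u
  rw [functional_eq]
  rfl

lemma mountainPassLevel_eq_energyLevel (hμ : 0 < firstEigenvalue g) (l : ℝ × ℝ) (b : E g) :
    mountainPassLevel g l b = @energyLevel (E g) (E.normedAddCommGroup hμ) E.potential
      (fun u ↦ E.potential (-u)) l b := by
  rw [mountainPassLevel, functional_eq_energy hμ]
  rfl

variable [IsFiniteMeasure (riemannianVolume g)]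

/-- Integrate e^x ≥ 1 + x; the linear term vanishes because the mean is zero. -/
lemma E.area_le_integral_exp (hμ : 0 < firstEigenvalue g) (u : E g) :
    area g ≤ ∫ q, Real.exp (u.fn q) ∂(riemannianVolume g) := by
  have h1 : ∫ q, (u.fn q + 1) ∂(riemannianVolume g) = area g := by
    rw [integral_add u.integrable_fn (integrable_const _), u.integral_fn]
    simp [area]
  rw [← h1]
  exact integral_mono (u.integrable_fn.add (integrable_const _)) (u.integrable_exp hμ)
    fun q ↦ Real.add_one_le_exp _

lemma E.potential_nonneg (hμ : 0 < firstEigenvalue g) (ha : 0 < area g) (u : E g) :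
    0 ≤ u.potential := by
  refine Real.log_nonneg ?_
  rw [one_div_mul_eq_div, one_le_div ha]
  exact u.area_le_integral_exp hμ

lemma E.potential_zero (ha : 0 < area g) : (0 : E g).potential = 0 := by
  have : ∫ q, Real.exp ((0 : E g).fn q) ∂(riemannianVolume g) = area g := by
    rw [integral_congr_ae (g := fun _ ↦ 1)]
    · simp [area]
    · filter_upwards [E.fn_zero (g := g)] with q hq
      simp [hq]
  rw [E.potential, this, one_div_mul_cancel ha.ne', Real.log_one]

/-- From log s ≤ s - 1; subtracting `u`, which has mean zero, leaves an integrand that is quadratic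
at the origin. -/
lemma E.potential_le (hμ : 0 < firstEigenvalue g) (ha : 0 < area g) (u : E g) :
    u.potential ≤ (area g)⁻¹ *
      ∫ q, (Real.exp (u.fn q) - 1 - u.fn q) ∂(riemannianVolume g) := by
  have h0 := ha.trans_le (u.area_le_integral_exp hμ)
  refine (Real.log_le_sub_one_of_pos (by positivity)).trans (le_of_eq ?_)
  rw [integral_sub (f := fun q ↦ Real.exp (u.fn q) - 1)
    ((u.integrable_exp hμ).sub (integrable_const _)) u.integrable_fn,
    integral_sub (u.integrable_exp hμ) (integrable_const _), u.integral_fn]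
  have : ∫ _ : M, (1 : ℝ) ∂(riemannianVolume g) = area g := by simp [area]
  rw [this]
  field_simp
  ring

/-- The density `e^u / ∫ e^u`, as an element of `L²`. -/
def E.gibbs (hμ : 0 < firstEigenvalue g) (u : E g) : Lp ℝ 2 (riemannianVolume g) :=
  (∫ q, Real.exp (u.fn q) ∂(riemannianVolume g))⁻¹ • (u.memLp_exp hμ).toLp _

lemma E.inner_gibbs (hμ : 0 < firstEigenvalue g) (u v : E g) :
    ⟪u.gibbs hμ, v.toLp⟫ = (∫ q, Real.exp (u.fn q) ∂(riemannianVolume g))⁻¹ *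
      ∫ q, Real.exp (u.fn q) * v.fn q ∂(riemannianVolume g) := by
  rw [E.gibbs, real_inner_smul_left, L2.inner_def]
  congr 1
  refine integral_congr_ae ?_
  filter_upwards [(u.memLp_exp hμ).coeFn_toLp] with q hq
  rw [hq, real_inner_comm]
  rfl

/-- Jensen's inequality for the Gibbs measure of `u`: with m the Gibbs mean of w - u, integrating
e^w ≥ e^m e^u (1 + w - u - m) gives ∫ e^w ≥ e^m ∫ e^u. -/
lemma E.tangent (hμ : 0 < firstEigenvalue g) (ha : 0 < area g) (u w : E g) :
    u.potential + ⟪u.gibbs hμ, (w - u).toLp⟫ ≤ w.potential := by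
  have hu := ha.trans_le (u.area_le_integral_exp hμ)
  have hw := ha.trans_le (w.area_le_integral_exp hμ)
  set m := ⟪u.gibbs hμ, (w - u).toLp⟫ with hm
  rw [E.inner_gibbs] at hm
  rw [E.potential, E.potential, Real.log_mul (by positivity) hu.ne',
    Real.log_mul (by positivity) hw.ne', add_assoc]
  gcongr
  have hint : Integrable (fun q ↦ Real.exp (u.fn q) * (w - u).fn q) (riemannianVolume g) :=
    (u.memLp_exp hμ).integrable_mul (w - u).memLp
  have h1 : ∫ q, Real.exp m * (Real.exp (u.fn q) * (w - u).fn q + (1 - m) * Real.exp (u.fn q))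
      ∂(riemannianVolume g) ≤ ∫ q, Real.exp (w.fn q) ∂(riemannianVolume g) := by
    refine integral_mono_ae ((hint.add ((u.integrable_exp hμ).const_mul _)).const_mul _)
      (w.integrable_exp hμ) ?_
    filter_upwards [E.fn_sub w u] with q hq
    rw [hq]
    have h2 := Real.add_one_le_exp (w.fn q - u.fn q - m)
    have h3 : Real.exp (w.fn q) =
        Real.exp m * (Real.exp (u.fn q) * Real.exp (w.fn q - u.fn q - m)) := by
      rw [← Real.exp_add, ← Real.exp_add]; congr 1; ring
    rw [h3]
    gcongr
    nlinarith [Real.exp_pos (u.fn q)]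
  rw [integral_const_mul, integral_add hint ((u.integrable_exp hμ).const_mul _),
    integral_const_mul] at h1
  have h4 : ∫ q, Real.exp (u.fn q) * (w - u).fn q ∂(riemannianVolume g) =
      m * ∫ q, Real.exp (u.fn q) ∂(riemannianVolume g) := by
    rw [hm]; field_simp
  rw [h4, ← add_mul, add_sub_cancel, one_mul] at h1
  rw [← Real.log_exp m, ← Real.log_mul hu.ne' (Real.exp_pos _).ne', mul_comm]
  exact Real.log_le_log (by positivity) (by simpa using h1)

lemma E.exists_exp_diff_le (hμ : 0 < firstEigenvalue g) (R : ℝ) : ∃ C : ℝ, ∀ u w : E g,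
    ‖u‖ ≤ R → ‖w‖ ≤ R →
    ‖(u.memLp_exp hμ).toLp _ - (w.memLp_exp hμ).toLp _‖ ^ 2 ≤ C * ‖(u - w).toLp‖ := by
  obtain ⟨C, hC, h⟩ := E.exists_integral_exp_le (g := g) hμ R (c := 4) (by norm_num)
  refine ⟨√(16 * C), fun u w hu hw ↦ ?_⟩
  have h1 : ‖(u.memLp_exp hμ).toLp _ - (w.memLp_exp hμ).toLp _‖ ^ 2 =
      ∫ q, (Real.exp (u.fn q) - Real.exp (w.fn q)) ^ 2 ∂(riemannianVolume g) := by
    rw [← real_inner_self_eq_norm_sq, ← MemLp.toLp_sub, L2.inner_def]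
    refine integral_congr_ae ?_
    filter_upwards [((u.memLp_exp hμ).sub (w.memLp_exp hμ)).coeFn_toLp] with q hq
    simp [hq, sq]
  have hF : MemLp (fun q ↦ 2 * (Real.exp (2 * |u.fn q|) + Real.exp (2 * |w.fn q|))) 2
      (riemannianVolume g) :=
    ((u.memLp_exp_abs hμ zero_le_two).add (w.memLp_exp_abs hμ zero_le_two)).const_mul 2
  have hd : MemLp (fun q ↦ |(u - w).fn q|) 2 (riemannianVolume g) := (u - w).memLp.abs
  have h2 : ∫ q, (Real.exp (u.fn q) - Real.exp (w.fn q)) ^ 2 ∂(riemannianVolume g) ≤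
      ∫ q, |(u - w).fn q| * (2 * (Real.exp (2 * |u.fn q|) + Real.exp (2 * |w.fn q|)))
        ∂(riemannianVolume g) := by
    refine integral_mono_ae ((u.memLp_exp hμ).sub (w.memLp_exp hμ)).integrable_sq
      (hd.integrable_mul hF) ?_
    filter_upwards [E.fn_sub u w] with q hq
    rw [hq]
    exact exp_sub_exp_sq_le _ _
  have h3 : ∫ q, (2 * (Real.exp (2 * |u.fn q|) + Real.exp (2 * |w.fn q|))) ^ 2
      ∂(riemannianVolume g) ≤ 16 * C := by
    have hi (u : E g) := u.integrable_exp_abs hμ (c := 4) (by norm_num)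
    calc _ ≤ ∫ q, 8 * (Real.exp (4 * |u.fn q|) + Real.exp (4 * |w.fn q|))
          ∂(riemannianVolume g) := by
          refine integral_mono hF.integrable_sq (((hi u).add (hi w)).const_mul 8) fun q ↦ ?_
          have e3 (x : ℝ) : Real.exp (4 * x) = Real.exp (2 * x) ^ 2 := by
            rw [← Real.exp_nat_mul]; congr 1; push_cast; ring
          simp only [e3]
          nlinarith [sq_nonneg (Real.exp (2 * |u.fn q|) - Real.exp (2 * |w.fn q|))]
      _ = 8 * (∫ q, Real.exp (4 * |u.fn q|) ∂(riemannianVolume g) +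
          ∫ q, Real.exp (4 * |w.fn q|) ∂(riemannianVolume g)) := by
          rw [integral_const_mul, integral_add (hi u) (hi w)]
      _ ≤ 16 * C := by linarith [h u hu, h w hw]
  rw [h1]
  refine h2.trans ((integral_mul_le_sqrt hd hF).trans ?_)
  rw [mul_comm]
  have h4 : √(∫ q, |(u - w).fn q| ^ 2 ∂(riemannianVolume g)) = ‖(u - w).toLp‖ := by
    simp only [sq_abs]
    rw [← E.norm_toLp_sq, Real.sqrt_sq (norm_nonneg _)]
  rw [h4]
  gcongr

/-- On a bounded set of E, L² convergence of the functions already gives L² convergence of their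
exponentials, and the normalizing integrals stay above the area. Combined with Rellich this yields
both continuity and compactness of the gradient. -/
lemma E.tendsto_gibbs (hμ : 0 < firstEigenvalue g) (ha : 0 < area g) {u : ℕ → E g} {z : E g}
    {R : ℝ} (hu : ∀ n, ‖u n‖ ≤ R) (h : Tendsto (fun n ↦ ‖(u n - z).toLp‖) atTop (𝓝 0)) :
    Tendsto (fun n ↦ (u n).gibbs hμ) atTop (𝓝 (z.gibbs hμ)) := by
  obtain ⟨C, hC⟩ := E.exists_exp_diff_le (g := g) hμ (max R ‖z‖)
  have h1 : Tendsto (fun n ↦ ((u n).memLp_exp hμ).toLp _) atTop (𝓝 ((z.memLp_exp hμ).toLp _)) := by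
    rw [tendsto_iff_norm_sub_tendsto_zero]
    have h2 : Tendsto (fun n ↦ ‖((u n).memLp_exp hμ).toLp _ - (z.memLp_exp hμ).toLp _‖ ^ 2)
        atTop (𝓝 0) := by
      refine squeeze_zero (fun n ↦ sq_nonneg _)
        (fun n ↦ hC (u n) z ((hu n).trans (le_max_left _ _)) (le_max_right _ _)) ?_
      simpa using h.const_mul C
    have h3 := (Real.continuous_sqrt.tendsto _).comp h2
    simpa [Function.comp_def, Real.sqrt_sq] using h3
  have hone : MemLp (fun _ : M ↦ (1 : ℝ)) 2 (riemannianVolume g) := memLp_const 1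
  have hZ (u : E g) : ∫ q, Real.exp (u.fn q) ∂(riemannianVolume g) =
      ⟪hone.toLp _, (u.memLp_exp hμ).toLp _⟫ := by
    rw [L2.inner_def]
    refine integral_congr_ae ?_
    filter_upwards [(u.memLp_exp hμ).coeFn_toLp, hone.coeFn_toLp] with q hq hq'
    rw [hq, hq']
    simp
  have h4 : Tendsto (fun n ↦ ∫ q, Real.exp ((u n).fn q) ∂(riemannianVolume g)) atTop
      (𝓝 (∫ q, Real.exp (z.fn q) ∂(riemannianVolume g))) := by
    simp only [hZ]
    exact tendsto_const_nhds.inner h1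
  exact (h4.inv₀ (ha.trans_le (z.area_le_integral_exp hμ)).ne').smul h1

/-- The gradient is the adjoint of the inclusion of E in L² applied to the Gibbs density. -/
lemma E.exists_isCompactPotential (hμ : 0 < firstEigenvalue g) (ha : 0 < area g) :
    ∃ p : E g → E g, @IsCompactPotential (E g) (E.normedAddCommGroup hμ) _ E.potential p := by
  let _ := E.normedAddCommGroup hμ
  have _ := E.completeSpace hμ
  have hT (u : E g) : E.toLpCLM hμ u = u.toLp := rfl
  refine ⟨fun u ↦ ContinuousLinearMap.adjoint (E.toLpCLM hμ) (u.gibbs hμ), ?_⟩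
  refine ⟨E.potential_nonneg hμ ha, E.potential_zero ha, ?_, fun u w ↦ ?_, fun u R hu ↦ ?_⟩
  · refine (ContinuousLinearMap.continuous _).comp (continuous_iff_seqContinuous.2 fun u z h ↦ ?_)
    obtain ⟨R, hR⟩ := (Metric.isBounded_range_of_tendsto u h).exists_norm_le
    refine E.tendsto_gibbs hμ ha (fun n ↦ hR _ (mem_range_self n)) ?_
    have := (((E.toLpCLM hμ).continuous.tendsto _).comp (h.sub_const z)).norm
    rwa [sub_self, map_zero, norm_zero] at this
  · rw [ContinuousLinearMap.adjoint_inner_left, hT]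
    exact E.tangent hμ ha u w
  · obtain ⟨φ, hφ, z, hz⟩ := E.rellich hμ u R hu
    exact ⟨φ, hφ, _, ((ContinuousLinearMap.continuous _).tendsto _).comp
      (E.tendsto_gibbs hμ ha (fun n ↦ hu _) hz)⟩

lemma exp_sub_one_sub_le (x : ℝ) :
    Real.exp x - 1 - x ≤ 1 / 2 * x ^ 2 + |x| ^ 3 * Real.exp |x| := by
  have h := Complex.norm_exp_sub_sum_le_norm_mul_exp (x : ℂ) 3
  have e : Complex.exp x - ∑ m ∈ Finset.range 3, (x : ℂ) ^ m / (m.factorial : ℂ) =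
      ((Real.exp x - 1 - x - 1 / 2 * x ^ 2 : ℝ) : ℂ) := by
    simp [Finset.sum_range_succ, Nat.factorial]
    ring
  rw [e, Complex.norm_real, Complex.norm_real, Real.norm_eq_abs, Real.norm_eq_abs] at h
  linarith [le_abs_self (Real.exp x - 1 - x - 1 / 2 * x ^ 2)]

lemma E.memLp_cube (hμ : 0 < firstEigenvalue g) (u : E g) :
    MemLp (fun q ↦ |u.fn q| ^ 3) 2 (riemannianVolume g) := by
  have hm := u.measurable_fn
  refine ((u.memLp_exp_abs hμ zero_le_one).const_mul 6).mono (by fun_prop)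
    (Eventually.of_forall fun q ↦ ?_)
  have h := Real.pow_div_factorial_le_exp _ (abs_nonneg (u.fn q)) 3
  rw [Real.norm_of_nonneg (by positivity), Real.norm_of_nonneg (by positivity), one_mul]
  norm_num [Nat.factorial] at h
  linarith

/-- Both sides are homogeneous of degree 6, so it suffices to treat the unit sphere, where x⁶ ≤ 6!
e^{|x|} and the Trudinger bound apply; 720 is 6!. -/
lemma E.exists_integral_pow_le (hμ : 0 < firstEigenvalue g) : ∃ C : ℝ, 0 ≤ C ∧ ∀ u : E g,
    ∫ q, (|u.fn q| ^ 3) ^ 2 ∂(riemannianVolume g) ≤ C * ‖u‖ ^ 6 := by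
  obtain ⟨C, hC, h⟩ := E.exists_integral_exp_le (g := g) hμ 1 (c := 1) zero_le_one
  refine ⟨720 * C, by positivity, fun u ↦ ?_⟩
  by_cases hu : ‖u‖ = 0
  · obtain rfl := E.eq_zero_of_norm hμ u hu
    rw [integral_congr_ae (g := fun _ ↦ 0)]
    · simp
    · filter_upwards [E.fn_zero (g := g)] with q hq
      simp [hq]
  have hpos : 0 < ‖u‖ := lt_of_le_of_ne (norm_nonneg u) (Ne.symm hu)
  set v : E g := ‖u‖⁻¹ • u with hv
  have hv1 : ‖v‖ ≤ 1 := by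
    rw [hv, norm_smul, norm_inv, norm_norm, inv_mul_cancel₀ hu]
  have h1 : ∫ q, (|u.fn q| ^ 3) ^ 2 ∂(riemannianVolume g) =
      ‖u‖ ^ 6 * ∫ q, (|v.fn q| ^ 3) ^ 2 ∂(riemannianVolume g) := by
    rw [← integral_const_mul]
    refine integral_congr_ae ?_
    filter_upwards [E.fn_smul ‖u‖⁻¹ u] with q hq
    rw [hq, abs_mul, abs_inv, abs_norm]
    field_simp
  have h2 : ∫ q, (|v.fn q| ^ 3) ^ 2 ∂(riemannianVolume g) ≤ 720 * C := by
    calc _ ≤ ∫ q, 720 * Real.exp (1 * |v.fn q|) ∂(riemannianVolume g) := by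
          refine integral_mono (v.memLp_cube hμ).integrable_sq
            ((v.integrable_exp_abs hμ zero_le_one).const_mul 720) fun q ↦ ?_
          have h := Real.pow_div_factorial_le_exp _ (abs_nonneg (v.fn q)) 6
          norm_num [Nat.factorial] at h
          simp only [← pow_mul, one_mul]
          norm_num
          linarith
      _ ≤ 720 * C := by
          rw [integral_const_mul]
          gcongr
          exact h v hv1
  rw [h1, mul_comm]
  gcongr

/-- The quadratic part keeps the sharp Poincaré constant, as the threshold μ₁|M| requires; the
Taylor remainder is of third order by Cauchy–Schwarz and the exponential bounds. -/
lemma E.exists_potential_le_cube (hμ : 0 < firstEigenvalue g) (ha : 0 < area g) :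
    ∃ K : ℝ, 0 ≤ K ∧ ∀ u : E g, ‖u‖ ≤ 1 →
      u.potential ≤ (area g)⁻¹ * (1 / 2 * ((firstEigenvalue g)⁻¹ * ‖u‖ ^ 2) + K * ‖u‖ ^ 3) := by
  obtain ⟨C, hC, h⟩ := E.exists_integral_pow_le (g := g) hμ
  obtain ⟨C', hC', h'⟩ := E.exists_integral_exp_le (g := g) hμ 1 (c := 2) zero_le_two
  refine ⟨√C * √C', by positivity, fun u hu ↦ (u.potential_le hμ ha).trans ?_⟩
  have he := u.memLp_exp_abs hμ zero_le_one
  have hint : Integrable (fun q ↦ |u.fn q| ^ 3 * Real.exp (1 * |u.fn q|)) (riemannianVolume g) :=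
    (u.memLp_cube hμ).integrable_mul he
  have h1 : ∫ q, (Real.exp (u.fn q) - 1 - u.fn q) ∂(riemannianVolume g) ≤
      1 / 2 * (∫ q, u.fn q ^ 2 ∂(riemannianVolume g)) +
        ∫ q, |u.fn q| ^ 3 * Real.exp (1 * |u.fn q|) ∂(riemannianVolume g) := by
    rw [← integral_const_mul, ← integral_add (u.integrable_sq.const_mul _) hint]
    refine integral_mono (((u.integrable_exp hμ).sub (integrable_const _)).sub u.integrable_fn)
      ((u.integrable_sq.const_mul _).add hint) fun q ↦ ?_
    simp only [one_mul]
    exact exp_sub_one_sub_le _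
  have h2 : ∫ q, u.fn q ^ 2 ∂(riemannianVolume g) ≤ (firstEigenvalue g)⁻¹ * ‖u‖ ^ 2 := by
    rw [inv_mul_eq_div, le_div_iff₀ hμ, mul_comm]
    exact u.poincare
  have h3 : √(∫ q, (|u.fn q| ^ 3) ^ 2 ∂(riemannianVolume g)) ≤ √C * ‖u‖ ^ 3 := by
    refine (Real.sqrt_le_sqrt (h u)).trans (le_of_eq ?_)
    rw [Real.sqrt_mul hC, show ‖u‖ ^ 6 = (‖u‖ ^ 3) ^ 2 by ring, Real.sqrt_sq (by positivity)]
  have h4 : √(∫ q, Real.exp (1 * |u.fn q|) ^ 2 ∂(riemannianVolume g)) ≤ √C' := by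
    refine Real.sqrt_le_sqrt (le_trans (le_of_eq ?_) (h' u hu))
    refine integral_congr_ae (Eventually.of_forall fun q ↦ ?_)
    simp only [← Real.exp_nat_mul]
    congr 1; push_cast; ring
  have h5 := integral_mul_le_sqrt (u.memLp_cube hμ) he
  gcongr
  calc _ ≤ _ := h1
    _ ≤ _ := by
        gcongr
        refine h5.trans ((mul_le_mul h3 h4 (Real.sqrt_nonneg _) (by positivity)).trans
          (le_of_eq (by ring)))

/-- The origin is a nondegenerate local minimum for subcritical parameters. -/
lemma E.exists_local_min (hμ : 0 < firstEigenvalue g) (ha : 0 < area g) {l : ℝ × ℝ}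
    (h1 : 0 ≤ l.1) (h2 : 0 ≤ l.2) (hl : l.1 + l.2 < firstEigenvalue g * area g) :
    ∃ ρ > 0, ∃ δ > 0, ∀ u : E g, ‖u‖ ≤ ρ → δ * ‖u‖ ^ 2 ≤ functional g l u := by
  obtain ⟨K, hK, h⟩ := E.exists_potential_le_cube (g := g) hμ ha
  set s := l.1 + l.2 with hs
  set μ := firstEigenvalue g
  set a := area g
  -- η is the spectral gap 1 - (l₁ + l₂)/(μ₁|M|). The quadratic part of the functional is at least
  -- (η/2)‖u‖².
  have hη : 0 < 1 - s * (a⁻¹ * μ⁻¹) := by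
    have : s * (a⁻¹ * μ⁻¹) < 1 := by
      rw [← mul_inv, ← div_eq_mul_inv, div_lt_one (by positivity), mul_comm a]; exact hl
    linarith
  set η := 1 - s * (a⁻¹ * μ⁻¹) with hη'
  have hs0 : 0 ≤ s := by positivity
  set T := s * (a⁻¹ * K) with hT
  have hT0 : 0 ≤ T := by positivity
  -- On this ball the cubic term costs at most (η/4)‖u‖². Using T + 1 keeps the quotient meaningful
  -- when T = 0.
  refine ⟨min 1 (η / (4 * (T + 1))), by positivity, η / 4, by positivity, fun u hu ↦ ?_⟩
  have hu1 : ‖u‖ ≤ 1 := hu.trans (min_le_left _ _)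
  have hu2 : (T + 1) * ‖u‖ ≤ η / 4 := by
    have := hu.trans (min_le_right _ _)
    rw [le_div_iff₀ (by positivity)] at this
    linarith
  have hb := h u hu1
  have hb' := h (-u) (by rwa [norm_neg])
  rw [norm_neg] at hb'
  rw [functional_eq]
  set B := a⁻¹ * (1 / 2 * (μ⁻¹ * ‖u‖ ^ 2) + K * ‖u‖ ^ 3) with hB
  have e1 := mul_le_mul_of_nonneg_left hb h1
  have e2 := mul_le_mul_of_nonneg_left hb' h2
  have e3 : l.1 * B + l.2 * B = 1 / 2 * (1 - η) * ‖u‖ ^ 2 + T * ‖u‖ * ‖u‖ ^ 2 := by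
    rw [← add_mul, hη', hT, hB]; ring
  have e4 : T * ‖u‖ * ‖u‖ ^ 2 ≤ η / 4 * ‖u‖ ^ 2 := by
    gcongr
    linarith [norm_nonneg u, add_mul T 1 ‖u‖]
  linarith

/-- A lower bound on the unit ball means that a sufficiently negative value is attained only at norm
above 1. -/
lemma E.exists_functional_ge (hμ : 0 < firstEigenvalue g) (ha : 0 < area g) {l : ℝ × ℝ}
    (h1 : 0 ≤ l.1) (h2 : 0 ≤ l.2) : ∃ C : ℝ, ∀ u : E g, ‖u‖ ≤ 1 → -C ≤ functional g l u := by
  obtain ⟨K, hK, h⟩ := E.exists_potential_le_cube (g := g) hμ ha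
  set B := (area g)⁻¹ * (1 / 2 * ((firstEigenvalue g)⁻¹ * 1 ^ 2) + K * 1 ^ 3) with hB
  have hP (u : E g) (hu : ‖u‖ ≤ 1) : u.potential ≤ B := by
    refine (h u hu).trans ?_
    rw [hB]
    gcongr
  refine ⟨l.1 * B + l.2 * B, fun u hu ↦ ?_⟩
  have e1 := mul_le_mul_of_nonneg_left (hP u hu) h1
  have e2 := mul_le_mul_of_nonneg_left (hP (-u) (by rwa [norm_neg])) h2
  rw [functional_eq]
  nlinarith [sq_nonneg ‖u‖]

end ExpPotential

/-! ### C¹ functions as elements of E -/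

section SmoothFunctions

/-- The products with a test function vanish off Ω, so both integrals become integrals over the
plane, where integration by parts has no boundary term. -/
lemma hasWeakPartialDeriv_of_contDiffOn {Ω : Set Plane} (hΩ : IsOpen Ω) {f : Plane → ℝ}
    (hf : ContDiffOn ℝ 1 f Ω) (i : Fin 2) :
    HasWeakPartialDeriv Ω i f fun y ↦ fderiv ℝ f y (stdVec i) := by
  have hc : ContinuousOn (fun y ↦ fderiv ℝ f y (stdVec i)) Ω :=
    (hf.continuousOn_fderiv_of_isOpen hΩ le_rfl).clm_apply continuousOn_const
  have h1 := hf.continuousOn.locallyIntegrableOn (μ := volume) hΩ.measurableSet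
  have h2 := hc.locallyIntegrableOn (μ := volume) hΩ.measurableSet
  refine ⟨h1, h2, fun ψ hψ hψc hψt ↦ ?_⟩
  have hd : Continuous fun y ↦ fderiv ℝ ψ y (stdVec i) :=
    (hψ.continuous_fderiv (by simp)).clm_apply continuous_const
  have hdc : HasCompactSupport fun y ↦ fderiv ℝ ψ y (stdVec i) := hψc.fderiv_apply ℝ _
  have hdt : tsupport (fun y ↦ fderiv ℝ ψ y (stdVec i)) ⊆ Ω :=
    (tsupport_fderiv_apply_subset ℝ _).trans hψt
  have hzero {h ψ : Plane → ℝ} (ht : tsupport ψ ⊆ Ω) (y : Plane) (hy : y ∉ Ω) : h y * ψ y = 0 := by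
    rw [image_eq_zero_of_notMem_tsupport fun hh ↦ hy (ht hh), mul_zero]
  have hI {h ψ : Plane → ℝ} (hh : LocallyIntegrableOn h Ω) (hψ : Continuous ψ)
      (hc : HasCompactSupport ψ) (ht : tsupport ψ ⊆ Ω) : Integrable fun y ↦ h y * ψ y := by
    rw [← integrableOn_iff_integrable_of_support_subset (s := Ω)]
    · exact integrable_mul_test hh hψ hc ht
    · intro y hy
      by_contra hyΩ
      exact hy (hzero ht y hyΩ)
  rw [setIntegral_eq_integral_of_forall_compl_eq_zero (hzero hdt),
    setIntegral_eq_integral_of_forall_compl_eq_zero (hzero hψt)]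
  exact integral_mul_fderiv_eq_neg_fderiv_mul_of_integrable (hI h2 hψ.continuous hψc hψt)
    (hI h1 hd hdc hdt) (hI h1 hψ.continuous hψc hψt)
    (fun y hy ↦ (hf.differentiableOn one_ne_zero).differentiableAt (hΩ.mem_nhds (hψt hy)))
    fun y _ ↦ hψ.differentiable (by simp) y

lemma exists_riesz (b : Plane →L[ℝ] Plane →L[ℝ] ℝ) (hb : ∀ v, v ≠ 0 → 0 < b v v)
    (L : Plane →L[ℝ] ℝ) : ∃ X, ∀ v, b X v = L v := by
  let T : Plane →ₗ[ℝ] Module.Dual ℝ Plane :=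
    (LinearMap.toContinuousLinearMap (𝕜 := ℝ) (E := Plane) (F' := ℝ)).symm.toLinearMap ∘ₗ
      (b : Plane →ₗ[ℝ] Plane →L[ℝ] ℝ)
  have hT (v w : Plane) : T v w = b v w := rfl
  have hinj : Function.Injective T := by
    rw [injective_iff_map_eq_zero]
    intro v hv
    by_contra hne
    have := hb v hne
    rw [← hT, hv] at this
    simp at this
  have hsurj := (LinearMap.injective_iff_surjective_of_finrank_eq_finrank
    (Subspace.dual_finrank_eq (K := ℝ) (V := Plane)).symm).1 hinj
  obtain ⟨X, hX⟩ := hsurj (L : Plane →ₗ[ℝ] ℝ)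
  exact ⟨X, fun v ↦ by rw [← hT, hX]; rfl⟩

variable {M : Type*} [TopologicalSpace M] [ChartedSpace Plane M] [IsManifold (𝓡 2) ∞ M]
  {g : Metric M}

lemma exists_gradient (g : Metric M) (w : M → ℝ) (p : M) :
    ∃ X : TangentSpace (𝓡 2) p, ∀ v : TangentSpace (𝓡 2) p,
      g.inner p X v = mfderiv (𝓡 2) 𝓘(ℝ, ℝ) w p v :=
  exists_riesz (metricForm g p) (fun v hv ↦ g.pos p v hv) (mfderiv (𝓡 2) 𝓘(ℝ, ℝ) w p)

/-- The gradient of a differentiable function. -/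
def gradField (g : Metric M) (w : M → ℝ) (p : M) : TangentSpace (𝓡 2) p :=
  Classical.choose (exists_gradient g w p)

lemma inner_gradField (w : M → ℝ) (p : M) (v : TangentSpace (𝓡 2) p) :
    g.inner p (gradField g w p) v = mfderiv (𝓡 2) 𝓘(ℝ, ℝ) w p v :=
  Classical.choose_spec (exists_gradient g w p) v

lemma inner_gradField_chartDeriv {w : M → ℝ} (hw : ContMDiff (𝓡 2) 𝓘(ℝ, ℝ) 1 w) (x : M)
    {y : Plane} (hy : y ∈ (chartAt Plane x).target) (v : Plane) :
    g.inner _ (gradField g w ((chartAt Plane x).symm y)) (chartDeriv x y v) =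
      fderiv ℝ (fun y ↦ w ((chartAt Plane x).symm y)) y v := by
  rw [inner_gradField]
  have h1 := ((hw.mdifferentiable one_ne_zero) ((chartAt Plane x).symm y)).hasMFDerivAt
  have h2 : HasMFDerivAt (𝓡 2) (𝓡 2) (chartAt Plane x).symm y (chartDeriv x y) :=
    (((mdifferentiable_chart (I := 𝓡 2) x).symm).mdifferentiableAt hy).hasMFDerivAt
  have h3 : HasMFDerivAt 𝓘(ℝ, Plane) 𝓘(ℝ, ℝ) (fun y ↦ w ((chartAt Plane x).symm y)) y
      ((mfderiv (𝓡 2) 𝓘(ℝ, ℝ) w ((chartAt Plane x).symm y)).comp (chartDeriv x y)) :=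
    h1.comp y h2
  let L : Plane →L[ℝ] ℝ :=
    (mfderiv (𝓡 2) 𝓘(ℝ, ℝ) w ((chartAt Plane x).symm y)).comp (chartDeriv x y)
  have h4 : HasFDerivAt (fun y ↦ w ((chartAt Plane x).symm y)) L y :=
    hasMFDerivAt_iff_hasFDerivAt.1 h3
  have h5 : fderiv ℝ (fun y ↦ w ((chartAt Plane x).symm y)) y v = L v := by rw [h4.fderiv]
  exact h5.symm

lemma contDiffOn_comp_chart_symm {w : M → ℝ} (hw : ContMDiff (𝓡 2) 𝓘(ℝ, ℝ) 1 w) (x : M) :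
    ContDiffOn ℝ 1 (fun y ↦ w ((chartAt Plane x).symm y)) (chartAt Plane x).target := by
  rw [← contMDiffOn_iff_contDiffOn]
  have h1 : ContMDiffOn (𝓡 2) (𝓡 2) ∞ (chartAt Plane x).symm (chartAt Plane x).target :=
    contMDiffOn_chart_symm
  have h2 : ContMDiffOn (𝓡 2) (𝓡 2) 1 (chartAt Plane x).symm (chartAt Plane x).target :=
    h1.of_le (by norm_num)
  exact hw.comp_contMDiffOn h2

lemma component_gradField {w : M → ℝ} (hw : ContMDiff (𝓡 2) 𝓘(ℝ, ℝ) 1 w) (x : M) (i : Fin 2)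
    {y : Plane} (hy : y ∈ (chartAt Plane x).target) :
    component g (gradField g w) x i y =
      fderiv ℝ (fun y ↦ w ((chartAt Plane x).symm y)) y (stdVec i) :=
  inner_gradField_chartDeriv hw x hy _

lemma continuousOn_component_gradField {w : M → ℝ} (hw : ContMDiff (𝓡 2) 𝓘(ℝ, ℝ) 1 w) (x : M)
    (i : Fin 2) :
    ContinuousOn (component g (gradField g w) x i) (chartAt Plane x).target :=
  (((contDiffOn_comp_chart_symm hw x).continuousOn_fderiv_of_isOpen (chartAt Plane x).open_target
    le_rfl).clm_apply continuousOn_const).congr fun _ hy ↦ component_gradField hw x i hy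

variable [CompactSpace M] [MeasurableSpace M] [BorelSpace M]

lemma isBorelField_gradField {w : M → ℝ} (hw : ContMDiff (𝓡 2) 𝓘(ℝ, ℝ) 1 w) :
    IsBorelField g (gradField g w) := fun x i ↦
  (continuousOn_iff_continuous_domRestrict.1 (continuousOn_component_gradField hw x i)).measurable

lemma measurable_gradField_sq {w : M → ℝ} (hw : ContMDiff (𝓡 2) 𝓘(ℝ, ℝ) 1 w) :
    Measurable fun p ↦ g.inner p (gradField g w p) (gradField g w p) :=
  measurable_inner g (isBorelField_gradField hw) (isBorelField_gradField hw)

lemma isWeakGradient_gradField {w : M → ℝ} (hw : ContMDiff (𝓡 2) 𝓘(ℝ, ℝ) 1 w)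
    (hfin : fieldEnergy g (gradField g w) ≠ ⊤) : IsWeakGradient g w (gradField g w) where
  measurable := isBorelField_gradField hw
  weak x i := by
    have h := hasWeakPartialDeriv_of_contDiffOn (chartAt Plane x).open_target
      (contDiffOn_comp_chart_symm hw x) i
    have he : EqOn (component g (gradField g w) x i)
        (fun y ↦ fderiv ℝ (fun y ↦ w ((chartAt Plane x).symm y)) y (stdVec i))
        (chartAt Plane x).target := fun y hy ↦ component_gradField hw x i hy
    have hm := (chartAt Plane x).open_target.measurableSet
    refine ⟨h.locInt, ?_, fun ψ h1 h2 h3 ↦ ?_⟩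
    · exact (continuousOn_component_gradField hw x i).locallyIntegrableOn hm
    · rw [h.parts ψ h1 h2 h3]
      congr 1
      exact setIntegral_congr_fun hm fun y hy ↦ by simp only [he hy]
  sq_integrable := by
    refine ⟨(measurable_gradField_sq hw).aestronglyMeasurable, ?_⟩
    rw [hasFiniteIntegral_iff_ofReal (Eventually.of_forall fun p ↦ metric_nonneg g p _)]
    exact hfin.lt_top

lemma exists_E_of_contMDiff [IsFiniteMeasure (riemannianVolume g)] {w : M → ℝ}
    (hw : ContMDiff (𝓡 2) 𝓘(ℝ, ℝ) 1 w)
    (hfin : fieldEnergy g (gradField g w) ≠ ⊤) (h0 : ∫ p, w p ∂(riemannianVolume g) = 0) :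
    ∃ u : E g, u.fn =ᵐ[riemannianVolume g] w ∧
      ENNReal.ofReal (‖u‖ ^ 2) = fieldEnergy g (gradField g w) := by
  obtain ⟨C, hC⟩ := isCompact_univ.exists_bound_of_continuousOn hw.continuous.continuousOn
  have hLp : MemLp w 2 (riemannianVolume g) :=
    MemLp.of_bound hw.continuous.measurable.aestronglyMeasurable C
      (Eventually.of_forall fun p ↦ hC p (mem_univ p))
  have hg := isWeakGradient_gradField hw hfin
  have he := hLp.coeFn_toLp
  let u : E g := (⟨hLp.toLp w, ⟨_, hg.congr he.symm⟩,
    (hLp.integrable one_le_two).congr he.symm, by rw [integral_congr_ae he, h0]⟩ :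
      meanZeroSubmodule g)
  have hu : u.fn =ᵐ[riemannianVolume g] w := he
  exact ⟨u, hu, u.ofReal_norm_sq_of_isWeakGradient (hg.congr hu.symm)⟩

end SmoothFunctions

/-! ### Truncated logarithmic bubbles in the plane -/

section Bubble

/-- A concave profile of class `C¹` which rises from `0` at `0` to `1` at `1`, and is constant
afterwards. -/
def profile (s : ℝ) : ℝ := 1 - max (1 - s) 0 ^ 2

/-- The derivative of `profile`. -/
def profileDeriv (s : ℝ) : ℝ := 2 * max (1 - s) 0

lemma hasDerivAt_profile (s : ℝ) : HasDerivAt profile (profileDeriv s) s := by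
  rw [hasDerivAt_iff_isLittleO, Asymptotics.isLittleO_iff]
  intro c hc
  filter_upwards [Metric.ball_mem_nhds s hc] with x hx
  rw [Metric.mem_ball, Real.dist_eq] at hx
  have key : |profile x - profile s - (x - s) * profileDeriv s| ≤ |x - s| * |x - s| := by
    rw [abs_mul_abs_self, abs_le, profile, profile, profileDeriv]
    rcases le_total (1 - x) 0 with h1 | h1 <;> rcases le_total (1 - s) 0 with h2 | h2 <;>
      simp only [h1, h2, max_eq_left, max_eq_right] <;> constructor <;> nlinarith
  rw [smul_eq_mul, Real.norm_eq_abs, Real.norm_eq_abs]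
  exact key.trans (mul_le_mul_of_nonneg_right hx.le (abs_nonneg _))

lemma continuous_profileDeriv : Continuous profileDeriv := by
  unfold profileDeriv; fun_prop

lemma contDiff_profile : ContDiff ℝ 1 profile := by
  rw [contDiff_one_iff_deriv]
  refine ⟨fun s ↦ (hasDerivAt_profile s).differentiableAt, ?_⟩
  rw [show deriv profile = profileDeriv from funext fun s ↦ (hasDerivAt_profile s).deriv]
  exact continuous_profileDeriv

lemma profileDeriv_nonneg (s : ℝ) : 0 ≤ profileDeriv s := by unfold profileDeriv; positivity

lemma profile_le_one (s : ℝ) : profile s ≤ 1 := by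
  have := sq_nonneg (max (1 - s) 0); unfold profile; linarith

lemma profile_of_one_le {s : ℝ} (hs : 1 ≤ s) : profile s = 1 := by
  simp [profile, hs]

lemma profileDeriv_of_one_le {s : ℝ} (hs : 1 ≤ s) : profileDeriv s = 0 := by
  simp [profileDeriv, hs]

lemma profile_zero : profile 0 = 0 := by simp [profile]

/-- Concavity with value 0 at 0. It absorbs one factor of the squared gradient of the bubble. -/
lemma mul_profileDeriv_le {s : ℝ} (hs : 0 ≤ s) : s * profileDeriv s ≤ profile s := by
  unfold profile profileDeriv
  rcases le_total (1 - s) 0 with h | h <;> simp only [h, max_eq_left, max_eq_right] <;> nlinarith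

lemma profile_nonneg {s : ℝ} (hs : 0 ≤ s) : 0 ≤ profile s :=
  (mul_nonneg hs (profileDeriv_nonneg s)).trans (mul_profileDeriv_le hs)

lemma profile_le_two_mul {s : ℝ} (hs : 0 ≤ s) : profile s ≤ 2 * s := by
  unfold profile
  rcases le_total (1 - s) 0 with h | h <;> simp only [h, max_eq_left, max_eq_right] <;> nlinarith

/-- The truncated logarithmic bubble of scale `ε`, supported in `{|z|² ≤ δ}`. -/
def bubble (ε δ : ℝ) (z : Plane) : ℝ :=
  2 * (Real.log (ε + 1) - Real.log (ε + profile (‖z‖ ^ 2 / δ)))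

/-- An upper bound for the energy density of `bubble`. -/
def bubbleDensity (ε δ r : ℝ) : ℝ :=
  16 * (profileDeriv (r ^ 2 / δ) / (δ * (ε + profile (r ^ 2 / δ))))

variable {ε δ : ℝ}

lemma profile_arg_pos (hε : 0 < ε) (hδ : 0 < δ) (r : ℝ) : 0 < ε + profile (r ^ 2 / δ) := by
  have := profile_nonneg (s := r ^ 2 / δ) (by positivity); positivity

lemma contDiff_bubble (hε : 0 < ε) (hδ : 0 < δ) : ContDiff ℝ 1 (bubble ε δ) := by
  unfold bubble
  refine contDiff_const.mul (contDiff_const.sub (ContDiff.log ?_ fun z ↦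
    (profile_arg_pos hε hδ _).ne'))
  exact contDiff_const.add (contDiff_profile.comp ((contDiff_norm_sq ℝ).div_const δ))

lemma bubble_eq_zero (hδ : 0 < δ) {z : Plane} (hz : δ ≤ ‖z‖ ^ 2) : bubble ε δ z = 0 := by
  rw [bubble, profile_of_one_le ((one_le_div hδ).2 hz), sub_self, mul_zero]

lemma bubble_nonneg (hε : 0 < ε) (hδ : 0 < δ) (z : Plane) : 0 ≤ bubble ε δ z := by
  have := Real.log_le_log (profile_arg_pos hε hδ ‖z‖)
    (add_le_add_right (profile_le_one (‖z‖ ^ 2 / δ)) ε)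
  unfold bubble; linarith

lemma bubble_le (hε : 0 < ε) (hδ : 0 < δ) (z : Plane) :
    bubble ε δ z ≤ 2 * (Real.log (ε + 1) - Real.log ε) := by
  have := Real.log_le_log hε (le_add_of_nonneg_right (a := ε)
    (profile_nonneg (s := ‖z‖ ^ 2 / δ) (by positivity)))
  unfold bubble; linarith

/-- In this disc the profile is at most 2ε, so the denominator ε + profile is at most 3ε, while the
numerator exceeds 1. -/
lemma le_exp_bubble (hε : 0 < ε) (hδ : 0 < δ) {z : Plane} (hz : ‖z‖ ^ 2 ≤ ε * δ) :
    (1 / (3 * ε)) ^ 2 ≤ Real.exp (bubble ε δ z) := by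
  have h1 := profile_arg_pos hε hδ ‖z‖
  have h2 : profile (‖z‖ ^ 2 / δ) ≤ 2 * ε :=
    (profile_le_two_mul (by positivity)).trans (by gcongr; rwa [div_le_iff₀ hδ])
  rw [bubble, ← Real.log_div (by positivity) h1.ne', two_mul, Real.exp_add,
    Real.exp_log (by positivity), ← sq]
  refine pow_le_pow_left₀ (by positivity) (div_le_div₀ (by positivity) (by linarith) h1
    (by linarith)) 2

lemma fderiv_bubble_sq_le (hε : 0 < ε) (hδ : 0 < δ) (z v : Plane) :
    (fderiv ℝ (bubble ε δ) z v) ^ 2 ≤ bubbleDensity ε δ ‖z‖ * ‖v‖ ^ 2 := by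
  have h1 := profile_arg_pos hε hδ ‖z‖
  set σ := ‖z‖ ^ 2 / δ with hσ
  have hσ0 : 0 ≤ σ := by positivity
  have hz : ‖z‖ ^ 2 = δ * σ := by rw [hσ]; field_simp
  have hd1 : HasFDerivAt (fun z : Plane ↦ ‖z‖ ^ 2 / δ) (δ⁻¹ • (2 • innerSL ℝ z)) z := by
    have := (hasStrictFDerivAt_norm_sq (F := Plane) z).hasFDerivAt.mul_const δ⁻¹
    simpa only [div_eq_mul_inv] using this
  have hd2 : HasDerivAt (fun s ↦ 2 * (Real.log (ε + 1) - Real.log (ε + profile s)))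
      (2 * (0 - profileDeriv σ / (ε + profile σ))) σ :=
    ((hasDerivAt_const _ _).sub
      (((hasDerivAt_profile σ).const_add ε).log h1.ne')).const_mul 2
  have hd := (hd2.comp_hasFDerivAt z hd1).fderiv
  have e : fderiv ℝ (bubble ε δ) z v =
      2 * (0 - profileDeriv σ / (ε + profile σ)) * (δ⁻¹ * (2 * ⟪z, v⟫)) := by
    have := congrArg (fun L : Plane →L[ℝ] ℝ ↦ L v) hd
    simp only [smul_apply, innerSL_apply_apply, smul_eq_mul, nsmul_eq_mul, Nat.cast_ofNat] at this
    exact this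
  have hcs : ⟪z, v⟫ ^ 2 ≤ δ * σ * ‖v‖ ^ 2 := by
    rw [← hz, ← mul_pow, ← sq_abs]
    exact pow_le_pow_left₀ (abs_nonneg _) (abs_real_inner_le_norm z v) 2
  have hp := profileDeriv_nonneg σ
  have hm := mul_profileDeriv_le hσ0
  -- Discarding this factor leaves a density that is an exact logarithmic derivative in polar
  -- coordinates.
  have hmul : σ * profileDeriv σ / (ε + profile σ) ≤ 1 := by
    rw [div_le_one h1]; linarith
  rw [e, bubbleDensity, ← hσ]
  calc (2 * (0 - profileDeriv σ / (ε + profile σ)) * (δ⁻¹ * (2 * ⟪z, v⟫))) ^ 2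
      = 16 * (profileDeriv σ / (ε + profile σ)) ^ 2 * (δ⁻¹) ^ 2 * ⟪z, v⟫ ^ 2 := by ring
    _ ≤ 16 * (profileDeriv σ / (ε + profile σ)) ^ 2 * (δ⁻¹) ^ 2 * (δ * σ * ‖v‖ ^ 2) := by gcongr
    _ = 16 * (profileDeriv σ / (δ * (ε + profile σ))) * ‖v‖ ^ 2 *
        (σ * profileDeriv σ / (ε + profile σ)) := by field_simp
    _ ≤ 16 * (profileDeriv σ / (δ * (ε + profile σ))) * ‖v‖ ^ 2 * 1 := by gcongr
    _ = _ := mul_one _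

lemma bubbleDensity_nonneg (hε : 0 < ε) (hδ : 0 < δ) (r : ℝ) : 0 ≤ bubbleDensity ε δ r := by
  have := profile_arg_pos hε hδ r
  have := profileDeriv_nonneg (r ^ 2 / δ)
  unfold bubbleDensity; positivity

lemma bubbleDensity_eq_zero (hδ : 0 < δ) {r : ℝ} (hr : δ ≤ r ^ 2) : bubbleDensity ε δ r = 0 := by
  rw [bubbleDensity, profileDeriv_of_one_le ((one_le_div hδ).2 hr)]; simp

lemma measurable_bubbleDensity : Measurable (bubbleDensity ε δ) := by
  have h1 := continuous_profileDeriv.measurable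
  have h2 := contDiff_profile.continuous.measurable
  unfold bubbleDensity
  fun_prop

/-- In polar coordinates r times the density is the derivative of 8 log(ε + profile(r²/δ)), and the
angle contributes 2π. The coefficient 16π, halved in the functional, is the source of the threshold
8π. -/
lemma lintegral_bubbleDensity (hε : 0 < ε) (hδ : 0 < δ) :
    ∫⁻ z : Plane, ENNReal.ofReal (bubbleDensity ε δ ‖z‖) =
      ENNReal.ofReal (16 * Real.pi * (Real.log (ε + 1) - Real.log ε)) := by
  have hderiv (r : ℝ) (_ : r ∈ Ici (0 : ℝ)) :
      HasDerivAt (fun r ↦ 8 * Real.log (ε + profile (r ^ 2 / δ))) (r * bubbleDensity ε δ r) r := by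
    have h1 : HasDerivAt (fun r : ℝ ↦ r ^ 2 / δ) (2 * r / δ) r := by
      simpa using (hasDerivAt_pow 2 r).div_const δ
    have h2 := ((((hasDerivAt_profile _).comp r h1).const_add ε).log
      (profile_arg_pos hε hδ r).ne').const_mul 8
    refine h2.congr_deriv ?_
    rw [bubbleDensity]
    have := (profile_arg_pos hε hδ r).ne'
    simp only [Function.comp]
    field_simp
    ring
  have hpos (r : ℝ) (hr : r ∈ Ioi (0 : ℝ)) : 0 ≤ r * bubbleDensity ε δ r :=
    mul_nonneg (le_of_lt hr) (bubbleDensity_nonneg hε hδ r)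
  have hlim : Tendsto (fun r ↦ 8 * Real.log (ε + profile (r ^ 2 / δ))) atTop
      (𝓝 (8 * Real.log (ε + 1))) := by
    refine tendsto_const_nhds.congr' ?_
    filter_upwards [eventually_ge_atTop (max 1 δ)] with r hr
    have h1 := le_of_max_le_left hr
    have h2 := le_of_max_le_right hr
    rw [profile_of_one_le ((one_le_div hδ).2 (by nlinarith))]
  have hint := integrableOn_Ioi_deriv_of_nonneg' hderiv hpos hlim
  have hval := integral_Ioi_of_hasDerivAt_of_nonneg' hderiv hpos hlim
  have hfin : Module.finrank ℝ Plane = 2 := by simp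
  have hI : Integrable fun z : Plane ↦ bubbleDensity ε δ ‖z‖ := by
    rw [integrable_fun_norm_addHaar (volume : Measure Plane) (f := bubbleDensity ε δ), hfin]
    simpa using hint
  rw [← ofReal_integral_eq_lintegral_ofReal hI
    (Eventually.of_forall fun z ↦ bubbleDensity_nonneg hε hδ _),
    integral_fun_norm_addHaar (volume : Measure Plane) (bubbleDensity ε δ), hfin]
  congr 1
  have hball : (volume : Measure Plane).real (Metric.ball 0 1) = Real.pi := by
    rw [Measure.real, EuclideanSpace.volume_ball_fin_two]
    simp [Real.pi_pos.le]
  simp only [hball, Nat.add_one_sub_one, pow_one, smul_eq_mul, nsmul_eq_mul, Nat.cast_ofNat, hval]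
  simp only [ne_eq, OfNat.ofNat_ne_zero, not_false_eq_true, zero_pow, zero_div, profile_zero,
    add_zero]
  ring

lemma volume_norm_sq_le (hδ : 0 ≤ δ) :
    (volume : Measure Plane) {z | ‖z‖ ^ 2 ≤ δ} = ENNReal.ofReal (Real.pi * δ) := by
  have : {z : Plane | ‖z‖ ^ 2 ≤ δ} = Metric.closedBall 0 (√δ) := by
    ext z
    rw [mem_ofPred_eq, mem_closedBall_zero_iff, Real.le_sqrt (norm_nonneg z) hδ]
  rw [this, EuclideanSpace.volume_closedBall_fin_two, ← ENNReal.ofReal_pow (Real.sqrt_nonneg _),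
    Real.sq_sqrt hδ, mul_comm, ENNReal.ofReal_mul Real.pi_pos.le]

end Bubble

/-! ### Nearly Euclidean coordinates at a point -/

section Frozen

lemma lintegral_comp_affine (B : Plane ≃L[ℝ] Plane) (hB : 0 < (B : Plane →L[ℝ] Plane).det)
    (y₀ : Plane) {h : Plane → ℝ≥0∞} (hh : Measurable h) :
    ∫⁻ y, h (B (y - y₀)) = ENNReal.ofReal (B : Plane →L[ℝ] Plane).det⁻¹ * ∫⁻ z, h z := by
  rw [lintegral_sub_right_eq_self (fun y ↦ h (B y)) y₀]
  have h1 := Measure.map_linearMap_addHaar_eq_smul_addHaar (volume : Measure Plane)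
    (f := ((B : Plane →L[ℝ] Plane) : Plane →ₗ[ℝ] Plane)) hB.ne'
  have h2 : ∫⁻ y, h (B y) = ∫⁻ z, h z ∂(Measure.map B volume) :=
    (lintegral_map hh B.continuous.measurable).symm
  rw [h2]
  have h3 : Measure.map B (volume : Measure Plane) =
      ENNReal.ofReal (B : Plane →L[ℝ] Plane).det⁻¹ • volume := by
    rw [← abs_of_pos (inv_pos.2 hB)]
    exact h1
  rw [h3, lintegral_smul_measure, smul_eq_mul]

/-- The Cholesky factorization of a positive definite quadratic form in two variables. -/
lemma exists_cholesky {a b c : ℝ} (ha : 0 < a) (hd : 0 < a * c - b ^ 2) :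
    ∃ B : Plane ≃L[ℝ] Plane, (B : Plane →L[ℝ] Plane).det = √(a * c - b ^ 2) ∧
      ∀ v, ‖B v‖ ^ 2 = a * v 0 ^ 2 + 2 * b * v 0 * v 1 + c * v 1 ^ 2 := by
  let f : Plane →ₗ[ℝ] Plane :=
    { toFun := fun v ↦ !₂[√a * v 0 + b / √a * v 1, √(a * c - b ^ 2) / √a * v 1]
      map_add' := fun v w ↦ by ext i; fin_cases i <;> simp <;> ring
      map_smul' := fun r v ↦ by ext i; fin_cases i <;> simp <;> ring }
  have hsa : 0 < √a := Real.sqrt_pos.2 ha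
  have hf (v : Plane) : f v = !₂[√a * v 0 + b / √a * v 1, √(a * c - b ^ 2) / √a * v 1] := rfl
  have hdet : (LinearMap.toContinuousLinearMap f).det = √(a * c - b ^ 2) := by
    rw [plane_det]
    simp [hf]
    field_simp
  have hdet' : LinearMap.det f = √(a * c - b ^ 2) := hdet
  have hne : LinearMap.det f ≠ 0 := by rw [hdet']; exact (Real.sqrt_pos.2 hd).ne'
  refine ⟨(LinearMap.equivOfDetNeZero f hne).toContinuousLinearEquiv, ?_, fun v ↦ ?_⟩
  · exact hdet
  · have : (LinearMap.equivOfDetNeZero f hne).toContinuousLinearEquiv v = f v := rfl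
    rw [this, hf, EuclideanSpace.real_norm_sq_eq, Fin.sum_univ_two]
    simp only [Matrix.cons_val_zero, Matrix.cons_val_one]
    have e1 : √a ^ 2 = a := Real.sq_sqrt ha.le
    have e2 : √(a * c - b ^ 2) ^ 2 = a * c - b ^ 2 := Real.sq_sqrt hd.le
    have e3 : (√a * v 0 + b / √a * v 1) ^ 2 + (√(a * c - b ^ 2) / √a * v 1) ^ 2 =
        √a ^ 2 * v 0 ^ 2 + 2 * b * v 0 * v 1 +
          (b ^ 2 + √(a * c - b ^ 2) ^ 2) / √a ^ 2 * v 1 ^ 2 := by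
      field_simp
      ring
    rw [e3, e1, e2]
    field_simp
    ring

variable {M : Type*} [TopologicalSpace M] [ChartedSpace Plane M] [IsManifold (𝓡 2) ∞ M]

lemma inner_chartDeriv (g : Metric M) (x : M) (y v : Plane) :
    g.inner _ (chartDeriv x y v) (chartDeriv x y v) =
      g.inner _ (coordVec x y 0) (coordVec x y 0) * v 0 ^ 2 +
      2 * g.inner _ (coordVec x y 0) (coordVec x y 1) * v 0 * v 1 +
      g.inner _ (coordVec x y 1) (coordVec x y 1) * v 1 ^ 2 := by
  have h : chartDeriv x y v = v 0 • coordVec x y 0 + v 1 • coordVec x y 1 := by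
    unfold coordVec
    rw [← map_smul, ← map_smul, ← map_add]
    exact congrArg _ (plane_eq_sum v)
  rw [h]
  simp only [map_add, map_smul, add_apply, smul_apply, smul_eq_mul,
    g.symm _ (coordVec x y 1) (coordVec x y 0)]
  ring

lemma quadratic_nonneg {a b c : ℝ} (ha : 0 < a) (hd : 0 < a * c - b ^ 2) (s t : ℝ) :
    0 ≤ a * s ^ 2 + 2 * b * s * t + c * t ^ 2 := by
  have : a * s ^ 2 + 2 * b * s * t + c * t ^ 2 =
      ((a * s + b * t) ^ 2 + (a * c - b ^ 2) * t ^ 2) / a := by field_simp; ring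
  rw [this]; positivity

/-- Linear coordinates at the centre of a chart in which the metric is nearly Euclidean. -/
lemma exists_frozen_coordinates (g : Metric M) (x : M) {t : ℝ} (ht : 1 < t) :
    ∃ B : Plane ≃L[ℝ] Plane, 0 < (B : Plane →L[ℝ] Plane).det ∧ ∃ r > 0,
      ∀ y, ‖B (y - chartAt Plane x x)‖ ^ 2 ≤ r → y ∈ (chartAt Plane x).target ∧
        √(gram g x y).det ≤ t * (B : Plane →L[ℝ] Plane).det ∧
        (B : Plane →L[ℝ] Plane).det ≤ t * √(gram g x y).det ∧
        ∀ v, ‖B v‖ ^ 2 ≤ t * g.inner _ (chartDeriv x y v) (chartDeriv x y v) := by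
  set y₀ := chartAt Plane x x with hy₀
  have hyt : y₀ ∈ (chartAt Plane x).target := mem_chart_target Plane x
  let G (i j : Fin 2) (y : Plane) : ℝ := g.inner _ (coordVec x y i) (coordVec x y j)
  have hG (i j : Fin 2) : ContinuousAt (G i j) y₀ :=
    (gram_continuousOn g x i j).continuousAt ((chartAt Plane x).open_target.mem_nhds hyt)
  have hdet (y : Plane) : (gram g x y).det = G 0 0 y * G 1 1 y - G 0 1 y ^ 2 := gram_det g x y
  have hd := gram_det_pos g x hyt
  rw [hdet] at hd
  have ha : 0 < G 0 0 y₀ := by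
    refine g.pos _ _ fun h ↦ ?_
    have := coordVec_indep x hyt 1 0 (by simp [h])
    simp at this
  obtain ⟨B, hBdet, hB⟩ := exists_cholesky ha hd
  have hBpos : 0 < (B : Plane →L[ℝ] Plane).det := by rw [hBdet]; exact Real.sqrt_pos.2 hd
  refine ⟨B, hBpos, ?_⟩
  have hc : ContinuousAt (fun y ↦ √(gram g x y).det) y₀ := by
    simp only [hdet]
    exact (((hG 0 0).mul (hG 1 1)).sub ((hG 0 1).pow 2)).sqrt
  have hc0 : √(gram g x y₀).det = (B : Plane →L[ℝ] Plane).det := by rw [hBdet, hdet]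
  have ev (f : Plane → ℝ) (c : ℝ) (hf : ContinuousAt f y₀) (h : c < f y₀) :
      ∀ᶠ y in 𝓝 y₀, c < f y := hf.tendsto.eventually_const_lt h
  have hct (i j : Fin 2) : ContinuousAt (fun y ↦ t * G i j y - G i j y₀) y₀ :=
    (continuousAt_const.mul (hG i j)).sub continuousAt_const
  have e1 : ∀ᶠ y in 𝓝 y₀, √(gram g x y).det < t * (B : Plane →L[ℝ] Plane).det :=
    hc.tendsto.eventually_lt_const (by rw [hc0]; nlinarith)
  have e2 := ev (fun y ↦ t * √(gram g x y).det) (B : Plane →L[ℝ] Plane).det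
    (continuousAt_const.mul hc) (by simp only [hc0]; nlinarith)
  have e3 := ev (fun y ↦ t * G 0 0 y - G 0 0 y₀) 0 (hct 0 0) (by nlinarith)
  -- The form tG(y) - G(y₀) equals (t - 1)G(y₀) at y₀, which is positive definite. Positivity of its
  -- leading entry and its determinant persists nearby, giving ‖Bv‖² ≤ t g(v, v).
  have e4 := ev (fun y ↦ (t * G 0 0 y - G 0 0 y₀) * (t * G 1 1 y - G 1 1 y₀) -
      (t * G 0 1 y - G 0 1 y₀) ^ 2) 0 (((hct 0 0).mul (hct 1 1)).sub ((hct 0 1).pow 2)) (by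
    have : (t * G 0 0 y₀ - G 0 0 y₀) * (t * G 1 1 y₀ - G 1 1 y₀) -
        (t * G 0 1 y₀ - G 0 1 y₀) ^ 2 =
        (t - 1) ^ 2 * (G 0 0 y₀ * G 1 1 y₀ - G 0 1 y₀ ^ 2) := by ring
    rw [this]
    have : 0 < t - 1 := by linarith
    positivity)
  have e5 : ∀ᶠ y in 𝓝 y₀, y ∈ (chartAt Plane x).target :=
    (chartAt Plane x).open_target.mem_nhds hyt
  have hcont : Tendsto (fun z : Plane ↦ y₀ + B.symm z) (𝓝 0) (𝓝 y₀) := by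
    have : Continuous fun z : Plane ↦ y₀ + B.symm z := by fun_prop
    simpa using this.tendsto 0
  obtain ⟨ρ, hρ, hball⟩ := Metric.eventually_nhds_iff.1
    (hcont.eventually (e1.and (e2.and (e3.and (e4.and e5)))))
  refine ⟨(ρ / 2) ^ 2, by positivity, fun y hy ↦ ?_⟩
  have hlt : dist (B (y - y₀)) 0 < ρ := by
    rw [dist_zero_right]
    have := abs_le_of_sq_le_sq' hy (by positivity)
    linarith [this.2]
  obtain ⟨f1, f2, f3, f4, f5⟩ := hball hlt
  simp only [ContinuousLinearEquiv.symm_apply_apply, add_sub_cancel] at f1 f2 f3 f4 f5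
  refine ⟨f5, f1.le, f2.le, fun v ↦ ?_⟩
  have hq := quadratic_nonneg f3 f4 (v 0) (v 1)
  rw [hB, inner_chartDeriv]
  change _ ≤ t * (G 0 0 y * v 0 ^ 2 + 2 * G 0 1 y * v 0 * v 1 + G 1 1 y * v 1 ^ 2)
  linarith

end Frozen

/-! ### Concentrating test functions on the surface -/

section TestFunctions

variable {M : Type*} [TopologicalSpace M] [ChartedSpace Plane M] [IsManifold (𝓡 2) ∞ M]

/-- The function on `M` given by `F` in the preferred chart at `x`, extended by zero. -/
def extendChart (x : M) (F : Plane → ℝ) : M → ℝ :=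
  (chartAt Plane x).source.indicator fun p ↦ F (chartAt Plane x p)

lemma extendChart_symm (x : M) (F : Plane → ℝ) {y : Plane} (hy : y ∈ (chartAt Plane x).target) :
    extendChart x F ((chartAt Plane x).symm y) = F y := by
  rw [extendChart, indicator_of_mem ((chartAt Plane x).map_target hy),
    (chartAt Plane x).right_inv hy]

lemma extendChart_of_notMem {x p : M} (F : Plane → ℝ) (hp : p ∉ (chartAt Plane x).source) :
    extendChart x F p = 0 := indicator_of_notMem hp _

/-- In a Hausdorff space the compact image of the support is closed, so a point outside the chart
has a neighbourhood avoiding it. -/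
lemma extendChart_eventually_eq_zero [T2Space M] {x p : M} {F : Plane → ℝ} {K : Set Plane}
    (hK : IsCompact K) (hKt : K ⊆ (chartAt Plane x).target) (h0 : ∀ y, y ∉ K → F y = 0)
    (hp : p ∉ (chartAt Plane x).source) : extendChart x F =ᶠ[𝓝 p] fun _ ↦ 0 := by
  have hc : IsCompact ((chartAt Plane x).symm '' K) :=
    hK.image_of_continuousOn ((chartAt Plane x).continuousOn_symm.mono hKt)
  have hpn : p ∉ (chartAt Plane x).symm '' K := by
    rintro ⟨y, hy, rfl⟩
    exact hp ((chartAt Plane x).map_target (hKt hy))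
  filter_upwards [hc.isClosed.isOpen_compl.mem_nhds hpn] with q hq
  by_cases hqs : q ∈ (chartAt Plane x).source
  · rw [extendChart, indicator_of_mem hqs]
    refine h0 _ fun hqK ↦ hq ⟨_, hqK, (chartAt Plane x).left_inv hqs⟩
  · exact extendChart_of_notMem F hqs

lemma contMDiff_extendChart [T2Space M] {x : M} {F : Plane → ℝ} (hF : ContDiff ℝ 1 F)
    {K : Set Plane} (hK : IsCompact K) (hKt : K ⊆ (chartAt Plane x).target)
    (h0 : ∀ y, y ∉ K → F y = 0) : ContMDiff (𝓡 2) 𝓘(ℝ, ℝ) 1 (extendChart x F) := by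
  intro p
  by_cases hp : p ∈ (chartAt Plane x).source
  · have h1 : ContMDiffOn (𝓡 2) (𝓡 2) ∞ (chartAt Plane x) (chartAt Plane x).source :=
      contMDiffOn_chart
    have h2 : ContMDiffAt (𝓡 2) (𝓡 2) 1 (chartAt Plane x) p :=
      (h1.of_le (by norm_num)).contMDiffAt ((chartAt Plane x).open_source.mem_nhds hp)
    have h3 : ContMDiffAt (𝓡 2) 𝓘(ℝ, ℝ) 1 (fun p ↦ F (chartAt Plane x p)) p :=
      (hF.contMDiff.contMDiffAt).comp p h2
    refine h3.congr_of_eventuallyEq ?_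
    filter_upwards [(chartAt Plane x).open_source.mem_nhds hp] with q hq
    exact indicator_of_mem hq _
  · exact contMDiffAt_const.congr_of_eventuallyEq (extendChart_eventually_eq_zero hK hKt h0 hp)

lemma gradField_sq_eq_zero {g : Metric M} {w : M → ℝ} {p : M} {c : ℝ}
    (hw : w =ᶠ[𝓝 p] fun _ ↦ c) : g.inner p (gradField g w p) (gradField g w p) = 0 := by
  rw [inner_gradField, hw.mfderiv_eq, mfderiv_const]
  rfl

variable [MeasurableSpace M] [BorelSpace M]

/-- On the region where `h` can be nonzero the density is at most t·det B, and the linear change of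
variables cancels det B. Only the distortion t remains. -/
lemma lintegral_le_of_frozen (g : Metric M) {x : M} {B : Plane ≃L[ℝ] Plane}
    (hB : 0 < (B : Plane →L[ℝ] Plane).det) {t r : ℝ} (ht : 0 < t)
    (hr : ∀ y, ‖B (y - chartAt Plane x x)‖ ^ 2 ≤ r →
      √(gram g x y).det ≤ t * (B : Plane →L[ℝ] Plane).det)
    {f : M → ℝ≥0∞} (hf : Measurable f) (hf0 : ∀ p, p ∉ (chartAt Plane x).source → f p = 0)
    {h : Plane → ℝ≥0∞} (hh : Measurable h) (hh0 : ∀ z, r < ‖z‖ ^ 2 → h z = 0)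
    (hfh : ∀ y ∈ (chartAt Plane x).target,
      f ((chartAt Plane x).symm y) ≤ h (B (y - chartAt Plane x x))) :
    ∫⁻ p, f p ∂(riemannianVolume g) ≤ ENNReal.ofReal t * ∫⁻ z, h z := by
  have h1 : ∫⁻ p, f p ∂(riemannianVolume g) =
      ∫⁻ p in (chartAt Plane x).source, f p ∂(riemannianVolume g) := by
    rw [← lintegral_indicator (chartAt Plane x).open_source.measurableSet]
    refine lintegral_congr fun p ↦ ?_
    by_cases hp : p ∈ (chartAt Plane x).source
    · rw [indicator_of_mem hp]
    · rw [indicator_of_notMem hp, hf0 p hp]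
  rw [h1, setLIntegral_source g x hf]
  calc _ ≤ ∫⁻ y in (chartAt Plane x).target,
        ENNReal.ofReal (t * (B : Plane →L[ℝ] Plane).det) * h (B (y - chartAt Plane x x)) := by
        refine setLIntegral_mono' (chartAt Plane x).open_target.measurableSet fun y hy ↦ ?_
        by_cases hyr : ‖B (y - chartAt Plane x x)‖ ^ 2 ≤ r
        · exact mul_le_mul' (ENNReal.ofReal_le_ofReal (hr y hyr)) (hfh y hy)
        · have := hfh y hy
          rw [hh0 _ (not_le.1 hyr), nonpos_iff_eq_zero] at this
          rw [this, mul_zero]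
          exact zero_le
    _ ≤ ∫⁻ y, ENNReal.ofReal (t * (B : Plane →L[ℝ] Plane).det) * h (B (y - chartAt Plane x x)) :=
        setLIntegral_le_lintegral _ _
    _ = _ := by
        rw [lintegral_const_mul _ (by fun_prop), lintegral_comp_affine B hB _ hh,
          ← mul_assoc, ← ENNReal.ofReal_mul (by positivity), mul_assoc, mul_inv_cancel₀ hB.ne',
          mul_one]

lemma le_lintegral_of_frozen (g : Metric M) {x : M} {B : Plane ≃L[ℝ] Plane}
    (hB : 0 < (B : Plane →L[ℝ] Plane).det) {t r : ℝ} (ht : 0 < t)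
    (hr : ∀ y, ‖B (y - chartAt Plane x x)‖ ^ 2 ≤ r → y ∈ (chartAt Plane x).target ∧
      (B : Plane →L[ℝ] Plane).det ≤ t * √(gram g x y).det)
    {f : M → ℝ≥0∞} (hf : Measurable f)
    {h : Plane → ℝ≥0∞} (hh : Measurable h) (hh0 : ∀ z, r < ‖z‖ ^ 2 → h z = 0)
    (hfh : ∀ y ∈ (chartAt Plane x).target,
      h (B (y - chartAt Plane x x)) ≤ f ((chartAt Plane x).symm y)) :
    ENNReal.ofReal t⁻¹ * ∫⁻ z, h z ≤ ∫⁻ p, f p ∂(riemannianVolume g) := by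
  refine le_trans ?_ (setLIntegral_le_lintegral (chartAt Plane x).source f)
  rw [setLIntegral_source g x hf]
  calc _ = ∫⁻ y, ENNReal.ofReal (t⁻¹ * (B : Plane →L[ℝ] Plane).det) *
        h (B (y - chartAt Plane x x)) := by
        rw [lintegral_const_mul _ (by fun_prop), lintegral_comp_affine B hB _ hh,
          ← mul_assoc, ← ENNReal.ofReal_mul (by positivity), mul_assoc, mul_inv_cancel₀ hB.ne',
          mul_one]
    _ = ∫⁻ y in (chartAt Plane x).target, ENNReal.ofReal (t⁻¹ * (B : Plane →L[ℝ] Plane).det) *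
        h (B (y - chartAt Plane x x)) := by
        rw [← lintegral_indicator (chartAt Plane x).open_target.measurableSet]
        refine lintegral_congr fun y ↦ ?_
        by_cases hy : y ∈ (chartAt Plane x).target
        · rw [indicator_of_mem hy]
        · rw [indicator_of_notMem hy, hh0 _ (not_le.1 fun hh ↦ hy (hr y hh).1), mul_zero]
    _ ≤ _ := by
        refine setLIntegral_mono' (chartAt Plane x).open_target.measurableSet fun y hy ↦ ?_
        by_cases hyr : ‖B (y - chartAt Plane x x)‖ ^ 2 ≤ r
        · refine mul_le_mul' (ENNReal.ofReal_le_ofReal ?_) (hfh y hy)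
          rw [inv_mul_le_iff₀ ht]
          exact (hr y hyr).2
        · rw [hh0 _ (not_le.1 hyr), mul_zero]
          exact zero_le

variable [CompactSpace M] [T2Space M]

/-- Concentrating test functions. -/
lemma exists_bubble (g : Metric M) [IsFiniteMeasure (riemannianVolume g)]
    (ha : 0 < area g) {t : ℝ} (ht : 1 < t) :
    ∃ r > 0, ∀ ε δ : ℝ, 0 < ε → ε ≤ 1 → 0 < δ → δ ≤ r → ∃ u : E g,
      ‖u‖ ^ 2 ≤ t ^ 2 * (16 * Real.pi * (Real.log (ε + 1) - Real.log ε)) ∧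
      Real.log (Real.pi * δ / (9 * t * area g)) - Real.log ε -
        2 * (Real.log (ε + 1) - Real.log ε) * (t * Real.pi * δ) / area g ≤ u.potential := by
  have hne : Nonempty M := by
    by_contra h
    rw [not_nonempty_iff] at h
    have : area g = 0 := by simp [area, univ_eq_empty_iff.2 h]
    exact ha.ne' this
  obtain ⟨x⟩ := hne
  have ht0 : 0 < t := zero_lt_one.trans ht
  obtain ⟨B, hB, r, hr, hr'⟩ := exists_frozen_coordinates g x ht
  refine ⟨r, hr, fun ε δ hε hε1 hδ hδr ↦ ?_⟩
  set y₀ := chartAt Plane x x with hy₀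
  set L := Real.log (ε + 1) - Real.log ε with hL
  have hL0 : 0 ≤ L := sub_nonneg.2 (Real.log_le_log hε (by linarith))
  set F : Plane → ℝ := fun y ↦ bubble ε δ (B (y - y₀)) with hF
  set K : Set Plane := {y | ‖B (y - y₀)‖ ^ 2 ≤ r} with hK
  have hKc : IsCompact K := by
    have h1 : IsCompact ((fun z : Plane ↦ B.symm z + y₀) '' Metric.closedBall 0 (√r)) :=
      (isCompact_closedBall _ _).image (by fun_prop)
    convert h1 using 1
    ext y
    simp only [hK, mem_ofPred_eq, mem_image, mem_closedBall_zero_iff]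
    constructor
    · intro hy
      exact ⟨B (y - y₀), Real.le_sqrt_of_sq_le hy, by simp⟩
    · rintro ⟨z, hz, rfl⟩
      simpa using (Real.le_sqrt (norm_nonneg _) hr.le).1 hz
  have hKt : K ⊆ (chartAt Plane x).target := fun y hy ↦ (hr' y hy).1
  have hF0 (y : Plane) (hy : y ∉ K) : F y = 0 :=
    bubble_eq_zero hδ (hδr.trans (not_le.1 hy).le)
  have hFd : ContDiff ℝ 1 F := (contDiff_bubble hε hδ).comp (by fun_prop)
  set w := extendChart x F with hw
  have hwd : ContMDiff (𝓡 2) 𝓘(ℝ, ℝ) 1 w := contMDiff_extendChart hFd hKc hKt hF0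
  have hw0 (p : M) : 0 ≤ w p := indicator_nonneg (fun p _ ↦ bubble_nonneg hε hδ _) p
  have hwm := hwd.continuous.measurable
  obtain ⟨Cw, hCw⟩ := isCompact_univ.exists_bound_of_continuousOn hwd.continuous.continuousOn
  have hwi : Integrable w (riemannianVolume g) :=
    Integrable.of_bound hwm.aestronglyMeasurable Cw
      (Eventually.of_forall fun p ↦ hCw p (mem_univ p))
  set m := (∫ p, w p ∂(riemannianVolume g)) / area g with hm
  -- the mean value
  have hmean : ∫ p, w p ∂(riemannianVolume g) ≤ 2 * L * (t * Real.pi * δ) := by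
    rw [integral_eq_lintegral_of_nonneg_ae (Eventually.of_forall hw0) hwm.aestronglyMeasurable]
    refine ENNReal.toReal_le_of_le_ofReal (by positivity) ?_
    have hs : MeasurableSet {z : Plane | ‖z‖ ^ 2 ≤ δ} :=
      (isClosed_le (by fun_prop) continuous_const).measurableSet
    refine (lintegral_le_of_frozen g hB ht0 (fun y hy ↦ (hr' y hy).2.1) hwm.ennreal_ofReal
      (fun p hp ↦ by rw [hw, extendChart_of_notMem F hp, ENNReal.ofReal_zero])
      (h := {z : Plane | ‖z‖ ^ 2 ≤ δ}.indicator fun _ ↦ ENNReal.ofReal (2 * L))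
      (measurable_const.indicator hs) (fun z hz ↦ ?_) (fun y hy ↦ ?_)).trans ?_
    · have : z ∉ {z : Plane | ‖z‖ ^ 2 ≤ δ} := (hδr.trans_lt hz).not_ge
      exact indicator_of_notMem this _
    · rw [hw, extendChart_symm x F hy]
      by_cases hyd : ‖B (y - y₀)‖ ^ 2 ≤ δ
      · rw [indicator_of_mem (by exact hyd)]
        exact ENNReal.ofReal_le_ofReal (bubble_le hε hδ _)
      · rw [hF]
        simp only
        rw [bubble_eq_zero hδ (not_le.1 hyd).le, ENNReal.ofReal_zero]
        exact zero_le
    · rw [lintegral_indicator_const hs, volume_norm_sq_le hδ.le,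
        ← ENNReal.ofReal_mul (by positivity),
        ← ENNReal.ofReal_mul ht0.le]
      exact ENNReal.ofReal_le_ofReal (le_of_eq (by ring))
  -- the exponential integral
  have hexpi : Integrable (fun p ↦ Real.exp (w p)) (riemannianVolume g) := by
    refine Integrable.of_bound (by fun_prop) (Real.exp Cw) (Eventually.of_forall fun p ↦ ?_)
    rw [Real.norm_eq_abs, Real.abs_exp]
    exact Real.exp_le_exp.2 ((le_abs_self _).trans (hCw p (mem_univ p)))
  have hexp : Real.pi * δ / (9 * t * ε) ≤ ∫ p, Real.exp (w p) ∂(riemannianVolume g) := by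
    rw [← ENNReal.ofReal_le_ofReal_iff (integral_nonneg fun p ↦ (Real.exp_pos _).le),
      ofReal_integral_eq_lintegral_ofReal hexpi (Eventually.of_forall fun p ↦ (Real.exp_pos _).le)]
    have hs : MeasurableSet {z : Plane | ‖z‖ ^ 2 ≤ ε * δ} :=
      (isClosed_le (by fun_prop) continuous_const).measurableSet
    have hεδ : ε * δ ≤ r := (mul_le_of_le_one_left hδ.le hε1).trans hδr
    refine le_trans ?_ (le_lintegral_of_frozen g hB ht0
      (fun y hy ↦ ⟨(hr' y hy).1, (hr' y hy).2.2.1⟩)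
      (f := fun p ↦ ENNReal.ofReal (Real.exp (w p))) (by fun_prop)
      (h := {z : Plane | ‖z‖ ^ 2 ≤ ε * δ}.indicator fun _ ↦ ENNReal.ofReal ((1 / (3 * ε)) ^ 2))
      (measurable_const.indicator hs) (fun z hz ↦ ?_) (fun y hy ↦ ?_))
    · rw [lintegral_indicator_const hs, volume_norm_sq_le (by positivity),
        ← ENNReal.ofReal_mul (by positivity), ← ENNReal.ofReal_mul (by positivity)]
      refine ENNReal.ofReal_le_ofReal (le_of_eq ?_)
      field_simp
      ring
    · have : z ∉ {z : Plane | ‖z‖ ^ 2 ≤ ε * δ} := (hεδ.trans_lt hz).not_ge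
      exact indicator_of_notMem this _
    · rw [hw, extendChart_symm x F hy]
      by_cases hyd : ‖B (y - y₀)‖ ^ 2 ≤ ε * δ
      · rw [indicator_of_mem (by exact hyd)]
        exact ENNReal.ofReal_le_ofReal (le_exp_bubble hε hδ hyd)
      · rw [indicator_of_notMem (by exact hyd)]
        exact zero_le
  -- the element of the Sobolev space
  set v : M → ℝ := fun p ↦ w p - m with hv
  have hvd : ContMDiff (𝓡 2) 𝓘(ℝ, ℝ) 1 v := hwd.sub contMDiff_const
  have hv0 : ∫ p, v p ∂(riemannianVolume g) = 0 := by
    rw [hv, integral_sub hwi (integrable_const _), integral_const, smul_eq_mul]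
    change _ - area g * m = 0
    rw [hm]
    field_simp
    ring
  -- One factor t comes from the volume, the other from the metric in the gradient estimate.
  have henergy : fieldEnergy g (gradField g v) ≤
      ENNReal.ofReal (t ^ 2 * (16 * Real.pi * L)) := by
    refine (lintegral_le_of_frozen g hB ht0 (fun y hy ↦ (hr' y hy).2.1)
      (measurable_gradField_sq hvd).ennreal_ofReal (fun p hp ↦ ?_)
      (h := fun z ↦ ENNReal.ofReal t * ENNReal.ofReal (bubbleDensity ε δ ‖z‖))
      ((measurable_bubbleDensity.comp measurable_norm).ennreal_ofReal.const_mul _)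
      (fun z hz ↦ ?_) (fun y hy ↦ ?_)).trans ?_
    · have h1 := extendChart_eventually_eq_zero hKc hKt hF0 hp
      have h2 : v =ᶠ[𝓝 p] fun _ ↦ 0 - m := by
        filter_upwards [h1] with q hq
        rw [hv, hw]
        simp only [hq]
      rw [gradField_sq_eq_zero h2, ENNReal.ofReal_zero]
    · rw [bubbleDensity_eq_zero hδ (hδr.trans hz.le), ENNReal.ofReal_zero, mul_zero]
    · rw [← ENNReal.ofReal_mul ht0.le]
      refine ENNReal.ofReal_le_ofReal ?_
      have hsurj : Function.Surjective (chartDeriv x y) :=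
        (mdifferentiable_chart (I := 𝓡 2) x).symm.mfderiv_surjective (x := y) hy
      obtain ⟨e, he⟩ := hsurj (gradField g v ((chartAt Plane x).symm y))
      set N := g.inner _ (gradField g v ((chartAt Plane x).symm y))
        (gradField g v ((chartAt Plane x).symm y)) with hN
      have hN0 : 0 ≤ N := metric_nonneg g _ _
      -- The gradient itself is used as direction: |∇v|² is the derivative of v along ∇v, which in
      -- frozen coordinates is the derivative of the bubble along Be.
      have hNe : N = fderiv ℝ (bubble ε δ) (B (y - y₀)) (B e) := by
        have h1 := inner_gradField_chartDeriv (g := g) hvd x hy e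
        rw [he] at h1
        rw [hN, h1]
        have h2 : (fun y ↦ v ((chartAt Plane x).symm y)) =ᶠ[𝓝 y] fun y ↦ F y - m := by
          filter_upwards [(chartAt Plane x).open_target.mem_nhds hy] with q hq
          rw [hv, hw]
          simp only [extendChart_symm x F hq]
        rw [h2.fderiv_eq, fderiv_sub_const]
        have h3 : HasFDerivAt (fun y ↦ B (y - y₀)) (B : Plane →L[ℝ] Plane) y :=
          (B : Plane →L[ℝ] Plane).hasFDerivAt.comp y ((hasFDerivAt_id y).sub_const y₀)
        have h4 := ((contDiff_bubble hε hδ).differentiable one_ne_zero (B (y - y₀))).hasFDerivAt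
        have h5 := HasFDerivAt.comp (g := bubble ε δ) y h4 h3
        have h6 : fderiv ℝ F y =
          (fderiv ℝ (bubble ε δ) (B (y - y₀))).comp (B : Plane →L[ℝ] Plane) := h5.fderiv
        rw [h6]
        rfl
      have hsq := fderiv_bubble_sq_le hε hδ (B (y - y₀)) (B e)
      rw [← hNe] at hsq
      have hd0 := bubbleDensity_nonneg hε hδ ‖B (y - y₀)‖
      by_cases hyr : ‖B (y - y₀)‖ ^ 2 ≤ r
      · have h5 := (hr' y hyr).2.2.2 e
        rw [he] at h5
        -- Dividing N² ≤ density · tN by N, when N > 0, bounds N itself.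
        have h6 : N ^ 2 ≤ bubbleDensity ε δ ‖B (y - y₀)‖ * (t * N) :=
          hsq.trans (mul_le_mul_of_nonneg_left h5 hd0)
        rcases hN0.eq_or_lt with h7 | h7
        · rw [← h7]; positivity
        · nlinarith
      · rw [bubbleDensity_eq_zero hδ (hδr.trans (not_le.1 hyr).le), zero_mul] at hsq
        have : N = 0 := by nlinarith
        rw [this]; positivity
    · have hbm : Measurable fun z : Plane ↦ ENNReal.ofReal (bubbleDensity ε δ ‖z‖) :=
        (measurable_bubbleDensity.comp measurable_norm).ennreal_ofReal
      rw [lintegral_const_mul _ hbm, lintegral_bubbleDensity hε hδ,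
        ← ENNReal.ofReal_mul ht0.le, ← ENNReal.ofReal_mul ht0.le]
      exact ENNReal.ofReal_le_ofReal (le_of_eq (by ring))
  obtain ⟨u, hu, hun⟩ := exists_E_of_contMDiff hvd
    (henergy.trans_lt ENNReal.ofReal_lt_top).ne hv0
  refine ⟨u, ?_, ?_⟩
  · rw [← hun, ENNReal.ofReal_le_ofReal_iff (by positivity)] at henergy
    exact henergy
  -- Removing the mean multiplies the exponential integral by e^{-m}, so the potential is log ∫ e^w
  -- - log |M| - m.
  · have h1 : ∫ q, Real.exp (u.fn q) ∂(riemannianVolume g) =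
        Real.exp (-m) * ∫ q, Real.exp (w q) ∂(riemannianVolume g) := by
      rw [← integral_const_mul]
      refine integral_congr_ae ?_
      filter_upwards [hu] with q hq
      rw [hq, ← Real.exp_add, hv]
      congr 1; ring
    have hpos : 0 < Real.pi * δ / (9 * t * ε) := by positivity
    have hI := hpos.trans_le hexp
    rw [E.potential, h1, Real.log_mul (by positivity) (by positivity),
      Real.log_mul (by positivity) hI.ne', Real.log_exp, one_div, Real.log_inv]
    have h2 := Real.log_le_log hpos hexp
    have h3 : Real.log (Real.pi * δ / (9 * t * area g)) - Real.log ε =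
        Real.log (Real.pi * δ / (9 * t * ε)) - Real.log (area g) := by
      rw [← Real.log_div (by positivity) hε.ne', ← Real.log_div (by positivity) ha.ne']
      congr 1
      field_simp
    have h4 : m ≤ 2 * L * (t * Real.pi * δ) / area g := by
      rw [hm]; gcongr
    rw [h3]
    linarith

/-- With L ≈ log(1/ε), the bubble has ½‖u‖² ≤ 8πt²L approximately, and its potential is at least L
up to a constant and a mean correction proportional to δL. Since l > 8π, taking t near 1, δ small
and then ε → 0 sends the difference to -∞. -/
lemma exists_energy_lt (g : Metric M) [IsFiniteMeasure (riemannianVolume g)]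
    (ha : 0 < area g) {l : ℝ} (hl : 8 * Real.pi < l) (C : ℝ) :
    ∃ u : E g, 1 / 2 * ‖u‖ ^ 2 - l * u.potential < C := by
  have hπ := Real.pi_pos
  have hl0 : 0 < l := by linarith
  obtain ⟨t, ht, htl⟩ : ∃ t : ℝ, 1 < t ∧ 8 * Real.pi * t ^ 2 < l := by
    have h1 : 1 < l / (8 * Real.pi) := by rwa [one_lt_div (by positivity)]
    refine ⟨√((1 + l / (8 * Real.pi)) / 2), ?_, ?_⟩
    · rw [Real.lt_sqrt zero_le_one]; linarith
    · rw [Real.sq_sqrt (by positivity)]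
      have : 8 * Real.pi * (l / (8 * Real.pi)) = l := by field_simp
      nlinarith
  have ht0 : 0 < t := by linarith
  obtain ⟨r, hr, h⟩ := exists_bubble g ha ht
  -- Half of the gap pays for the mean correction, through the choice of δ; the other half drives
  -- the energy down.
  set c := (l - 8 * Real.pi * t ^ 2) / 2 with hc
  have hc0 : 0 < c := by rw [hc]; linarith
  set δ := min r (c * area g / (2 * l * t * Real.pi)) with hδ
  have hδ0 : 0 < δ := by positivity
  have hδ1 : l * (2 * (t * Real.pi * δ) / area g) ≤ c := by
    have := min_le_right r (c * area g / (2 * l * t * Real.pi))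
    rw [← hδ, le_div_iff₀ (by positivity)] at this
    rw [← mul_div_assoc, div_le_iff₀ ha]
    linarith
  set A := Real.log (Real.pi * δ / (9 * t * area g)) with hA
  -- With ε = e^{-N} the energy is at most l log 2 - lA - cN; the maximum with 0 ensures ε ≤ 1.
  set N := max 0 ((l * Real.log 2 - l * A - C) / c + 1) with hN
  have hN0 : 0 ≤ N := le_max_left _ _
  have hN1 : l * Real.log 2 - l * A - C < c * N := by
    have h1 : (l * Real.log 2 - l * A - C) / c < N :=
      lt_of_lt_of_le (lt_add_one _) (le_max_right _ _)
    rw [div_lt_iff₀ hc0] at h1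
    linarith
  have hε1 : Real.exp (-N) ≤ 1 := Real.exp_le_one_iff.2 (by linarith)
  obtain ⟨u, hu1, hu2⟩ := h (Real.exp (-N)) δ (Real.exp_pos _) hε1 hδ0 (min_le_left _ _)
  refine ⟨u, ?_⟩
  rw [Real.log_exp] at hu1 hu2
  set q := Real.log (Real.exp (-N) + 1) with hq
  have hq0 : 0 ≤ q := Real.log_nonneg (by linarith [Real.exp_pos (-N)])
  have hq2 : q ≤ Real.log 2 := Real.log_le_log (by positivity) (by linarith)
  have e1 : l * (2 * (q - -N) * (t * Real.pi * δ) / area g) ≤ c * (q + N) := by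
    calc l * (2 * (q - -N) * (t * Real.pi * δ) / area g)
        = l * (2 * (t * Real.pi * δ) / area g) * (q + N) := by ring
      _ ≤ _ := by gcongr
  have e2 := mul_le_mul_of_nonneg_left hu2 hl0.le
  have e3 : 8 * Real.pi * t ^ 2 = l - 2 * c := by rw [hc]; ring
  have e4 : 1 / 2 * ‖u‖ ^ 2 ≤ (l - 2 * c) * (q + N) := by
    rw [← e3]; linarith
  have e5 : l * q ≤ l * Real.log 2 := by gcongr
  have e6 : 0 ≤ c * q := by positivity
  nlinarith

end TestFunctions

/-! ### Negative values of the functional and the conclusion -/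

section Main

variable {M : Type*} [TopologicalSpace M] [T2Space M] [CompactSpace M] [ChartedSpace Plane M]
  [IsManifold (𝓡 2) ∞ M] [MeasurableSpace M] [BorelSpace M]

/-- Both potentials are nonnegative, so the one with the smaller parameter can be dropped. The
bubble is used as it is or with reversed sign, according to which parameter exceeds 8π, and is taken
below the infimum over the unit ball so that its norm is at least 1. -/
lemma exists_functional_neg (g : Metric M) [IsFiniteMeasure (riemannianVolume g)]
    (hμ : 0 < firstEigenvalue g) (ha : 0 < area g) {l : ℝ × ℝ} (hl : l ∈ paramSet g) :
    ∃ u : E g, 1 ≤ ‖u‖ ∧ functional g l u < 0 := by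
  obtain ⟨h1, h2, -, h4⟩ := hl
  obtain ⟨C, hC⟩ := E.exists_functional_ge (g := g) hμ ha h1 h2
  suffices h : ∃ u : E g, functional g l u < -max C 0 by
    obtain ⟨u, hu⟩ := h
    refine ⟨u, ?_, hu.trans_le (neg_nonpos.2 (le_max_right _ _))⟩
    by_contra hlt
    have := hC u (not_le.1 hlt).le
    linarith [le_max_left C 0]
  rcases lt_max_iff.1 h4 with h | h
  · obtain ⟨u, hu⟩ := exists_energy_lt g ha h (-max C 0)
    refine ⟨u, lt_of_le_of_lt ?_ hu⟩
    rw [functional_eq]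
    linarith [mul_nonneg h2 (E.potential_nonneg hμ ha (-u))]
  · obtain ⟨u, hu⟩ := exists_energy_lt g ha h (-max C 0)
    refine ⟨-u, lt_of_le_of_lt ?_ hu⟩
    rw [functional_eq, neg_neg, norm_neg]
    linarith [mul_nonneg h1 (E.potential_nonneg hμ ha (-u))]

end Main

end MeanField

end

theorem proposition3 {M : Type*} [TopologicalSpace M] [T2Space M] [CompactSpace M]
    [ChartedSpace MeanField.Plane M] [IsManifold (𝓡 2) ∞ M] [MeasurableSpace M] [BorelSpace M]
    (g : MeanField.Metric M) (horient : MeanField.IsOrientable M)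
    (hlower : 8 * Real.pi < MeanField.firstEigenvalue g * MeanField.area g)
    (hupper : MeanField.firstEigenvalue g * MeanField.area g < 16 * Real.pi) :
    ∀ᵐ l ∂(volume : Measure (ℝ × ℝ)), l ∈ MeanField.paramSet g →
      (∃ ubar : MeanField.E g, 1 ≤ ‖ubar‖ ∧ MeanField.functional g l ubar < 0) ∧
      ∀ ubar : MeanField.E g, 1 ≤ ‖ubar‖ → MeanField.functional g l ubar < 0 →
        0 < MeanField.mountainPassLevel g l ubar ∧
        ∃ u : MeanField.E g, u ≠ 0 ∧
          HasFDerivAt (MeanField.functional g l) (0 : MeanField.E g →L[ℝ] ℝ) u ∧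
          MeanField.functional g l u = MeanField.mountainPassLevel g l ubar := by
  have hpos : 0 < MeanField.firstEigenvalue g * MeanField.area g :=
    lt_trans (by positivity) hlower
  have ha : 0 < MeanField.area g := by
    refine lt_of_le_of_ne measureReal_nonneg fun h ↦ ?_
    rw [← h, mul_zero] at hpos
    exact lt_irrefl _ hpos
  have hμ : 0 < MeanField.firstEigenvalue g := (mul_pos_iff_of_pos_right ha).1 hpos
  -- An infinite volume would have real value 0 by convention, contradicting positive area.
  have hfin : IsFiniteMeasure (MeanField.riemannianVolume g) := by
    refine ⟨lt_top_iff_ne_top.2 fun h ↦ ha.ne' ?_⟩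
    rw [MeanField.area, Measure.real, h, ENNReal.toReal_top]
  let _ := MeanField.E.normedAddCommGroup hμ
  have _ := MeanField.E.completeSpace hμ
  have _ := MeanField.E.separableSpace hμ
  obtain ⟨p, hp⟩ := MeanField.E.exists_isCompactPotential hμ ha
  -- The second potential is the reflection of the first, so one compact potential serves both.
  filter_upwards [MeanField.ae_mountainPass hp hp.neg] with l hl hmem
  refine ⟨MeanField.exists_functional_neg g hμ ha hmem, fun ubar _ hneg ↦ ?_⟩
  obtain ⟨h1, h2, h3, -⟩ := hmem
  have hmin := MeanField.E.exists_local_min (g := g) hμ ha h1 h2 h3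
  rw [MeanField.functional_eq_energy hμ] at hmin hneg ⊢
  rw [MeanField.mountainPassLevel_eq_energyLevel hμ]
  exact hl h1 h2 hmin ubar hneg
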